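/- **Conventions.** A geodesic space $X$ is $\delta$-hyperbolic if, for every geodesic triangle with vertices $x,y,z$, points $y'\in[x,y]$ and $z'\in[x,z]$ with $d(x,y')=d(x,z')\le (y|z)_x$ satisfy $d(y',z')\le\delta$, where $(y|z)_x=\frac12\bigl(d(x,y)+d(x,z)-d(y,z)\bigr)$. Its boundary $\partial X$ is the set of geodesic rays up to bounded distance; $X$ is *visual* if, for some $w\in X$ and $C<\infty$, every point of $X$ is within $C$ of a geodesic ray based at $w$. A metric $d$ on $\partial X$ is *visual* if for some $w\in X$, $a>1$, $c_1,c_2>0$ one has $c_1a^{-(\xi|\xi')_w}\le d(\xi,\xi')\le c_2a^{-(\xi|\xi')_w}$ for all $\xi,\xi'\in\partial X$, where $(\xi|\xi')_w$ is the infimum of $\liminf_i (y_i|z_i)_w$ over all sequences $y_i\to\xi$, $z_i\to\xi'$ in $X$. A map $\partial X\to\partial X'$ is a *quasisymmetry* if, with respect to some (equivalently, every) choice of visual metrics, it is a homeomorphism $f$ for which there is a homeomorphism $\eta\colon[0,\infty)\to[0,\infty)$ such that $d(x,a)\le t\,d(x,b)$ implies $d(f(x),f(a))\le\eta(t)\,d(f(x),f(b))$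 for all $t\ge 0$ and all $x,a,b$. A map $f$ of metric spaces is *coarse Lipschitz* if $d(f(x),f(y))\le\lambda d(x,y)+\epsilon$ for some constants $\lambda\ge1,\epsilon\ge0$, and a *quasi-isometry* if moreover it has a coarse Lipschitz coarse inverse (both compositions at bounded distance from the identity). A *horofunction* about $\eta\in\partial X$ is a function $h\colon X\to\mathbb R$ for which there is a constant $D$ such that $|h(w)-h(x)-d(x,w)|\le D$ whenever $w$ is within $5\delta$ of a ray from $x$ to $\eta$. An *open horoball* about $\eta$ is an open set of the form $\{h>0\}$ with $h$ a horofunction about $\eta$. For a group $\Gamma$ acting on $X$ by isometries, a *parabolic point* is a point of $\partial X$ that is the unique fixed point of some infinite subgroup of $\Gamma$, and a *maximal parabolic subgroup* is the stabilizer of a parabolic point. Let $\mathbb P$ be a finite family of subgroups of $\Gamma$. An action of $(\Gamma,\mathbb P)$ on $X$ is *cusp uniform* if $X$ is a proper, visual $\delta$-hyperbolic space, $\Gamma$ acts properly discontinuously by isometries, $\mathbb P$ is a set of representatives of the conjugacy classes of maximal parabolic subgroups, and there is a $\Gamma$-equivariant family of disjoint open horoballs about parabolic points on the complement of whose union $\Gamma$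 acts cocompactly. Then $X$ is a *cusped space* for $(\Gamma,\mathbb P)$ if this family can be chosen so that each horoball $B$ in it has *constant horospherical distortion*: the stabilizer $P$ of $B$ has a finite generating set $\mathcal T$ and, for a base point $y_0\in B$, there are a bilipschitz homeomorphism $g\colon[0,\infty)\to[0,\infty)$ and a constant $b>0$ such that $\frac1b\exp g\bigl(d_X(py_0,p'y_0)\bigr)\le d_{\mathcal T}(p,p')\le b\exp g\bigl(d_X(py_0,p'y_0)\bigr)$ for all distinct $p,p'\in P$. Finitely generated groups carry the word metric of a finite generating set. A *coarse Lipschitz map of pairs* $(\Gamma,\mathbb P)\to(\Gamma',\mathbb P')$ is a coarse Lipschitz map $\phi\colon\Gamma\to\Gamma'$ for which there is a constant $R$ such that for all $P\in\mathbb P$ and $\gamma\in\Gamma$ there are $P'\in\mathbb P'$ and $\gamma'\in\Gamma'$ with $\phi(\gamma P)\subseteq\mathcal N_R(\gamma'P')$. A *quasi-isometry of pairs* is a coarse Lipschitz map of pairs with a coarse inverse that is also a coarse Lipschitz map of pairs. An *isomorphism of pairs* is a group isomorphism that carries the conjugacy classes of the members of $\mathbb P$ onto those of the members of $\mathbb P'$.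 A map $\hat\phi\colon X\to X'$ *extends* $\phi$ if for all $x\in X$ and $x'\in X'$ the distance $d\bigl(\hat\phi(\gamma x),\phi(\gamma)x'\bigr)$ is bounded over $\gamma\in\Gamma$. **Theorem.** Let $\Gamma$ and $\Gamma'$ be finitely generated groups, and let $X$ and $X'$ be cusped spaces for pairs $(\Gamma,\mathbb P)$ and $(\Gamma',\mathbb P')$. 1. Every coarse Lipschitz map of pairs $\phi\colon(\Gamma,\mathbb P)\to(\Gamma',\mathbb P')$ extends to a coarse Lipschitz map $\hat\phi\colon X\to X'$. 2. Every quasi-isometry of pairs $\phi\colon(\Gamma,\mathbb P)\to(\Gamma',\mathbb P')$ extends to a quasi-isometry $\hat\phi\colon X\to X'$, and $\hat\phi$ induces a quasisymmetry $\partial\hat\phi\colon\partial X\to\partial X'$, in the sense that $\hat\phi(y_i)\to\partial\hat\phi(\xi)$ whenever $y_i\in X$ and $y_i\to\xi\in\partial X$. 3. Every isomorphism of pairs $\Phi\colon(\Gamma,\mathbb P)\to(\Gamma',\mathbb P')$ extends to a quasi-isometry $\hat\Phi\colon X\to X'$ that is roughly equivariant, i.e. $d\bigl(\hat\Phi(\gamma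 x),\Phi(\gamma)\hat\Phi(x)\bigr)$ is bounded over all $\gamma\in\Gamma$ and $x\in X$, and that induces an equivariant quasisymmetry $\partial\hat\Phi\colon\partial X\to\partial X'$, i.e. $\partial\hat\Phi(\gamma\xi)=\Phi(\gamma)\,\partial\hat\Phi(\xi)$. In particular, if $(\Gamma,\mathbb P)=(\Gamma',\mathbb P')$, then the identity map of $\Gamma$ extends to a roughly $\Gamma$-equivariant quasi-isometry $X\to X'$ that induces a $\Gamma$-equivariant quasisymmetry. -/

import Mathlib

open Filter Topology
open scoped NNReal ENNReal Pointwise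

namespace CuspedSpaces

/-! ### Word metrics -/

section WordMetric

variable {G : Type*} [Group G]

/-- The word length of `g` with respect to `S`: the least length of a word in the letters
`S ∪ S⁻¹` that represents `g`. It is only used for sets `S` that generate `G`. -/
noncomputable def wordLength (S : Set G) (g : G) : ℕ :=
  sInf {n : ℕ | ∃ l : List G, l.length = n ∧ (∀ s ∈ l, s ∈ S ∨ s⁻¹ ∈ S) ∧ l.prod = g}

/-- The left-invariant word metric `d_S(g, h) = |g⁻¹ h|_S`. -/
noncomputable def wordDist (S : Set G) (g h : G) : ℝ :=
  (wordLength S (g⁻¹ * h) : ℝ)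

/-- `S` is a finite generating set of `G`. -/
structure IsFiniteGeneratingSet (S : Set G) : Prop where
  finite : S.Finite
  closure_eq : Subgroup.closure S = ⊤

end WordMetric

/-! ### Coarse Lipschitz maps and quasi-isometries

These are stated for explicit distance functions, since they are applied both to metric spaces
(with `dist`) and to groups (with a word metric). -/

section Coarse

variable {A B : Type*}

/-- `f` is `(L, ε)`-coarse Lipschitz from `(A, dA)` to `(B, dB)` for some `L ≥ 1` and `ε ≥ 0`. -/
def IsCoarseLipschitz (dA : A → A → ℝ) (dB : B → B → ℝ) (f : A → B) : Prop :=
  ∃ L ε : ℝ, 1 ≤ L ∧ 0 ≤ ε ∧ ∀ a b : A, dB (f a) (f b) ≤ L * dA a b + ε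

/-- `g ∘ f` and `f ∘ g` are at finite sup-distance from the identity maps. -/
def IsCoarseInverse (dA : A → A → ℝ) (dB : B → B → ℝ) (f : A → B) (g : B → A) : Prop :=
  ∃ ε : ℝ, (∀ a : A, dA (g (f a)) a ≤ ε) ∧ ∀ b : B, dB (f (g b)) b ≤ ε

/-- `f` is a quasi-isometry: a coarse Lipschitz map with a coarse Lipschitz coarse inverse. -/
def IsQuasiIsometry (dA : A → A → ℝ) (dB : B → B → ℝ) (f : A → B) : Prop :=
  IsCoarseLipschitz dA dB f ∧
    ∃ g : B → A, IsCoarseLipschitz dB dA g ∧ IsCoarseInverse dA dB f g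

end Coarse

/-! ### Maps of group pairs -/

section Pairs

variable {G G' : Type*} [Group G] [Group G']

/-- A coarse Lipschitz map of pairs `(G, ℙ) → (G', ℙ')`, with respect to the word metrics of
`S` and `S'`: a coarse Lipschitz map for which some constant `R` has the property that the image
of every left coset `γP` with `P ∈ ℙ` lies in the closed `R`-neighborhood of some left coset
`γ'P'` with `P' ∈ ℙ'`. -/
def IsCoarseLipschitzMapOfPairs (S : Set G) (ℙ : Set (Subgroup G)) (S' : Set G')
    (ℙ' : Set (Subgroup G')) (φ : G → G') : Prop :=
  IsCoarseLipschitz (wordDist S) (wordDist S') φ ∧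
    ∃ R : ℝ, ∀ P ∈ ℙ, ∀ γ : G, ∃ P' ∈ ℙ', ∃ γ' : G',
      ∀ p ∈ P, ∃ p' ∈ P', wordDist S' (φ (γ * p)) (γ' * p') ≤ R

/-- A quasi-isometry of pairs: a coarse Lipschitz map of pairs with a coarse inverse that is also
a coarse Lipschitz map of pairs. -/
def IsQuasiIsometryOfPairs (S : Set G) (ℙ : Set (Subgroup G)) (S' : Set G')
    (ℙ' : Set (Subgroup G')) (φ : G → G') : Prop :=
  IsCoarseLipschitzMapOfPairs S ℙ S' ℙ' φ ∧
    ∃ ψ : G' → G, IsCoarseLipschitzMapOfPairs S' ℙ' S ℙ ψ ∧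
      IsCoarseInverse (wordDist S) (wordDist S') φ ψ

/-- Two subgroups are conjugate. -/
def AreConjugate (P Q : Subgroup G) : Prop :=
  ∃ g : G, P.map (MulAut.conj g).toMonoidHom = Q

/-- An isomorphism of pairs: a group isomorphism that carries the conjugacy classes of members of
`ℙ` onto the conjugacy classes of members of `ℙ'`. -/
def IsIsomorphismOfPairs (ℙ : Set (Subgroup G)) (ℙ' : Set (Subgroup G')) (Φ : G ≃* G') : Prop :=
  (∀ P ∈ ℙ, ∃ P' ∈ ℙ', AreConjugate (P.map Φ.toMonoidHom) P') ∧
    ∀ P' ∈ ℙ', ∃ P ∈ ℙ, AreConjugate (P.map Φ.toMonoidHom) P'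

end Pairs

/-! ### Hyperbolic spaces and their boundaries -/

section Hyperbolic

variable {X : Type*} [MetricSpace X]

/-- The Gromov product `(y|z)_x`. -/
noncomputable def gromovProduct (x y z : X) : ℝ :=
  (dist x y + dist x z - dist y z) / 2

variable (X) in
/-- Any two points are joined by a geodesic segment. -/
def IsGeodesicSpace : Prop :=
  ∀ x y : X, ∃ c : ℝ → X, c 0 = x ∧ c (dist x y) = y ∧
    ∀ s ∈ Set.Icc 0 (dist x y), ∀ t ∈ Set.Icc 0 (dist x y), dist (c s) (c t) = |s - t|

variable (X) in
/-- `X` is a `δ`-hyperbolic geodesic space: for each geodesic triangle with vertices `x, y, z`,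
points `y' ∈ [x, y]` and `z' ∈ [x, z]` with `d(x, y') = d(x, z') ≤ (y|z)_x` satisfy
`d(y', z') ≤ δ`. In a geodesic space, a point `y'` lies on some geodesic segment `[x, y]` exactly
when `d(x, y') + d(y', y) = d(x, y)`. -/
def IsHyperbolic (δ : ℝ) : Prop :=
  IsGeodesicSpace X ∧
    ∀ x y z y' z' : X, dist x y' + dist y' y = dist x y → dist x z' + dist z' z = dist x z →
      dist x y' = dist x z' → dist x y' ≤ gromovProduct x y z → dist y' z' ≤ δ

variable (X) in
/-- Geodesic rays in `X`. -/
@[ext]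
structure GeodesicRay where
  /-- The underlying map. -/
  toFun : ℝ≥0 → X
  isometry : Isometry toFun

variable (X) in
/-- Two rays are asymptotic if `d(c(t), c'(t))` is bounded. -/
instance asymptotic : Setoid (GeodesicRay X) where
  r c c' := ∃ M : ℝ, ∀ t : ℝ≥0, dist (c.toFun t) (c'.toFun t) ≤ M
  iseqv :=
    { refl := fun _ => ⟨0, fun _ => (dist_self _).le⟩
      symm := fun ⟨M, h⟩ => ⟨M, fun t => (dist_comm _ _).trans_le (h t)⟩
      trans := fun ⟨M, h⟩ ⟨N, k⟩ =>
        ⟨M + N, fun t => (dist_triangle _ _ _).trans (add_le_add (h t) (k t))⟩ }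

variable (X) in
/-- The Gromov boundary `∂X`: asymptote classes of geodesic rays. -/
def GromovBoundary : Type _ := Quotient (asymptotic X)

/-- The point at infinity of a ray. -/
def GeodesicRay.endpoint (c : GeodesicRay X) : GromovBoundary X := Quotient.mk (asymptotic X) c

variable (X) in
/-- `X` is visual: for some base point `w` and some constant `C`, every point of `X` is within `C`
of a geodesic ray based at `w`. -/
def IsVisual : Prop :=
  ∃ (w : X) (C : ℝ), ∀ x : X, ∃ c : GeodesicRay X, c.toFun 0 = w ∧ ∃ t : ℝ≥0, dist x (c.toFun t) ≤ C

/-- The sequence `y` of points of `X` converges to `ξ ∈ ∂X` in `X ∪ ∂X`: for a ray `c` ending at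
`ξ`, the Gromov products `(y_i|c(t))` tend to infinity as `i, t → ∞`. (In a proper hyperbolic space
this depends neither on the ray nor on the base point.) -/
def ConvergesToBoundary (y : ℕ → X) (ξ : GromovBoundary X) : Prop :=
  ∃ c : GeodesicRay X, c.endpoint = ξ ∧
    Tendsto (fun p : ℕ × ℝ≥0 => gromovProduct (c.toFun 0) (y p.1) (c.toFun p.2))
      (atTop ×ˢ atTop) atTop

/-- The extended Gromov product `(ξ|ξ')_w = inf liminf (y_i|z_i)_w ∈ [0, ∞]`, the infimum being
over all sequences `y_i → ξ` and `z_i → ξ'` in `X`. -/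
noncomputable def boundaryGromovProduct (w : X) (ξ ξ' : GromovBoundary X) : ℝ≥0∞ :=
  ⨅ (y : ℕ → X) (z : ℕ → X) (_ : ConvergesToBoundary y ξ) (_ : ConvergesToBoundary z ξ'),
    liminf (fun i => ENNReal.ofReal (gromovProduct w (y i) (z i))) atTop

open scoped Classical in
/-- `a ^ (-p)` for `p ∈ [0, ∞]`, with `a ^ (-∞) = 0`. -/
noncomputable def negPow (a : ℝ) (p : ℝ≥0∞) : ℝ :=
  if p = ∞ then 0 else a ^ (-p.toReal)

/-- The metric `m` on `∂X` is a visual metric (for some base point `w` and parameter `a > 1`). -/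
def IsVisualMetric (m : MetricSpace (GromovBoundary X)) : Prop :=
  ∃ (w : X) (a c₁ c₂ : ℝ), 1 < a ∧ 0 < c₁ ∧ 0 < c₂ ∧ ∀ ξ ξ' : GromovBoundary X,
    c₁ * negPow a (boundaryGromovProduct w ξ ξ') ≤ m.dist ξ ξ' ∧
      m.dist ξ ξ' ≤ c₂ * negPow a (boundaryGromovProduct w ξ ξ')

/-- `h` is a horofunction about `η`, where `X` is `δ`-hyperbolic: for some constant `D`, if `w` is
within `5δ` of a ray from `x` to `η`, then `h(w) - h(x)` is within `D` of `d(x, w)`. So `h`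
increases towards `η`. -/
def IsHorofunction (δ : ℝ) (η : GromovBoundary X) (h : X → ℝ) : Prop :=
  ∃ D : ℝ, ∀ (x w : X) (c : GeodesicRay X), c.toFun 0 = x → c.endpoint = η →
    (∃ t : ℝ≥0, dist w (c.toFun t) ≤ 5 * δ) → |h w - h x - dist x w| ≤ D

/-- `B` is an open horoball about `η`: an open set on which some horofunction about `η`, in the
above convention, is positive and outside of which it is not. -/
def IsOpenHoroball (δ : ℝ) (η : GromovBoundary X) (B : Set X) : Prop :=
  IsOpen B ∧ ∃ h : X → ℝ, IsHorofunction δ η h ∧ B = {x | 0 < h x}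

end Hyperbolic

/-! ### Quasisymmetries -/

section Quasisymmetry

/-- `f` is a quasisymmetry: a homeomorphism that is `η`-quasisymmetric for some homeomorphism
`η : [0, ∞) → [0, ∞)`. -/
def IsQuasisymmetry {Z Z' : Type*} [MetricSpace Z] [MetricSpace Z'] (f : Z → Z') : Prop :=
  IsHomeomorph f ∧ ∃ η : ℝ≥0 ≃ₜ ℝ≥0, ∀ (t : ℝ≥0) (x a b : Z),
    dist x a ≤ t * dist x b → dist (f x) (f a) ≤ η t * dist (f x) (f b)

/-- A map of Gromov boundaries is a quasisymmetry if it is one with respect to some, and every,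
choice of visual metrics. -/
def IsBoundaryQuasisymmetry {X X' : Type*} [MetricSpace X] [MetricSpace X']
    (f : GromovBoundary X → GromovBoundary X') : Prop :=
  (∃ m : MetricSpace (GromovBoundary X), IsVisualMetric m) ∧
    (∃ m' : MetricSpace (GromovBoundary X'), IsVisualMetric m') ∧
    ∀ (m : MetricSpace (GromovBoundary X)) (m' : MetricSpace (GromovBoundary X')),
      IsVisualMetric m → IsVisualMetric m' → @IsQuasisymmetry _ _ m m' f

/-- `f` is the boundary map induced by `F`: whenever a sequence `y` in `X` converges to `ξ ∈ ∂X`,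
the sequence `F ∘ y` converges to `f(ξ)`. -/
def InducesOnBoundary {X X' : Type*} [MetricSpace X] [MetricSpace X'] (F : X → X')
    (f : GromovBoundary X → GromovBoundary X') : Prop :=
  ∀ (ξ : GromovBoundary X) (y : ℕ → X), ConvergesToBoundary y ξ →
    ConvergesToBoundary (fun i => F (y i)) (f ξ)

end Quasisymmetry

/-! ### Cusp-uniform actions and cusped spaces -/

section Actions

variable {G : Type*} [Group G] {X : Type*} [MetricSpace X] [MulAction G X] [IsIsometricSMul G X]

instance : SMul G (GeodesicRay X) where
  smul g c := ⟨fun t => g • c.toFun t, (isometry_smul X g).comp c.isometry⟩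

instance : MulAction G (GeodesicRay X) where
  one_smul c := GeodesicRay.ext (funext fun t => one_smul G (c.toFun t))
  mul_smul g h c := GeodesicRay.ext (funext fun t => mul_smul g h (c.toFun t))

/-- The action of `G` on `∂X` induced by an isometric action on `X`. -/
instance : MulAction G (GromovBoundary X) where
  smul g := Quotient.map (g • ·) fun _ _ ⟨M, hM⟩ =>
    ⟨M, fun t => (dist_smul g _ _).trans_le (hM t)⟩
  one_smul ξ := Quotient.inductionOn ξ fun c => congrArg (Quotient.mk _) (one_smul G c)
  mul_smul g h ξ := Quotient.inductionOn ξ fun c => congrArg (Quotient.mk _) (mul_smul g h c)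

variable (G) in
/-- `η ∈ ∂X` is a parabolic point: the unique fixed point in `∂X` of some infinite subgroup. -/
def IsParabolicPoint (η : GromovBoundary X) : Prop :=
  ∃ H : Subgroup G, Infinite H ∧ ∀ ξ : GromovBoundary X, (∀ h ∈ H, h • ξ = ξ) ↔ ξ = η

variable (X) in
/-- `Q` is a maximal parabolic subgroup: the stabilizer of a parabolic point. -/
def IsMaximalParabolic (Q : Subgroup G) : Prop :=
  ∃ η : GromovBoundary X, IsParabolicPoint G η ∧ Q = MulAction.stabilizer G η

/-- The action of `(G, ℙ)` on `X` is cusp uniform, with `ℬ` as the family of horoballs: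
`X` is a proper, visual `δ`-hyperbolic space on which `G` acts properly discontinuously (and
isometrically), the finite family `ℙ` represents each conjugacy class of maximal parabolic
subgroups exactly once, and `ℬ` is an equivariant family of disjoint open horoballs about parabolic
points on whose complement `G` acts cocompactly. -/
structure IsCuspUniform (ℙ : Set (Subgroup G)) (δ : ℝ) (ℬ : Set (Set X)) : Prop where
  proper : ProperSpace X
  hyperbolic : IsHyperbolic X δ
  visual : IsVisual X
  properlyDiscontinuous : ProperlyDiscontinuousSMul G X
  finite_peripheral : ℙ.Finite
  peripheral_parabolic : ∀ P ∈ ℙ, IsMaximalParabolic X P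
  parabolic_conj : ∀ Q : Subgroup G, IsMaximalParabolic X Q → ∃! P, P ∈ ℙ ∧ AreConjugate P Q
  horoball : ∀ B ∈ ℬ, ∃ η : GromovBoundary X, IsParabolicPoint G η ∧ IsOpenHoroball δ η B
  smul_mem : ∀ (g : G), ∀ B ∈ ℬ, g • B ∈ ℬ
  disjoint : ℬ.PairwiseDisjoint id
  cocompact : ∃ K : Set X, IsCompact K ∧ (⋃₀ ℬ)ᶜ ⊆ ⋃ g : G, g • K

/-- The horoball `B`, with the action of the subgroup `P`, has constant horospherical distortion:
for a base point `y₀` of `B` and a finite generating set `T` of `P` there are a bilipschitz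
homeomorphism `g : [0, ∞) → [0, ∞)` and a constant `b` such that
`b⁻¹ exp g(d(p y₀, p' y₀)) ≤ d_T(p, p') ≤ b exp g(d(p y₀, p' y₀))` for all distinct `p, p' ∈ P`. -/
def HasConstantHorosphericalDistortion (P : Subgroup G) (B : Set X) : Prop :=
  ∃ y₀ ∈ B, ∃ T : Set P, IsFiniteGeneratingSet T ∧
    ∃ (g : ℝ≥0 ≃ₜ ℝ≥0) (K : ℝ≥0) (b : ℝ), LipschitzWith K g ∧ AntilipschitzWith K g ∧ 0 < b ∧
      ∀ p p' : P, p ≠ p' →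
        b⁻¹ * Real.exp (g (nndist (p • y₀) (p' • y₀))) ≤ wordDist T p p' ∧
          wordDist T p p' ≤ b * Real.exp (g (nndist (p • y₀) (p' • y₀)))

variable (X) in
/-- `X` is a cusped space for the pair `(G, ℙ)`: the action is cusp uniform with respect to some
family of horoballs, each of which has constant horospherical distortion with respect to its
stabilizer. -/
def IsCuspedSpace (ℙ : Set (Subgroup G)) : Prop :=
  ∃ (δ : ℝ) (ℬ : Set (Set X)), IsCuspUniform ℙ δ ℬ ∧
    ∀ B ∈ ℬ, HasConstantHorosphericalDistortion (MulAction.stabilizer G B) B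

end Actions

/-! ### Cusp extensions -/

section Extension

variable {G G' X X' : Type*} [Group G] [Group G'] [MetricSpace X] [MetricSpace X']
  [MulAction G X] [MulAction G' X']

/-- `F : X → X'` extends (is induced by) `φ : G → G'`: for all base points `x` and `x'`, the
distance `d(F(γx), φ(γ)x')` is uniformly bounded over `γ ∈ G`. -/
def IsCuspExtension (φ : G → G') (F : X → X') : Prop :=
  ∀ (x : X) (x' : X'), ∃ M : ℝ, ∀ γ : G, dist (F (γ • x)) (φ γ • x') ≤ M

/-- `F` is roughly equivariant with respect to `φ`: `F ∘ γ` and `φ(γ) ∘ F` are at uniformly bounded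
sup-distance. -/
def IsRoughlyEquivariant (φ : G → G') (F : X → X') : Prop :=
  ∃ ν : ℝ, ∀ (γ : G) (x : X), dist (F (γ • x)) (φ γ • F x) ≤ ν

end Extension

end CuspedSpaces

namespace CuspedSpaces

/-! ### Gromov products -/

section GromovProduct

variable {X : Type*} [MetricSpace X]

/-! A cusped space has a coarse normal form, recorded in `CuspModel`. Up to bounded distance it is
an orbit Γo together with the translates γ c_P of rays c_P that run from o to the parabolic points
of the P ∈ ℙ. Rays attached to distinct peripheral cosets stay apart away from the orbit. The rays
at γ and γp with p ∈ P merge at depth about d(o, po)/2. By constant horospherical distortion this is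
the depth t at which exp (g_P t) is the word length of p in P, up to a bounded factor. So word
metrics determine where the rays merge.

A coarse Lipschitz map of pairs sends cosets near cosets and enlarges word lengths inside them at
most linearly. Sending depth t in a cusp of P to the depth t' in a cusp of P' with g_{P'} t' = g_P t
(`depthMap`) matches the two exponentials, so a bounded factor in word length costs only a bounded
distance. This defines a multivalued correspondence from X to X' (`Corresponds`). The central
estimate is `IsCosetMap.exists_dist_le`: points at bounded distance have correspondents at bounded
distance. Hence any selection F extends φ and, since X is geodesic, is coarse Lipschitz; it is
roughly equivariant if the relation between cosets is equivariant. For quasi-isometries of pairs,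
distinct peripheral cosets have bounded coarse intersection (`CuspModel.eq_of_coset_near`), so the
coset relations of φ and ψ undo each other, and so do the extensions.

The model exists (`exists_cuspModel`) once every parabolic point is known to be the center of a
horoball of the family. If one were not, a ray to it would return to a neighborhood of the orbit
forever. A group fixing its endpoint then either coarsely preserves a horofunction and is finite, or
contains an element with a drift towards the point, whose repelling point is fixed by the whole
group. Both contradict parabolicity. Disjointness of the horoballs makes stabilizers cocompact on
frontiers, and visuality then covers each horoball by neighborhoods of translates of a single ray.

For the boundary, the positive part of (x|a)_w - (x|b)_w is, up to bounded error, the distance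
between geodesics [w,b] and [x,a]. By the Morse lemma a quasi-isometry distorts it at most linearly
(`IsQIEmbedding.crossDiff_bounds`). Visual metrics are exponentials of Gromov products, so linear
control of differences becomes power control of ratios of distances, which is quasisymmetry. -/

theorem gromovProduct_comm (w x y : X) : gromovProduct w x y = gromovProduct w y x := by
  simp only [gromovProduct, dist_comm x y]; ring

theorem gromovProduct_nonneg (w x y : X) : 0 ≤ gromovProduct w x y := by
  have := dist_triangle_left x y w
  simp only [gromovProduct]; linarith

theorem gromovProduct_self (w x : X) : gromovProduct w x x = dist w x := by
  simp [gromovProduct]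

theorem gromovProduct_le_left (w x y : X) : gromovProduct w x y ≤ dist w x := by
  have := dist_triangle w x y
  simp only [gromovProduct]; linarith

theorem gromovProduct_le_right (w x y : X) : gromovProduct w x y ≤ dist w y := by
  rw [gromovProduct_comm]; exact gromovProduct_le_left w y x

theorem gromovProduct_le_add_base (w w' x y : X) :
    gromovProduct w x y ≤ gromovProduct w' x y + dist w w' := by
  have := dist_triangle w w' x
  have := dist_triangle w w' y
  simp only [gromovProduct]; linarith

theorem gromovProduct_le_add_left (w x x' y : X) :
    gromovProduct w x y ≤ gromovProduct w x' y + dist x x' := by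
  have := dist_triangle_right w x x'
  have := dist_triangle_left x' y x
  simp only [gromovProduct]; linarith

theorem gromovProduct_le_add_right (w x y y' : X) :
    gromovProduct w x y ≤ gromovProduct w x y' + dist y y' := by
  rw [gromovProduct_comm w x y, gromovProduct_comm w x y']
  exact gromovProduct_le_add_left w y y' x

theorem sub_dist_le_gromovProduct (w x y : X) : dist w x - dist x y ≤ gromovProduct w x y := by
  have := dist_triangle_right w x y
  simp only [gromovProduct]; linarith

theorem gromovProduct_smul {G : Type*} [Group G] [MulAction G X] [IsIsometricSMul G X] (g : G)
    (w x y : X) : gromovProduct (g • w) (g • x) (g • y) = gromovProduct w x y := by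
  simp [gromovProduct]

theorem IsGeodesicSpace.exists_between (h : IsGeodesicSpace X) (x y : X) {t : ℝ} (h0 : 0 ≤ t)
    (h1 : t ≤ dist x y) : ∃ u : X, dist x u = t ∧ dist u y = dist x y - t := by
  obtain ⟨c, hx, hy, hc⟩ := h x y
  refine ⟨c t, ?_, ?_⟩
  · have := hc 0 ⟨le_rfl, dist_nonneg⟩ t ⟨h0, h1⟩
    rw [hx] at this
    rw [this, zero_sub, abs_neg, abs_of_nonneg h0]
  · have := hc t ⟨h0, h1⟩ (dist x y) ⟨dist_nonneg, le_rfl⟩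
    rw [hy] at this
    rw [this, abs_sub_comm, abs_of_nonneg (by linarith)]

theorem IsHyperbolic.nonneg {δ : ℝ} (h : IsHyperbolic X δ) (x : X) : 0 ≤ δ := by
  have := h.2 x x x x x (by simp) (by simp) rfl (by simp [gromovProduct])
  simpa using this

/-- The four point condition. -/
theorem IsHyperbolic.four_point {δ : ℝ} (h : IsHyperbolic X δ) (w x y z : X) :
    min (gromovProduct w x y) (gromovProduct w y z) - δ ≤ gromovProduct w x z := by
  set m := min (gromovProduct w x y) (gromovProduct w y z) with hm
  have m0 : 0 ≤ m := le_min (gromovProduct_nonneg _ _ _) (gromovProduct_nonneg _ _ _)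
  have mx : m ≤ gromovProduct w x y := min_le_left _ _
  have mz : m ≤ gromovProduct w y z := min_le_right _ _
  -- The points at the common distance m from w on geodesics to x, y, z are successively within δ,
  -- so d(x', z') ≤ 2δ, and the path x, x', z', z bounds d(x, z).
  obtain ⟨x', hx1, hx2⟩ := h.1.exists_between w x m0 (mx.trans (gromovProduct_le_left _ _ _))
  obtain ⟨y', hy1, hy2⟩ := h.1.exists_between w y m0 (mx.trans (gromovProduct_le_right _ _ _))
  obtain ⟨z', hz1, hz2⟩ := h.1.exists_between w z m0 (mz.trans (gromovProduct_le_right _ _ _))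
  have h1 := h.2 w x y x' y' (by linarith) (by linarith) (by linarith) (by linarith)
  have h2 := h.2 w y z y' z' (by linarith) (by linarith) (by linarith) (by linarith)
  have h3 := dist_triangle x x' z
  have h4 := dist_triangle x' y' z
  have h5 := dist_triangle y' z' z
  rw [dist_comm x x'] at h3
  simp only [gromovProduct]
  linarith

/-- The four point condition for a chain of `N ≤ 2 ^ k` steps. -/
theorem IsHyperbolic.chain {δ : ℝ} (h : IsHyperbolic X δ) (z : X) (μ : ℝ) (k : ℕ) :
    ∀ (f : ℕ → X) (N : ℕ), 1 ≤ N → N ≤ 2 ^ k →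
      (∀ i < N, μ ≤ gromovProduct z (f i) (f (i + 1))) → μ - k * δ ≤ gromovProduct z (f 0) (f N) := by
  have hδ := h.nonneg z
  induction k with
  | zero =>
    intro f N h1 h2 hf
    obtain rfl : N = 1 := by simp at h2; omega
    simpa using hf 0 (by norm_num)
  | succ k ih =>
    intro f N h1 h2 hf
    push_cast
    by_cases hN : N ≤ 2 ^ k
    · have := ih f N h1 hN hf
      linarith
    · push Not at hN
      -- Cutting the chain at position 2 ^ k leaves two chains of at most 2 ^ k steps. Joining them
      -- costs one more δ, so the total loss is only logarithmic in the length.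
      have a1 := ih f (2 ^ k) Nat.one_le_two_pow le_rfl fun i hi => hf i (hi.trans hN)
      have a2 := ih (fun i => f (2 ^ k + i)) (N - 2 ^ k) (by omega) (by rw [pow_succ] at h2; omega)
        fun i hi => hf (2 ^ k + i) (by omega)
      simp only [add_zero, Nat.add_sub_cancel' hN.le] at a2
      have := h.four_point z (f 0) (f (2 ^ k)) (f N)
      have := le_min a1 a2
      linarith

end GromovProduct

/-! ### Rays and convergence to the boundary -/

section Rays

variable {X : Type*} [MetricSpace X] {δ : ℝ}

theorem GeodesicRay.dist_eq (c : GeodesicRay X) (s t : ℝ≥0) :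
    dist (c.toFun s) (c.toFun t) = |(s : ℝ) - t| := by
  rw [c.isometry.dist_eq, NNReal.dist_eq]

theorem GeodesicRay.dist_zero (c : GeodesicRay X) (t : ℝ≥0) :
    dist (c.toFun 0) (c.toFun t) = t := by
  rw [c.dist_eq]; simp

theorem GeodesicRay.dist_of_le (c : GeodesicRay X) {s t : ℝ≥0} (h : s ≤ t) :
    dist (c.toFun s) (c.toFun t) = t - s := by
  rw [c.dist_eq, abs_sub_comm, abs_of_nonneg]
  have : (s : ℝ) ≤ t := h
  linarith

theorem endpoint_eq_iff {c c' : GeodesicRay X} :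
    c.endpoint = c'.endpoint ↔ ∃ M : ℝ, ∀ t, dist (c.toFun t) (c'.toFun t) ≤ M :=
  ⟨fun h => Quotient.exact h, fun h => Quotient.sound h⟩

theorem exists_endpoint (ξ : GromovBoundary X) : ∃ c : GeodesicRay X, c.endpoint = ξ :=
  ⟨Quotient.out ξ, Quotient.out_eq ξ⟩

/-- The Gromov products `(y_i|c(t))_w` tend to infinity. -/
def TendsToRay (w : X) (y : ℕ → X) (c : GeodesicRay X) : Prop :=
  ∀ M : ℝ, ∃ N : ℕ, ∀ i ≥ N, ∀ t : ℝ≥0, (N : ℝ≥0) ≤ t → M ≤ gromovProduct w (y i) (c.toFun t)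

theorem tendsToRay_iff_tendsto {w : X} {y : ℕ → X} {c : GeodesicRay X} :
    TendsToRay w y c ↔ Tendsto (fun p : ℕ × ℝ≥0 => gromovProduct w (y p.1) (c.toFun p.2))
      (atTop ×ˢ atTop) atTop := by
  rw [tendsto_atTop]
  constructor
  · intro h M
    obtain ⟨N, hN⟩ := h M
    filter_upwards [(eventually_ge_atTop N).prod_mk (eventually_ge_atTop (N : ℝ≥0))] with p hp
    exact hN _ hp.1 _ hp.2
  · intro h M
    obtain ⟨pa, ha, pb, hb, hab⟩ := eventually_prod_iff.1 (h M)
    obtain ⟨n1, h1⟩ := eventually_atTop.1 ha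
    obtain ⟨t2, h2⟩ := eventually_atTop.1 hb
    obtain ⟨n2, hn2⟩ := exists_nat_ge t2
    refine ⟨max n1 n2, fun i hi t ht => hab (h1 i (le_of_max_le_left hi)) (h2 t ?_)⟩
    refine hn2.trans (le_trans ?_ ht)
    exact_mod_cast le_max_right n1 n2

theorem TendsToRay.base {w : X} {y : ℕ → X} {c : GeodesicRay X} (h : TendsToRay w y c) (w' : X) :
    TendsToRay w' y c := fun M => by
  obtain ⟨N, hN⟩ := h (M + dist w w')
  refine ⟨N, fun i hi t ht => ?_⟩
  have := hN i hi t ht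
  have := gromovProduct_le_add_base w w' (y i) (c.toFun t)
  linarith

theorem TendsToRay.ray {w : X} {y : ℕ → X} {c c' : GeodesicRay X} (h : TendsToRay w y c)
    (hc : c.endpoint = c'.endpoint) : TendsToRay w y c' := fun M => by
  obtain ⟨B, hB⟩ := endpoint_eq_iff.1 hc
  obtain ⟨N, hN⟩ := h (M + B)
  refine ⟨N, fun i hi t ht => ?_⟩
  have := hN i hi t ht
  have := gromovProduct_le_add_right w (y i) (c.toFun t) (c'.toFun t)
  linarith [hB t]

theorem convergesToBoundary_iff {y : ℕ → X} {c : GeodesicRay X} (w : X) :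
    ConvergesToBoundary y c.endpoint ↔ TendsToRay w y c := by
  constructor
  · rintro ⟨c', hc', h⟩
    exact ((tendsToRay_iff_tendsto.2 h).ray hc').base w
  · intro h
    exact ⟨c, rfl, tendsToRay_iff_tendsto.1 (h.base _)⟩

theorem GeodesicRay.gromovProduct_eq (c : GeodesicRay X) {s t : ℝ≥0} (h : s ≤ t) :
    gromovProduct (c.toFun 0) (c.toFun s) (c.toFun t) = s := by
  simp only [gromovProduct, c.dist_zero, c.dist_of_le h]; ring

theorem GeodesicRay.le_gromovProduct (c : GeodesicRay X) {r s t : ℝ≥0} (h : r ≤ s) (h' : r ≤ t) :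
    (r : ℝ) ≤ gromovProduct (c.toFun 0) (c.toFun s) (c.toFun t) := by
  rcases le_total s t with hst | hst
  · rw [c.gromovProduct_eq hst]; exact h
  · rw [gromovProduct_comm, c.gromovProduct_eq hst]; exact h'

theorem GeodesicRay.convergesToBoundary (c : GeodesicRay X) :
    ConvergesToBoundary (fun n : ℕ => c.toFun n) c.endpoint := by
  rw [convergesToBoundary_iff (c.toFun 0)]
  intro M
  obtain ⟨N, hN⟩ := exists_nat_ge M
  refine ⟨N, fun i hi t ht => hN.trans ?_⟩
  have := c.le_gromovProduct (r := N) (s := i) (by exact_mod_cast hi) ht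
  simpa using this

/-- Gromov products of sequences with a common limit tend to infinity. -/
theorem IsHyperbolic.gromovProduct_large (hX : IsHyperbolic X δ) {y z : ℕ → X}
    {ξ : GromovBoundary X} (hy : ConvergesToBoundary y ξ) (hz : ConvergesToBoundary z ξ) (w : X)
    (M : ℝ) : ∃ N : ℕ, ∀ i ≥ N, ∀ j ≥ N, M ≤ gromovProduct w (y i) (z j) := by
  obtain ⟨c, rfl⟩ := exists_endpoint ξ
  rw [convergesToBoundary_iff w] at hy hz
  obtain ⟨N1, h1⟩ := hy (M + δ)
  obtain ⟨N2, h2⟩ := hz (M + δ)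
  refine ⟨max N1 N2, fun i hi j hj => ?_⟩
  have a1 := h1 i (le_of_max_le_left hi) (max N1 N2 : ℕ) (by exact_mod_cast le_max_left _ _)
  have a2 := h2 j (le_of_max_le_right hj) (max N1 N2 : ℕ) (by exact_mod_cast le_max_right _ _)
  rw [gromovProduct_comm] at a2
  have := hX.four_point w (y i) (c.toFun (max N1 N2 : ℕ)) (z j)
  have := le_min a1 a2
  linarith

theorem IsHyperbolic.convergesToBoundary_of_gromovProduct (hX : IsHyperbolic X δ) {y z : ℕ → X}
    {ξ : GromovBoundary X} (hy : ConvergesToBoundary y ξ) (w : X)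
    (h : ∀ M : ℝ, ∃ N : ℕ, ∀ i ≥ N, M ≤ gromovProduct w (y i) (z i)) :
    ConvergesToBoundary z ξ := by
  obtain ⟨c, rfl⟩ := exists_endpoint ξ
  rw [convergesToBoundary_iff w] at hy ⊢
  intro M
  obtain ⟨N1, h1⟩ := hy (M + δ)
  obtain ⟨N2, h2⟩ := h (M + δ)
  refine ⟨max N1 N2, fun i hi t ht => ?_⟩
  have a1 := h1 i (le_of_max_le_left hi) t (le_trans (by exact_mod_cast le_max_left _ _) ht)
  have a2 := h2 i (le_of_max_le_right hi)
  rw [gromovProduct_comm] at a2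
  have := hX.four_point w (z i) (y i) (c.toFun t)
  have := le_min a2 a1
  linarith

theorem IsHyperbolic.dist_large (hX : IsHyperbolic X δ) {y : ℕ → X}
    {ξ : GromovBoundary X} (hy : ConvergesToBoundary y ξ) (w : X)
    (M : ℝ) : ∃ N : ℕ, ∀ i ≥ N, M ≤ dist w (y i) := by
  obtain ⟨N, hN⟩ := hX.gromovProduct_large hy hy w M
  exact ⟨N, fun i hi => (hN i hi i hi).trans (gromovProduct_le_left _ _ _)⟩

theorem IsHyperbolic.convergesToBoundary_of_dist (hX : IsHyperbolic X δ) {y z : ℕ → X}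
    {ξ : GromovBoundary X} (hy : ConvergesToBoundary y ξ) {B : ℝ}
    (h : ∀ i, dist (y i) (z i) ≤ B) : ConvergesToBoundary z ξ := by
  refine hX.convergesToBoundary_of_gromovProduct hy (y 0) fun M => ?_
  obtain ⟨N, hN⟩ := hX.dist_large hy (y 0) (M + B)
  refine ⟨N, fun i hi => ?_⟩
  have := hN i hi
  have := sub_dist_le_gromovProduct (y 0) (y i) (z i)
  linarith [h i]

theorem convergesToBoundary_smul {G : Type*} [Group G] [MulAction G X] [IsIsometricSMul G X]
    (g : G) {y : ℕ → X} {ξ : GromovBoundary X} (hy : ConvergesToBoundary y ξ) :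
    ConvergesToBoundary (fun i => g • y i) (g • ξ) := by
  obtain ⟨c, rfl, h⟩ := hy
  refine ⟨g • c, rfl, h.congr fun p => ?_⟩
  exact (gromovProduct_smul g _ _ _).symm

/-- If the Gromov products of the points of two rays are unbounded, then each ray is eventually
within `2δ` of the other one. -/
theorem IsHyperbolic.exists_dist_le_two_mul (hX : IsHyperbolic X δ) {c c' : GeodesicRay X}
    (h : ∀ M : ℝ, ∃ s t, M ≤ gromovProduct (c.toFun 0) (c.toFun s) (c'.toFun t)) (t₀ : ℝ≥0)
    (ht : dist (c.toFun 0) (c'.toFun 0) ≤ t₀) :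
    ∃ s₀ : ℝ≥0, dist (c.toFun t₀) (c'.toFun s₀) ≤ 2 * δ := by
  obtain ⟨s, t, hst⟩ := h t₀
  have h1 := gromovProduct_le_left (c.toFun 0) (c.toFun s) (c'.toFun t)
  have h2 := gromovProduct_le_right (c.toFun 0) (c.toFun s) (c'.toFun t)
  rw [c.dist_zero] at h1
  have hts : t₀ ≤ s := by exact_mod_cast hst.trans h1
  -- The diagonal from c(0) to c'(t) passes within δ of c(t₀), at u. A second comparison, from the
  -- vertex c'(t), moves u to c'.
  obtain ⟨u, hu1, hu2⟩ := hX.1.exists_between (c.toFun 0) (c'.toFun t) t₀.2 (hst.trans h2)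
  have d1 := hX.2 (c.toFun 0) (c.toFun s) (c'.toFun t) (c.toFun t₀) u
    (by rw [c.dist_zero, c.dist_zero, c.dist_of_le hts]; ring)
    (by rw [hu1, hu2]; ring) (by rw [hu1, c.dist_zero]; rfl) (by rw [c.dist_zero]; exact hst)
  have ht' := c'.dist_zero t
  have d2 := dist_triangle (c.toFun 0) (c'.toFun 0) (c'.toFun t)
  have d3 := dist_triangle_left (c'.toFun 0) (c'.toFun t) (c.toFun 0)
  set d := dist (c.toFun 0) (c'.toFun t)
  have hu2' : dist u (c'.toFun t) = d - t₀ := hu2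
  have hs0 : 0 ≤ (t : ℝ) - (d - t₀) := by linarith
  -- Chosen so that c'(s₀) and u are equidistant from c'(t). Since t₀ is at least the distance of
  -- the origins, that distance does not exceed the Gromov product at c'(t).
  obtain ⟨s₀, hs₀⟩ : ∃ s₀ : ℝ≥0, (s₀ : ℝ) = t - (d - t₀) := ⟨⟨_, hs0⟩, rfl⟩
  have hs0t : s₀ ≤ t := by
    rw [← NNReal.coe_le_coe]
    have : (t₀ : ℝ) ≤ d := hst.trans h2
    linarith
  have e1 : dist (c'.toFun t) (c'.toFun s₀) = d - t₀ := by
    rw [dist_comm, c'.dist_of_le hs0t]; linarith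
  refine ⟨s₀, ?_⟩
  have d4 := hX.2 (c'.toFun t) (c.toFun 0) (c'.toFun 0) u (c'.toFun s₀)
    (by rw [dist_comm _ u, hu2', dist_comm u, hu1, dist_comm (c'.toFun t)]
        change _ = d
        simp)
    (by rw [e1, dist_comm _ (c'.toFun 0), c'.dist_zero, dist_comm, c'.dist_zero]; linarith)
    (by rw [dist_comm, hu2', e1])
    (by
      rw [dist_comm, hu2']
      simp only [gromovProduct]
      rw [dist_comm (c'.toFun t) (c.toFun 0), dist_comm (c'.toFun t) (c'.toFun 0), ht']
      change _ ≤ (d + t - _) / 2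
      linarith)
  have := dist_triangle (c.toFun t₀) u (c'.toFun s₀)
  linarith

/-- Beyond the distance of the origins, c(t) is 2δ-close to some c'(s), and the triangle inequality
forces s ≈ t; before it, going back to the origins is short enough. The bound depends only on the
origins, and it turns unbounded Gromov products into equality of endpoints. -/
theorem IsHyperbolic.dist_ray_le (hX : IsHyperbolic X δ) {c c' : GeodesicRay X}
    (h : ∀ M : ℝ, ∃ s t, M ≤ gromovProduct (c.toFun 0) (c.toFun s) (c'.toFun t)) (t : ℝ≥0) :
    dist (c.toFun t) (c'.toFun t) ≤ 3 * dist (c.toFun 0) (c'.toFun 0) + 4 * δ := by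
  have hδ := hX.nonneg (c.toFun 0)
  have h0 : 0 ≤ dist (c.toFun 0) (c'.toFun 0) := dist_nonneg
  rcases le_total (dist (c.toFun 0) (c'.toFun 0)) t with ht | ht
  · obtain ⟨s, hs⟩ := hX.exists_dist_le_two_mul h t ht
    have h1 := c'.dist_eq s t
    have h2 := dist_triangle4 (c.toFun 0) (c.toFun t) (c'.toFun s) (c'.toFun 0)
    have h2' := dist_triangle4 (c'.toFun 0) (c'.toFun s) (c.toFun t) (c.toFun 0)
    have h3 := dist_triangle4 (c.toFun 0) (c'.toFun 0) (c'.toFun s) (c.toFun t)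
    have h4 := dist_triangle4 (c'.toFun 0) (c.toFun 0) (c.toFun t) (c'.toFun s)
    rw [c.dist_zero, c'.dist_zero, dist_comm _ (c.toFun t)] at h3
    rw [c.dist_zero, c'.dist_zero, dist_comm _ (c.toFun 0)] at h4
    have : |(s : ℝ) - t| ≤ dist (c.toFun 0) (c'.toFun 0) + 2 * δ := by
      rw [abs_le]; constructor <;> linarith
    have := dist_triangle (c.toFun t) (c'.toFun s) (c'.toFun t)
    linarith
  · have := dist_triangle4 (c.toFun t) (c.toFun 0) (c'.toFun 0) (c'.toFun t)
    rw [dist_comm (c.toFun t) (c.toFun 0), c.dist_zero, c'.dist_zero] at this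
    linarith

theorem gromovProduct_unbounded_of_endpoint_eq {c c' : GeodesicRay X}
    (h : c.endpoint = c'.endpoint) (M : ℝ) :
    ∃ s t, M ≤ gromovProduct (c.toFun 0) (c.toFun s) (c'.toFun t) := by
  obtain ⟨B, hB⟩ := endpoint_eq_iff.1 h
  obtain ⟨n, hn⟩ := exists_nat_ge (M + B)
  refine ⟨n, n, ?_⟩
  have := sub_dist_le_gromovProduct (c.toFun 0) (c.toFun n) (c'.toFun n)
  rw [c.dist_zero] at this
  have := hB n
  push_cast at *
  linarith

theorem IsHyperbolic.endpoint_eq_of_gromovProduct (hX : IsHyperbolic X δ) {c c' : GeodesicRay X}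
    {w : X} (h : ∀ M : ℝ, ∃ s t, M ≤ gromovProduct w (c.toFun s) (c'.toFun t)) :
    c.endpoint = c'.endpoint := by
  refine endpoint_eq_iff.2 ⟨_, hX.dist_ray_le fun M => ?_⟩
  obtain ⟨s, t, hst⟩ := h (M + dist w (c.toFun 0))
  refine ⟨s, t, ?_⟩
  have := gromovProduct_le_add_base w (c.toFun 0) (c.toFun s) (c'.toFun t)
  linarith

theorem IsHyperbolic.dist_ray_le_of_endpoint_eq (hX : IsHyperbolic X δ) {c c' : GeodesicRay X}
    (h : c.endpoint = c'.endpoint) (t : ℝ≥0) :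
    dist (c.toFun t) (c'.toFun t) ≤ 3 * dist (c.toFun 0) (c'.toFun 0) + 4 * δ :=
  hX.dist_ray_le (gromovProduct_unbounded_of_endpoint_eq h) t

theorem IsHyperbolic.convergesToBoundary_unique (hX : IsHyperbolic X δ) {y : ℕ → X}
    {ξ ζ : GromovBoundary X} (h : ConvergesToBoundary y ξ) (h' : ConvergesToBoundary y ζ) :
    ξ = ζ := by
  obtain ⟨c, rfl⟩ := exists_endpoint ξ
  obtain ⟨c', rfl⟩ := exists_endpoint ζ
  refine hX.endpoint_eq_of_gromovProduct (w := y 0) fun M => ?_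
  obtain ⟨N, hN⟩ := (convergesToBoundary_iff (y 0)).1 h (M + δ)
  obtain ⟨N', hN'⟩ := (convergesToBoundary_iff (y 0)).1 h' (M + δ)
  refine ⟨N, N', ?_⟩
  have a1 := hN (max N N') (le_max_left _ _) N le_rfl
  have a2 := hN' (max N N') (le_max_right _ _) N' le_rfl
  rw [gromovProduct_comm] at a1
  have := hX.four_point (y 0) (c.toFun N) (y (max N N')) (c'.toFun N')
  have := le_min a1 a2
  linarith

/-- A sequence that is Cauchy at infinity converges to the endpoint of a ray with a given
origin. -/
theorem IsHyperbolic.exists_ray_of_cauchy [ProperSpace X] (hX : IsHyperbolic X δ) (w : X)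
    {y : ℕ → X} (hy : ∀ M : ℝ, ∃ N : ℕ, ∀ i ≥ N, ∀ j ≥ N, M ≤ gromovProduct w (y i) (y j)) :
    ∃ c : GeodesicRay X, c.toFun 0 = w ∧ ConvergesToBoundary y c.endpoint := by
  choose e he0 he1 he using fun n => hX.1 w (y n)
  -- Geodesics from w to y_n, stopped at y_n so that they are defined for all times.
  set f : ℕ → ℝ≥0 → X := fun n t => e n (min t (dist w (y n))) with hf
  have f0 : ∀ n, f n 0 = w := fun n => by simp [hf, he0]
  have fd : ∀ n (s t : ℝ≥0), (s : ℝ) ≤ dist w (y n) → (t : ℝ) ≤ dist w (y n) →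
      dist (f n s) (f n t) = |(s : ℝ) - t| := fun n s t hs ht => by
    simp only [hf, min_eq_left hs, min_eq_left ht]
    exact he n _ ⟨s.coe_nonneg, hs⟩ _ ⟨t.coe_nonneg, ht⟩
  have fy : ∀ n (t : ℝ≥0), (t : ℝ) ≤ dist w (y n) → dist (f n t) (y n) = dist w (y n) - t := by
    intro n t ht
    simp only [hf, min_eq_left ht]
    have := he n _ ⟨t.coe_nonneg, ht⟩ (dist w (y n)) ⟨dist_nonneg, le_rfl⟩
    rw [he1] at this
    rw [this, abs_sub_comm, abs_of_nonneg (by linarith)]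
  have large : ∀ M : ℝ, ∀ᶠ n in (hyperfilter ℕ : Filter ℕ), M ≤ dist w (y n) := fun M => by
    obtain ⟨N, hN⟩ := hy M
    have : ∀ᶠ n in atTop, M ≤ dist w (y n) :=
      eventually_atTop.2 ⟨N, fun n hn => (hN n hn n hn).trans (gromovProduct_le_left _ _ _)⟩
    exact (Nat.hyperfilter_le_atTop) this
  -- Limits along a nonprincipal ultrafilter exist in compact balls, which makes a diagonal choice
  -- of subsequences unnecessary. The distances d(w, y_n) tend to infinity, so stopping does not
  -- affect the limit.
  have lim : ∀ t : ℝ≥0, ∃ x, Tendsto (fun n => f n t) (hyperfilter ℕ : Filter ℕ) (𝓝 x) := fun t => by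
    have hK : IsCompact (Metric.closedBall w t) := isCompact_closedBall w t
    obtain ⟨x, -, hx⟩ := hK.ultrafilter_le_nhds ((hyperfilter ℕ).map fun n => f n t) (by
      rw [le_principal_iff]
      refine (large t).mono fun n hn => ?_
      simp only [Metric.mem_closedBall]
      have := fd n t 0 hn (by simp)
      rw [f0] at this
      simp [this])
    exact ⟨x, hx⟩
  choose c hc using lim
  have cd : ∀ s t, dist (c s) (c t) = |(s : ℝ) - t| := fun s t => by
    refine tendsto_nhds_unique ((hc s).dist (hc t)) ?_
    refine tendsto_const_nhds.congr' ?_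
    filter_upwards [large (max s t)] with n hn
    exact (fd n s t ((le_max_left _ _).trans hn) ((le_max_right _ _).trans hn)).symm
  have c0 : c 0 = w := tendsto_nhds_unique (hc 0) (by simp only [f0]; exact tendsto_const_nhds)
  let r : GeodesicRay X := ⟨c, Isometry.of_dist_eq fun s t => by rw [cd, NNReal.dist_eq]⟩
  refine ⟨r, c0, (convergesToBoundary_iff w).2 fun M => ?_⟩
  obtain ⟨T, hT⟩ := exists_nat_ge (M + δ)
  obtain ⟨N, hN⟩ := hy T
  have hδ := hX.nonneg w
  -- For i, n ≥ N the geodesics to y_i and y_n agree up to δ until time T; letting n run along the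
  -- ultrafilter compares the geodesic to y_i with the limit ray.
  have close : ∀ i ≥ N, dist (f i T) (c T) ≤ δ := fun i hi => by
    refine le_of_tendsto (tendsto_const_nhds.dist (hc T)) ?_
    have : ∀ᶠ n in (hyperfilter ℕ : Filter ℕ), N ≤ n :=
      Nat.hyperfilter_le_atTop (eventually_ge_atTop N)
    filter_upwards [this] with n hn
    have p := hN i hi n hn
    have p1 := p.trans (gromovProduct_le_left _ _ _)
    have p2 := p.trans (gromovProduct_le_right _ _ _)
    have e1 := fd i 0 T (by simp) (by simpa using p1)
    have e2 := fd n 0 T (by simp) (by simpa using p2)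
    rw [f0] at e1 e2
    exact hX.2 w (y i) (y n) _ _
      (by rw [fy i T (by simpa using p1), e1]; simp)
      (by rw [fy n T (by simpa using p2), e2]; simp)
      (by rw [e1, e2]) (by rw [e1]; simpa using p)
  refine ⟨max N T, fun i hi t ht => ?_⟩
  have hiN : N ≤ i := le_of_max_le_left hi
  have p1 := (hN i hiN i hiN).trans (gromovProduct_le_left _ _ _)
  have hTt : (T : ℝ≥0) ≤ t := le_trans (by exact_mod_cast le_max_right _ _) ht
  have b1 := fy i T (by simpa using p1)
  have b2 := close i hiN
  have b3 := r.dist_of_le hTt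
  have b4 := r.dist_zero t
  have b5 := dist_triangle4 (y i) (f i T) (c T) (c t)
  rw [dist_comm (y i) (f i T)] at b5
  change dist (c 0) (c t) = t at b4
  change dist (c T) (c t) = _ at b3
  rw [c0] at b4
  change M ≤ gromovProduct w (y i) (c t)
  simp only [gromovProduct]
  push_cast at *
  linarith

theorem IsHyperbolic.exists_ray [ProperSpace X] (hX : IsHyperbolic X δ) (w : X)
    (ξ : GromovBoundary X) : ∃ c : GeodesicRay X, c.toFun 0 = w ∧ c.endpoint = ξ := by
  obtain ⟨c', rfl⟩ := exists_endpoint ξ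
  have h := c'.convergesToBoundary
  obtain ⟨c, hc, h'⟩ := hX.exists_ray_of_cauchy w (hX.gromovProduct_large h h w)
  exact ⟨c, hc, hX.convergesToBoundary_unique h' h⟩

theorem IsHyperbolic.gromovProduct_bounded (hX : IsHyperbolic X δ) {c c' : GeodesicRay X}
    (h : c.endpoint ≠ c'.endpoint) (w : X) :
    ∃ Q : ℝ, ∀ s t, gromovProduct w (c.toFun s) (c'.toFun t) ≤ Q := by
  by_contra! H
  exact h (hX.endpoint_eq_of_gromovProduct fun M => by
    obtain ⟨s, t, hst⟩ := H M
    exact ⟨s, t, hst.le⟩)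

end Rays

/-! ### Stability of quasigeodesics -/

section Morse

variable {X X' : Type*} [MetricSpace X] [MetricSpace X'] {δ δ' : ℝ}

/-- `F` is an `(L, ε)`-quasi-isometric embedding. -/
structure IsQIEmbedding (L ε : ℝ) (F : X → X') : Prop where
  one_le : 1 ≤ L
  nonneg : 0 ≤ ε
  upper : ∀ a b, dist (F a) (F b) ≤ L * dist a b + ε
  lower : ∀ a b, dist a b ≤ L * dist (F a) (F b) + ε

theorem IsQuasiIsometry.exists_isQIEmbedding {F : X → X'} (h : IsQuasiIsometry dist dist F) :
    ∃ (G : X' → X) (L ε : ℝ), IsQIEmbedding L ε F ∧ IsQIEmbedding L ε G ∧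
      (∀ a, dist (G (F a)) a ≤ ε) ∧ ∀ b, dist (F (G b)) b ≤ ε := by
  obtain ⟨⟨L₁, ε₁, hL₁, hε₁, h₁⟩, G, ⟨L₂, ε₂, hL₂, hε₂, h₂⟩, e, he₁, he₂⟩ := h
  have hm : ∀ {d : ℝ}, 0 ≤ d → L₁ * d ≤ (L₁ + L₂) * d ∧ L₂ * d ≤ (L₁ + L₂) * d := fun hd => by
    constructor <;> nlinarith
  have habs := le_abs_self e
  have h0 := abs_nonneg e
  refine ⟨G, L₁ + L₂, ε₁ + ε₂ + 2 * |e|, ⟨by linarith, by linarith, fun a b => ?_, fun a b => ?_⟩,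
    ⟨by linarith, by linarith, fun a b => ?_, fun a b => ?_⟩, fun a => ?_, fun b => ?_⟩
  · linarith [h₁ a b, (hm (dist_nonneg (x := a) (y := b))).1]
  · have := dist_triangle4 a (G (F a)) (G (F b)) b
    rw [dist_comm a (G (F a))] at this
    linarith [h₂ (F a) (F b), (hm (dist_nonneg (x := F a) (y := F b))).2, he₁ a, he₁ b]
  · linarith [h₂ a b, (hm (dist_nonneg (x := a) (y := b))).2]
  · have := dist_triangle4 a (F (G a)) (F (G b)) b
    rw [dist_comm a (F (G a))] at this
    linarith [h₁ (G a) (G b), (hm (dist_nonneg (x := G a) (y := G b))).1, he₂ a, he₂ b]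
  · linarith [he₁ a]
  · linarith [he₂ b]

theorem sq_le_four_mul_two_pow (k : ℕ) : k ^ 2 ≤ 4 * 2 ^ k := by
  induction k with
  | zero => simp
  | succ k ih =>
    have := (Nat.lt_two_pow_self (n := k))
    rw [pow_succ 2]
    nlinarith

/-- Here k is at most logarithmic in m, so m ≤ A + kδ cannot hold for large m. The inequality k² ≤ 4
· 2 ^ k replaces the logarithm. It closes the argument for the Morse lemma. -/
theorem exists_bound_of_log_growth (A a b δ : ℝ) (ha : 0 ≤ a) (hb : 0 ≤ b) (hA : 0 ≤ A) :
    ∃ D : ℝ, 0 ≤ D ∧ ∀ (m : ℝ) (k : ℕ), m ≤ A + k * δ → (2 : ℝ) ^ k ≤ a * m + b → m ≤ D := by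
  have hp : 0 ≤ 4 * δ ^ 2 * a := by positivity
  have hq : 0 ≤ 4 * δ ^ 2 * (a * A + b) := by positivity
  refine ⟨A + 4 * δ ^ 2 * a + 4 * δ ^ 2 * (a * A + b) + 1, by linarith, fun m k h1 h2 => ?_⟩
  by_contra! h
  have hs : 0 ≤ m - A := by linarith
  have e1 : (m - A) ^ 2 ≤ (k * δ) ^ 2 := by
    apply pow_le_pow_left₀ hs; linarith
  have e2 : ((k : ℝ)) ^ 2 ≤ 4 * 2 ^ k := by exact_mod_cast sq_le_four_mul_two_pow k
  have e3 : (m - A) ^ 2 ≤ 4 * δ ^ 2 * (a * m + b) := by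
    calc (m - A) ^ 2 ≤ (k : ℝ) ^ 2 * δ ^ 2 := by rw [← mul_pow]; exact e1
      _ ≤ (4 * 2 ^ k) * δ ^ 2 := by gcongr
      _ ≤ (4 * (a * m + b)) * δ ^ 2 := by gcongr
      _ = _ := by ring
  set p := 4 * δ ^ 2 * a
  set q := 4 * δ ^ 2 * (a * A + b)
  have e4 : 4 * δ ^ 2 * (a * m + b) = p * (m - A) + q := by simp only [p, q]; ring
  nlinarith

/-- Every point of a geodesic whose endpoints are images under a quasi-isometric embedding `F` is
close to the image of the corresponding geodesic. -/
theorem IsQIEmbedding.morse {L ε : ℝ} {F : X → X'} (hF : IsQIEmbedding L ε F)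
    (hX : IsGeodesicSpace X) (hX' : IsHyperbolic X' δ) :
    ∃ D : ℝ, ∀ (x y : X) (z : X'), dist (F x) z + dist z (F y) = dist (F x) (F y) →
      ∃ u, dist x u + dist u y = dist x y ∧ dist z (F u) ≤ D := by
  have hL := hF.one_le
  have hε := hF.nonneg
  rcases isEmpty_or_nonempty X' with hemp | ⟨⟨o⟩⟩
  · exact ⟨0, fun x => (hemp.false (F x)).elim⟩
  have hδ := hX'.nonneg o
  obtain ⟨D, hD0, hD⟩ := exists_bound_of_log_growth (1 + L + ε + 2 * δ) (12 * L) (2 * ε + 4) δ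
    (by linarith) (by linarith) (by linarith)
  refine ⟨D, fun x y z hz => ?_⟩
  obtain ⟨e, he0, he1, he⟩ := hX x y
  set d := dist x y with hd
  have hd0 : 0 ≤ d := dist_nonneg
  -- The geodesics from F x to F y lie in the m-neighborhood of the image of e.
  let Cov : ℝ → Prop := fun m => ∀ z, dist (F x) z + dist z (F y) = dist (F x) (F y) →
    ∃ s ∈ Set.Icc 0 d, dist z (F (e s)) ≤ m
  -- If m is a covering radius and z₀ is farther than m - 1 from the image, the image gives a detour
  -- around z₀. It joins points y₁ and y₂ of the geodesic on either side of z₀, each at distance 2m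
  -- from z₀ or an endpoint. The detour has O(m) steps, so hyperbolicity lets it avoid z₀ only by
  -- O(log m), which bounds m.
  have step : ∀ m, 0 ≤ m → Cov m → ∀ z₀, dist (F x) z₀ + dist z₀ (F y) = dist (F x) (F y) →
      (∀ s ∈ Set.Icc 0 d, m - 1 < dist z₀ (F (e s))) → m ≤ D := by
    intro m hm hcov z₀ hz₀ hfar
    have h1 : ∃ s₁ ∈ Set.Icc 0 d, ∃ y₁, dist y₁ z₀ ≤ 2 * m ∧
        dist (F x) y₁ + dist y₁ z₀ = dist (F x) z₀ ∧ dist y₁ (F (e s₁)) ≤ m ∧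
        m - 1 ≤ gromovProduct z₀ y₁ (F (e s₁)) := by
      rcases le_total (2 * m) (dist z₀ (F x)) with hc | hc
      · obtain ⟨y₁, hy1, hy2⟩ := hX'.1.exists_between z₀ (F x) (by linarith) hc
        rw [dist_comm] at hy1 hy2
        rw [dist_comm z₀ (F x)] at hy2
        obtain ⟨s₁, hs₁, hs⟩ := hcov y₁ (by
          have := dist_triangle y₁ z₀ (F y)
          have := dist_triangle (F x) y₁ (F y)
          linarith)
        refine ⟨s₁, hs₁, y₁, hy1.le, by linarith, hs, ?_⟩
        have := hfar s₁ hs₁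
        simp only [gromovProduct]
        rw [dist_comm z₀ y₁, hy1]
        linarith
      · refine ⟨0, ⟨le_rfl, hd0⟩, F x, by rwa [dist_comm], by simp, by simpa [he0] using hm, ?_⟩
        rw [he0, gromovProduct_self]
        have := hfar 0 ⟨le_rfl, hd0⟩
        rw [he0] at this
        exact this.le
    have h2 : ∃ s₂ ∈ Set.Icc 0 d, ∃ y₂, dist y₂ z₀ ≤ 2 * m ∧
        dist z₀ y₂ + dist y₂ (F y) = dist z₀ (F y) ∧ dist y₂ (F (e s₂)) ≤ m ∧
        m - 1 ≤ gromovProduct z₀ (F (e s₂)) y₂ := by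
      rcases le_total (2 * m) (dist z₀ (F y)) with hc | hc
      · obtain ⟨y₂, hy1, hy2⟩ := hX'.1.exists_between z₀ (F y) (by linarith) hc
        obtain ⟨s₁, hs₁, hs⟩ := hcov y₂ (by
          have := dist_triangle (F x) z₀ y₂
          have := dist_triangle (F x) y₂ (F y)
          linarith)
        refine ⟨s₁, hs₁, y₂, by rw [dist_comm, hy1], by linarith, hs, ?_⟩
        have := hfar s₁ hs₁
        simp only [gromovProduct]
        rw [dist_comm (F _) y₂, hy1]
        linarith
      · refine ⟨d, ⟨hd0, le_rfl⟩, F y, by rwa [dist_comm], by simp, by simpa [he1] using hm, ?_⟩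
        rw [he1, gromovProduct_self]
        have := hfar d ⟨hd0, le_rfl⟩
        rw [he1] at this
        exact this.le
    obtain ⟨s₁, hs₁, y₁, a1, a2, a3, a4⟩ := h1
    obtain ⟨s₂, hs₂, y₂, b1, b2, b3, b4⟩ := h2
    -- The path F(e s₁), y₁, z₀, y₂, F(e s₂) has length at most m + 2m + 2m + m.
    have hs : |s₁ - s₂| ≤ L * (6 * m) + ε := by
      rw [← he s₁ hs₁ s₂ hs₂]
      refine (hF.lower _ _).trans ?_
      have := dist_triangle4 (F (e s₁)) y₁ y₂ (F (e s₂))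
      have := dist_triangle_right y₁ y₂ z₀
      rw [dist_comm] at a3
      gcongr
      linarith
    -- y₁ and y₂ lie on opposite sides of z₀ on a geodesic.
    have hy12 : gromovProduct z₀ y₁ y₂ ≤ 0 := by
      have := dist_triangle4 (F x) y₁ y₂ (F y)
      simp only [gromovProduct]
      rw [dist_comm z₀ y₁]
      linarith
    set n : ℕ := ⌈|s₁ - s₂|⌉₊ + 1 with hn
    have hn0 : (0 : ℝ) < n := by rw [hn]; positivity
    have hn1 : |s₁ - s₂| ≤ n := by
      rw [hn]; push_cast; linarith [Nat.le_ceil |s₁ - s₂|]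
    have hn2 : (n : ℝ) ≤ L * (6 * m) + ε + 2 := by
      rw [hn]; push_cast; linarith [Nat.ceil_lt_add_one (abs_nonneg (s₁ - s₂))]
    -- Parameters from s₁ to s₂ in n equal steps of length at most 1; the minimum makes the sequence
    -- constant after n.
    set σ : ℕ → ℝ := fun i => s₁ + (min i n : ℕ) / n * (s₂ - s₁) with hσ
    have hσmem : ∀ i, σ i ∈ Set.Icc 0 d := fun i => by
      have hr : ((min i n : ℕ) : ℝ) / n ∈ Set.Icc (0 : ℝ) 1 := by
        refine ⟨by positivity, ?_⟩
        rw [div_le_one hn0]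
        exact_mod_cast min_le_right _ _
      have := (convex_Icc (0 : ℝ) d).add_smul_sub_mem hs₁ hs₂ hr
      simpa [hσ] using this
    have hσ0 : σ 0 = s₁ := by simp [hσ]
    have hσn : σ n = s₂ := by simp [hσ, hn0.ne']
    have hstep : ∀ i < n, dist (e (σ i)) (e (σ (i + 1))) ≤ 1 := fun i hi => by
      rw [he _ (hσmem _) _ (hσmem _)]
      have : σ i - σ (i + 1) = (s₁ - s₂) / n := by
        simp only [hσ, min_eq_left hi.le, min_eq_left (Nat.succ_le_of_lt hi)]
        push_cast
        field_simp
        ring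
      rw [this, abs_div, abs_of_pos hn0, div_le_one hn0]
      exact hn1
    set k := Nat.log 2 n + 1 with hk
    have hk1 : n ≤ 2 ^ k := (Nat.lt_pow_succ_log_self (by norm_num) n).le
    have hk2 : 2 ^ k ≤ 2 * n := by
      rw [hk, pow_succ, mul_comm]
      exact Nat.mul_le_mul_left 2 (Nat.pow_log_le_self 2 (by omega))
    have hchain := hX'.chain z₀ (m - 1 - L - ε) k (fun i => F (e (σ i))) n (by omega) hk1
      fun i hi => by
        have u1 := sub_dist_le_gromovProduct z₀ (F (e (σ i))) (F (e (σ (i + 1))))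
        have u2 := hF.upper (e (σ i)) (e (σ (i + 1)))
        have u3 := hfar _ (hσmem i)
        have u4 : L * dist (e (σ i)) (e (σ (i + 1))) ≤ L * 1 := by
          gcongr
          exact hstep i hi
        linarith
    simp only [hσ0, hσn] at hchain
    have hkδ : 0 ≤ k * δ := by positivity
    have f1 := hX'.four_point z₀ y₁ (F (e s₁)) (F (e s₂))
    have f2 := hX'.four_point z₀ y₁ (F (e s₂)) y₂
    have g1 : m - 1 - L - ε - k * δ ≤
        min (gromovProduct z₀ y₁ (F (e s₁))) (gromovProduct z₀ (F (e s₁)) (F (e s₂))) :=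
      le_min (by linarith) hchain
    have g2 : m - 1 - L - ε - k * δ - δ ≤
        min (gromovProduct z₀ y₁ (F (e s₂))) (gromovProduct z₀ (F (e s₂)) y₂) :=
      le_min (by linarith) (by linarith)
    refine hD m k (by linarith) ?_
    have : (2 : ℝ) ^ k ≤ 2 * n := by exact_mod_cast hk2
    linarith
  -- While it exceeds D, the covering radius can be lowered by 1. The descent starts from d(F x, F
  -- y), a radius that the endpoint F x alone provides. No farthest point has to exist.
  have key : ∀ (n : ℕ) (m : ℝ), 0 ≤ m → m ≤ D + n → Cov m → Cov D := by
    intro n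
    induction n with
    | zero =>
      intro m _ hm hc z hz
      obtain ⟨s, hs, h⟩ := hc z hz
      exact ⟨s, hs, h.trans (by simpa using hm)⟩
    | succ n ih =>
      intro m hm0 hm hc
      by_cases hmD : m ≤ D
      · exact fun z hz => by
          obtain ⟨s, hs, h⟩ := hc z hz
          exact ⟨s, hs, h.trans hmD⟩
      refine ih (max (m - 1) 0) (le_max_right _ _) (max_le ?_ ?_) fun z₀ hz₀ => ?_
      · push_cast at hm; linarith
      · positivity
      · by_contra! H
        exact hmD (step m hm0 hc z₀ hz₀ fun s hs => (le_max_left _ _).trans_lt (H s hs))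
  obtain ⟨n, hn⟩ := exists_nat_ge (dist (F x) (F y) - D)
  obtain ⟨s, hs, h⟩ := key n (dist (F x) (F y)) dist_nonneg (by linarith) (fun z hz =>
    ⟨0, ⟨le_rfl, hd0⟩, by
      rw [he0, dist_comm]
      linarith [dist_nonneg (x := z) (y := F y)]⟩) z hz
  refine ⟨e s, ?_, h⟩
  have e1 := he 0 ⟨le_rfl, hd0⟩ s hs
  have e2 := he s hs d ⟨hd0, le_rfl⟩
  rw [he0] at e1
  rw [he1] at e2
  rw [e1, e2, abs_of_nonpos (by linarith [hs.1]), abs_of_nonpos (by linarith [hs.2])]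
  ring

/-- The difference `(x|a)_w - (x|b)_w` of Gromov products. -/
noncomputable def crossDiff (w b x a : X) : ℝ :=
  (dist w a + dist x b - dist x a - dist w b) / 2

theorem crossDiff_eq (w b x a : X) :
    crossDiff w b x a = gromovProduct w x a - gromovProduct w x b := by
  simp only [crossDiff, gromovProduct]; ring

theorem crossDiff_swap (w b x a : X) : crossDiff w a x b = -crossDiff w b x a := by
  simp only [crossDiff]; ring

theorem crossDiff_le_dist {w b x a u v : X} (hu : dist w u + dist u b = dist w b)
    (hv : dist x v + dist v a = dist x a) : crossDiff w b x a ≤ dist u v := by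
  have := dist_triangle4 w u v a
  have := dist_triangle4 x v u b
  rw [dist_comm v u] at this
  simp only [crossDiff]
  linarith

/-- Together with `crossDiff_le_dist` this identifies the positive part of the difference with the
distance between geodesics [w,b] and [x,a], up to 2δ. The side [w,x] runs close to [w,b] up to time
(x|b)_w and close to [x,a] from time (x|a)_w on. -/
theorem IsHyperbolic.exists_dist_le_crossDiff (hX : IsHyperbolic X δ) (w b x a : X) :
    ∃ u v, dist w u + dist u b = dist w b ∧ dist x v + dist v a = dist x a ∧
      dist u v ≤ max (crossDiff w b x a) 0 + 2 * δ := by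
  obtain ⟨e, he0, he1, he⟩ := hX.1 w x
  have ta0 := gromovProduct_nonneg w x a
  have tb0 := gromovProduct_nonneg w x b
  have ta1 := gromovProduct_le_left w x a
  have tb1 := gromovProduct_le_left w x b
  have ta2 := gromovProduct_le_right w x a
  have tb2 := gromovProduct_le_right w x b
  rw [crossDiff_eq]
  set ta := gromovProduct w x a with hta
  set tb := gromovProduct w x b
  have d1 : ∀ t ∈ Set.Icc 0 (dist w x), dist w (e t) = t := fun t ht => by
    have := he 0 ⟨le_rfl, dist_nonneg⟩ t ht
    rw [he0] at this
    rw [this, zero_sub, abs_neg, abs_of_nonneg ht.1]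
  have d2 : ∀ t ∈ Set.Icc 0 (dist w x), dist (e t) x = dist w x - t := fun t ht => by
    have := he t ht _ ⟨dist_nonneg, le_rfl⟩
    rw [he1] at this
    rw [this, abs_sub_comm, abs_of_nonneg (by linarith [ht.2])]
  have mta : ta ∈ Set.Icc 0 (dist w x) := ⟨ta0, ta1⟩
  have hg : gromovProduct x w a = dist w x - ta := by
    simp only [hta, gromovProduct, dist_comm x w]; ring
  obtain ⟨v, hv1, hv2⟩ := hX.1.exists_between x a (t := dist w x - ta) (by linarith)
    (by rw [← hg]; exact gromovProduct_le_right _ _ _)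
  have hv : dist (e ta) v ≤ δ := hX.2 x w a (e ta) v
    (by rw [dist_comm x (e ta), dist_comm (e ta) w, d1 ta mta, d2 ta mta, dist_comm x w]; ring)
    (by linarith) (by rw [dist_comm, d2 ta mta, hv1]) (by rw [dist_comm, d2 ta mta, hg])
  have hu : ∀ t, 0 ≤ t → t ≤ tb → ∃ u, dist w u + dist u b = dist w b ∧ dist (e t) u ≤ δ := by
    intro t ht0 ht
    have mt : t ∈ Set.Icc 0 (dist w x) := ⟨ht0, ht.trans tb1⟩
    obtain ⟨u, hu1, hu2⟩ := hX.1.exists_between w b ht0 (ht.trans tb2)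
    refine ⟨u, by linarith, hX.2 w x b _ _ (by rw [d1 t mt, d2 t mt]; ring) (by linarith)
      (by rw [d1 t mt, hu1]) (by rw [d1 t mt]; exact ht)⟩
  rcases le_total ta tb with hab | hab
  · obtain ⟨u, hu1, hu2⟩ := hu ta ta0 hab
    refine ⟨u, v, hu1, by linarith, ?_⟩
    have := dist_triangle_left u v (e ta)
    have := le_max_right (ta - tb) 0
    linarith
  · obtain ⟨u, hu1, hu2⟩ := hu tb tb0 le_rfl
    refine ⟨u, v, hu1, by linarith, ?_⟩
    have h1 := dist_triangle4 u (e tb) (e ta) v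
    rw [he tb ⟨tb0, tb1⟩ ta mta, abs_sub_comm, abs_of_nonneg (by linarith)] at h1
    have := le_max_left (ta - tb) 0
    linarith [dist_comm u (e tb)]

/-- A shortest connection between the two image geodesics is moved by the Morse lemma to images of
points on the original geodesics, and the lower bound for F pulls it back. -/
theorem IsQIEmbedding.crossDiff_le {L ε : ℝ} {F : X → X'} (hF : IsQIEmbedding L ε F)
    (hX : IsGeodesicSpace X) (hX' : IsHyperbolic X' δ) :
    ∃ C : ℝ, ∀ w b x a, crossDiff w b x a ≤
      L * max (crossDiff (F w) (F b) (F x) (F a)) 0 + C := by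
  obtain ⟨D, hD⟩ := hF.morse hX hX'
  refine ⟨L * (2 * δ + 2 * D) + ε, fun w b x a => ?_⟩
  obtain ⟨u', v', hu', hv', huv⟩ := hX'.exists_dist_le_crossDiff (F w) (F b) (F x) (F a)
  obtain ⟨u, hu, hu2⟩ := hD _ _ _ hu'
  obtain ⟨v, hv, hv2⟩ := hD _ _ _ hv'
  have h1 := crossDiff_le_dist hu hv
  have h2 := hF.lower u v
  have h3 := dist_triangle4 (F u) u' v' (F v)
  rw [dist_comm (F u) u'] at h3
  have hL := hF.one_le
  have : L * dist (F u) (F v) ≤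
      L * (max (crossDiff (F w) (F b) (F x) (F a)) 0 + 2 * δ + 2 * D) := by
    gcongr
    linarith
  linarith

theorem crossDiff_le_of_dist_le {ε : ℝ} {w b x a w' b' x' a' : X} (h1 : dist w w' ≤ ε)
    (h2 : dist b b' ≤ ε) (h3 : dist x x' ≤ ε) (h4 : dist a a' ≤ ε) :
    crossDiff w b x a ≤ crossDiff w' b' x' a' + 4 * ε := by
  have := dist_triangle4 w w' a' a
  have := dist_triangle4 x x' b' b
  have := dist_triangle4 x' x a a'
  have := dist_triangle4 w' w b b'
  simp only [crossDiff]
  linarith [dist_comm x' x, dist_comm w' w, dist_comm a' a, dist_comm b' b]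

/-- A quasi-isometry quasi-preserves differences of Gromov products. -/
theorem IsQIEmbedding.crossDiff_bounds {L ε : ℝ} {F : X → X'} {G : X' → X}
    (hF : IsQIEmbedding L ε F) (hG : IsQIEmbedding L ε G) (hGF : ∀ a, dist (G (F a)) a ≤ ε)
    (hX : IsHyperbolic X δ) (hX' : IsHyperbolic X' δ') :
    ∃ C : ℝ, 0 ≤ C ∧ ∀ w b x a,
      crossDiff w b x a ≤ L * max (crossDiff (F w) (F b) (F x) (F a)) 0 + C ∧
      crossDiff (F w) (F b) (F x) (F a) ≤ L * max (crossDiff w b x a) 0 + C := by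
  obtain ⟨C₁, h₁⟩ := hF.crossDiff_le hX.1 hX'
  obtain ⟨C₂, h₂⟩ := hG.crossDiff_le hX'.1 hX
  have hL := hF.one_le
  have hε := hF.nonneg
  refine ⟨|C₁| + |C₂| + L * (4 * ε), by positivity, fun w b x a => ⟨?_, ?_⟩⟩
  · have : 0 ≤ L * (4 * ε) := by positivity
    linarith [h₁ w b x a, le_abs_self C₁, abs_nonneg C₂]
  · have h := h₂ (F w) (F b) (F x) (F a)
    have h3 := crossDiff_le_of_dist_le (hGF w) (hGF b) (hGF x) (hGF a)
    have h4 : max (crossDiff (G (F w)) (G (F b)) (G (F x)) (G (F a))) 0 ≤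
        max (crossDiff w b x a) 0 + 4 * ε := by
      refine max_le (h3.trans ?_) (by positivity)
      gcongr
      exact le_max_left _ _
    have h5 : L * max (crossDiff (G (F w)) (G (F b)) (G (F x)) (G (F a))) 0 ≤
        L * (max (crossDiff w b x a) 0 + 4 * ε) := by gcongr
    linarith [le_abs_self C₂, abs_nonneg C₁]

end Morse

/-! ### The Gromov product on the boundary -/

section BoundaryProduct

variable {X : Type*} [MetricSpace X] {δ : ℝ}

theorem boundaryGromovProduct_le {y z : ℕ → X} {ξ ζ : GromovBoundary X}
    (hy : ConvergesToBoundary y ξ) (hz : ConvergesToBoundary z ζ) (w : X) :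
    boundaryGromovProduct w ξ ζ ≤
      liminf (fun i => ENNReal.ofReal (gromovProduct w (y i) (z i))) atTop :=
  iInf_le_of_le y <| iInf_le_of_le z <| iInf_le_of_le hy <| iInf_le_of_le hz le_rfl

theorem le_boundaryGromovProduct {w : X} {ξ ζ : GromovBoundary X} {p : ℝ≥0∞}
    (h : ∀ y z : ℕ → X, ConvergesToBoundary y ξ → ConvergesToBoundary z ζ →
      p ≤ liminf (fun i => ENNReal.ofReal (gromovProduct w (y i) (z i))) atTop) :
    p ≤ boundaryGromovProduct w ξ ζ :=
  le_iInf fun y => le_iInf fun z => le_iInf fun hy => le_iInf fun hz => h y z hy hz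

theorem boundaryGromovProduct_comm (w : X) (ξ ζ : GromovBoundary X) :
    boundaryGromovProduct w ξ ζ = boundaryGromovProduct w ζ ξ := by
  refine le_antisymm (le_boundaryGromovProduct fun y z hy hz => ?_)
    (le_boundaryGromovProduct fun y z hy hz => ?_)
  all_goals
    simp only [gromovProduct_comm w (y _)]
    exact boundaryGromovProduct_le hz hy w

theorem IsHyperbolic.boundaryGromovProduct_self (hX : IsHyperbolic X δ) (w : X)
    (ξ : GromovBoundary X) : boundaryGromovProduct w ξ ξ = ∞ := by
  rw [eq_top_iff]
  refine le_boundaryGromovProduct fun y z hy hz => ?_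
  rw [Tendsto.liminf_eq (a := ∞)]
  refine ENNReal.tendsto_ofReal_atTop.comp (tendsto_atTop.2 fun M => ?_)
  obtain ⟨N, hN⟩ := hX.gromovProduct_large hy hz w M
  exact eventually_atTop.2 ⟨N, fun i hi => hN i hi i hi⟩

/-- The Gromov product of distinct boundary points is finite and is close to the Gromov products
of the points of any two sequences that converge to them. -/
theorem IsHyperbolic.boundaryGromovProduct_approx (hX : IsHyperbolic X δ) (w : X)
    {ξ ζ : GromovBoundary X} (h : ξ ≠ ζ) :
    boundaryGromovProduct w ξ ζ ≠ ∞ ∧ ∀ y z : ℕ → X, ConvergesToBoundary y ξ →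
      ConvergesToBoundary z ζ → ∀ᶠ i in atTop,
        |gromovProduct w (y i) (z i) - (boundaryGromovProduct w ξ ζ).toReal| ≤ 8 * δ := by
  have hδ := hX.nonneg w
  obtain ⟨c, rfl⟩ := exists_endpoint ξ
  obtain ⟨c', rfl⟩ := exists_endpoint ζ
  obtain ⟨Q, hQ⟩ := hX.gromovProduct_bounded h w
  set p : ℕ → ℝ := fun n => gromovProduct w (c.toFun n) (c'.toFun n) with hp
  -- Far out, (c|y) and (c'|z) exceed the bound Q for (c|c') by more than 4δ. They cannot realize
  -- the minima in the four point conditions, so two such conditions compare (y|z) with (c|c') in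
  -- each direction.
  have key : ∀ y z : ℕ → X, ConvergesToBoundary y c.endpoint → ConvergesToBoundary z c'.endpoint →
      ∃ N, ∀ i ≥ N, ∀ j ≥ N, |gromovProduct w (y i) (z i) - p j| ≤ 2 * δ := by
    intro y z hy hz
    obtain ⟨N₁, h₁⟩ := hX.gromovProduct_large c.convergesToBoundary hy w (Q + 4 * δ + 1)
    obtain ⟨N₂, h₂⟩ := hX.gromovProduct_large hz c'.convergesToBoundary w (Q + 4 * δ + 1)
    refine ⟨max N₁ N₂, fun i hi j hj => ?_⟩
    have a1 := h₁ j (le_of_max_le_left hj) i (le_of_max_le_left hi)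
    have a2 := h₂ i (le_of_max_le_right hi) j (le_of_max_le_right hj)
    have a3 := hQ j j
    have b1 := hX.four_point w (c.toFun j) (y i) (z i)
    have b2 := hX.four_point w (c.toFun j) (z i) (c'.toFun j)
    have b3 := hX.four_point w (y i) (c.toFun j) (c'.toFun j)
    have b4 := hX.four_point w (y i) (c'.toFun j) (z i)
    rw [gromovProduct_comm w (y i) (c.toFun j)] at b3
    rw [gromovProduct_comm w (c'.toFun j) (z i)] at b4
    simp only [hp]
    have u : gromovProduct w (y i) (z i) ≤ gromovProduct w (c.toFun j) (c'.toFun j) + 2 * δ := by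
      rcases min_le_iff.1 (sub_le_iff_le_add.1 b1) with h | h <;>
      rcases min_le_iff.1 (sub_le_iff_le_add.1 b2) with h' | h' <;> linarith
    have l : gromovProduct w (c.toFun j) (c'.toFun j) ≤ gromovProduct w (y i) (z i) + 2 * δ := by
      rcases min_le_iff.1 (sub_le_iff_le_add.1 b3) with h | h <;>
      rcases min_le_iff.1 (sub_le_iff_le_add.1 b4) with h' | h' <;> linarith
    rw [abs_le]
    constructor <;> linarith
  obtain ⟨N₀, hN₀⟩ := key _ _ c.convergesToBoundary c'.convergesToBoundary
  set r := p N₀ with hr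
  have hr0 : 0 ≤ r := gromovProduct_nonneg _ _ _
  have near : ∀ y z : ℕ → X, ConvergesToBoundary y c.endpoint → ConvergesToBoundary z c'.endpoint →
      ∀ᶠ i in atTop, |gromovProduct w (y i) (z i) - r| ≤ 4 * δ := by
    intro y z hy hz
    obtain ⟨N, hN⟩ := key y z hy hz
    refine eventually_atTop.2 ⟨max N N₀, fun i hi => ?_⟩
    have h1 := hN i (le_of_max_le_left hi) i (le_of_max_le_left hi)
    have h2 := hN₀ i (le_of_max_le_right hi) N₀ le_rfl
    have := abs_sub_le (gromovProduct w (y i) (z i)) (p i) r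
    linarith
  have upper : boundaryGromovProduct w c.endpoint c'.endpoint ≤ ENNReal.ofReal (r + 4 * δ) := by
    refine (boundaryGromovProduct_le c.convergesToBoundary c'.convergesToBoundary w).trans ?_
    refine liminf_le_of_frequently_le' (Eventually.frequently ?_)
    filter_upwards [near _ _ c.convergesToBoundary c'.convergesToBoundary] with i hi
    exact ENNReal.ofReal_le_ofReal (by linarith [(abs_le.1 hi).2])
  have lower : ENNReal.ofReal (r - 4 * δ) ≤ boundaryGromovProduct w c.endpoint c'.endpoint := by
    refine le_boundaryGromovProduct fun y z hy hz => le_liminf_of_le (by isBoundedDefault) ?_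
    filter_upwards [near y z hy hz] with i hi
    exact ENNReal.ofReal_le_ofReal (by linarith [(abs_le.1 hi).1])
  have fin : boundaryGromovProduct w c.endpoint c'.endpoint ≠ ∞ :=
    (upper.trans_lt ENNReal.ofReal_lt_top).ne
  refine ⟨fin, fun y z hy hz => ?_⟩
  have u := ENNReal.toReal_le_of_le_ofReal (by linarith) upper
  have l := (ENNReal.ofReal_le_iff_le_toReal fin).1 lower
  filter_upwards [near y z hy hz] with i hi
  rw [abs_le] at hi ⊢
  constructor <;> linarith

end BoundaryProduct

/-! ### Visual metrics -/

section Visual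

variable {X : Type*} [MetricSpace X] {δ : ℝ}

theorem negPow_nonneg {a : ℝ} (ha : 0 ≤ a) (p : ℝ≥0∞) : 0 ≤ negPow a p := by
  unfold negPow; split_ifs
  · exact le_rfl
  · positivity

theorem negPow_pos {a : ℝ} (ha : 0 < a) {p : ℝ≥0∞} (hp : p ≠ ∞) : 0 < negPow a p := by
  simp only [negPow, hp, if_false]; positivity

theorem negPow_top (a : ℝ) : negPow a ∞ = 0 := by simp [negPow]

theorem negPow_of_ne_top (a : ℝ) {p : ℝ≥0∞} (hp : p ≠ ∞) : negPow a p = a ^ (-p.toReal) := by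
  simp [negPow, hp]

/-- 17δ is the four point error δ plus an approximation error of 8δ for the product on each side. -/
theorem IsHyperbolic.boundary_four_point (hX : IsHyperbolic X δ) (w : X)
    {ξ ζ ω : GromovBoundary X} (h1 : ξ ≠ ζ) (h2 : ζ ≠ ω) (h3 : ξ ≠ ω) :
    min (boundaryGromovProduct w ξ ζ).toReal (boundaryGromovProduct w ζ ω).toReal - 17 * δ ≤
      (boundaryGromovProduct w ξ ω).toReal := by
  obtain ⟨c₁, rfl⟩ := exists_endpoint ξ
  obtain ⟨c₂, rfl⟩ := exists_endpoint ζ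
  obtain ⟨c₃, rfl⟩ := exists_endpoint ω
  have e1 := (hX.boundaryGromovProduct_approx w h1).2 _ _ c₁.convergesToBoundary
    c₂.convergesToBoundary
  have e2 := (hX.boundaryGromovProduct_approx w h2).2 _ _ c₂.convergesToBoundary
    c₃.convergesToBoundary
  have e3 := (hX.boundaryGromovProduct_approx w h3).2 _ _ c₁.convergesToBoundary
    c₃.convergesToBoundary
  obtain ⟨i, ⟨a1, a2⟩, a3⟩ := ((e1.and e2).and e3).exists
  rw [abs_le] at a1 a2 a3
  have := hX.four_point w (c₁.toFun i) (c₂.toFun i) (c₃.toFun i)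
  rcases min_le_iff.1 (sub_le_iff_le_add.1 this) with h | h
  · have := min_le_left (boundaryGromovProduct w c₁.endpoint c₂.endpoint).toReal
      (boundaryGromovProduct w c₂.endpoint c₃.endpoint).toReal
    linarith
  · have := min_le_right (boundaryGromovProduct w c₁.endpoint c₂.endpoint).toReal
      (boundaryGromovProduct w c₂.endpoint c₃.endpoint).toReal
    linarith

/-- The exponential form of the four point condition, a quasi-ultrametric inequality. Coinciding
points are treated apart because their Gromov product is infinite and `toReal` would send it to 0.
-/
theorem IsHyperbolic.negPow_boundary_le (hX : IsHyperbolic X δ) (w : X) {a : ℝ} (ha : 1 < a)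
    (ξ ζ ω : GromovBoundary X) :
    negPow a (boundaryGromovProduct w ξ ω) ≤ a ^ (17 * δ) *
      max (negPow a (boundaryGromovProduct w ξ ζ)) (negPow a (boundaryGromovProduct w ζ ω)) := by
  have hδ := hX.nonneg w
  have hK : 1 ≤ a ^ (17 * δ) := Real.one_le_rpow ha.le (by positivity)
  have hn := fun p => negPow_nonneg (zero_le_one.trans ha.le) p
  by_cases h3 : ξ = ω
  · subst h3
    rw [hX.boundaryGromovProduct_self, negPow_top]
    have := (hn (boundaryGromovProduct w ξ ζ)).trans
      (le_max_left _ (negPow a (boundaryGromovProduct w ζ ξ)))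
    positivity
  by_cases h1 : ξ = ζ
  · subst h1
    refine (le_max_right (negPow a (boundaryGromovProduct w ξ ξ)) _).trans ?_
    exact le_mul_of_one_le_left ((hn _).trans (le_max_left _ _)) hK
  by_cases h2 : ζ = ω
  · subst h2
    refine (le_max_left _ (negPow a (boundaryGromovProduct w ζ ζ))).trans ?_
    exact le_mul_of_one_le_left ((hn _).trans (le_max_left _ _)) hK
  have key := hX.boundary_four_point w h1 h2 h3
  rw [negPow_of_ne_top a (hX.boundaryGromovProduct_approx w h1).1,
    negPow_of_ne_top a (hX.boundaryGromovProduct_approx w h2).1,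
    negPow_of_ne_top a (hX.boundaryGromovProduct_approx w h3).1]
  rcases min_le_iff.1 (sub_le_iff_le_add.1 key) with h | h
  · refine le_trans ?_ (mul_le_mul_of_nonneg_left (le_max_left _ _) (by positivity))
    rw [← Real.rpow_add (by linarith)]
    exact Real.rpow_le_rpow_of_exponent_le ha.le (by linarith)
  · refine le_trans ?_ (mul_le_mul_of_nonneg_left (le_max_right _ _) (by positivity))
    rw [← Real.rpow_add (by linarith)]
    exact Real.rpow_le_rpow_of_exponent_le ha.le (by linarith)

theorem IsHyperbolic.negPow_boundary_eq_zero (hX : IsHyperbolic X δ) (w : X) {a : ℝ} (ha : 1 < a)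
    {ξ ζ : GromovBoundary X} (h : negPow a (boundaryGromovProduct w ξ ζ) = 0) : ξ = ζ := by
  by_contra hne
  exact (negPow_pos (by linarith) (hX.boundaryGromovProduct_approx w hne).1).ne' h

/-- For a close to 1 the quasi-ultrametric constant K satisfies K² ≤ 2. Then the infimum of lengths
of chains is a metric comparable, up to a factor of 2, with the exponential of the Gromov product.
-/
theorem IsHyperbolic.exists_visualMetric (hX : IsHyperbolic X δ) (w : X) :
    ∃ m : MetricSpace (GromovBoundary X), IsVisualMetric m := by
  have hδ := hX.nonneg w
  -- Then K² = a ^ (34δ) ≤ 2; the summand 1 covers δ = 0.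
  set a : ℝ := 2 ^ (1 / (34 * δ + 1)) with ha
  have ha1 : 1 < a := Real.one_lt_rpow (by norm_num) (by positivity)
  set K := a ^ (17 * δ) with hK
  have hK0 : 0 < K := by positivity
  have hKK : K * K ≤ 2 := by
    rw [hK, ← Real.rpow_add (by linarith), ha, ← Real.rpow_mul (by norm_num)]
    calc (2 : ℝ) ^ (1 / (34 * δ + 1) * (17 * δ + 17 * δ)) ≤ 2 ^ (1 : ℝ) := by
          refine Real.rpow_le_rpow_of_exponent_le (by norm_num) ?_
          rw [one_div, ← div_eq_inv_mul, div_le_one (by positivity)]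
          linarith
      _ = 2 := by norm_num
  have hK1 : 1 ≤ K := Real.one_le_rpow ha1.le (by positivity)
  let d : GromovBoundary X → GromovBoundary X → ℝ≥0 := fun ξ ζ =>
    ⟨negPow a (boundaryGromovProduct w ξ ζ), negPow_nonneg (by linarith) _⟩
  have dself : ∀ ξ, d ξ ξ = 0 := fun ξ => by
    apply NNReal.eq
    change negPow a _ = 0
    rw [hX.boundaryGromovProduct_self, negPow_top]
  have dcomm : ∀ ξ ζ, d ξ ζ = d ζ ξ := fun ξ ζ => by
    apply NNReal.eq
    change negPow a _ = negPow a _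
    rw [boundaryGromovProduct_comm]
  have dtri : ∀ x y z, (d x z : ℝ) ≤ K * max (d x y : ℝ) (d y z) := fun x y z =>
    hX.negPow_boundary_le w ha1 x y z
  have d4 : ∀ x₁ x₂ x₃ x₄, d x₁ x₄ ≤ 2 * max (d x₁ x₂) (max (d x₂ x₃) (d x₃ x₄)) := by
    intro x₁ x₂ x₃ x₄
    rw [← NNReal.coe_le_coe]
    push_cast
    have h1 := dtri x₁ x₂ x₄
    have h2 := dtri x₂ x₃ x₄
    set M := max (d x₁ x₂ : ℝ) (max (d x₂ x₃ : ℝ) (d x₃ x₄))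
    have hM : 0 ≤ M := (d x₁ x₂).coe_nonneg.trans (le_max_left _ _)
    have h3 : (d x₂ x₄ : ℝ) ≤ K * M := h2.trans (by gcongr; exact le_max_right _ _)
    have h4 : max (d x₁ x₂ : ℝ) (d x₂ x₄) ≤ K * M :=
      max_le ((le_max_left _ _).trans (le_mul_of_one_le_left hM hK1)) h3
    calc (d x₁ x₄ : ℝ) ≤ K * (K * M) := h1.trans (by gcongr)
      _ = (K * K) * M := by ring
      _ ≤ 2 * M := by gcongr
  let pm := PseudoMetricSpace.ofPreNNDist d dself dcomm
  have le1 : ∀ x y, @dist _ pm.toDist x y ≤ d x y :=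
    PseudoMetricSpace.dist_ofPreNNDist_le d dself dcomm
  have le2 : ∀ x y, (d x y : ℝ) ≤ 2 * @dist _ pm.toDist x y :=
    PseudoMetricSpace.le_two_mul_dist_ofPreNNDist d dself dcomm d4
  let m : MetricSpace (GromovBoundary X) :=
    { pm with
      eq_of_dist_eq_zero := fun {x y} h => by
        refine hX.negPow_boundary_eq_zero w ha1 ?_
        have h2 := le2 x y
        have h3 : (d x y : ℝ) ≤ 0 := by
          have : @dist _ pm.toDist x y = 0 := h
          linarith
        exact le_antisymm h3 (d x y).coe_nonneg }
  refine ⟨m, w, a, 1 / 2, 1, ha1, by norm_num, by norm_num, fun ξ ζ => ⟨?_, ?_⟩⟩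
  · have := le2 ξ ζ
    change (1 / 2) * (d ξ ζ : ℝ) ≤ @dist _ pm.toDist ξ ζ
    linarith
  · rw [one_mul]
    exact le1 ξ ζ

end Visual

/-! ### Power quasisymmetries -/

section Quasisymmetry

theorem exists_homeomorph_rpow_add_rpow {A p q : ℝ≥0} (hA : 0 < A) (hp : 0 < p) (hq : 0 < q) :
    ∃ η : ℝ≥0 ≃ₜ ℝ≥0, ∀ t, η t = A * (t ^ (p : ℝ) + t ^ (q : ℝ)) := by
  have hp' : (0 : ℝ) < p := hp
  have hq' : (0 : ℝ) < q := hq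
  let f : ℝ≥0 → ℝ≥0 := fun t => A * (t ^ (p : ℝ) + t ^ (q : ℝ))
  have hf : Continuous f := by
    refine continuous_const.mul (Continuous.add ?_ ?_)
    · exact NNReal.continuous_rpow_const hp'.le
    · exact NNReal.continuous_rpow_const hq'.le
  have hmono : StrictMono f := fun s t hst => by
    have h1 := NNReal.rpow_lt_rpow hst hp'
    have h2 := NNReal.rpow_lt_rpow hst hq'
    simp only [f]
    gcongr
  have hsurj : Function.Surjective f := fun y => by
    refine mem_range_of_exists_le_of_exists_ge hf ⟨0, ?_⟩ ⟨(y / A) ^ (p : ℝ)⁻¹, ?_⟩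
    · simp [f, hp'.ne', hq'.ne']
    · simp only [f]
      rw [← NNReal.rpow_mul, inv_mul_cancel₀ hp'.ne', NNReal.rpow_one, mul_add,
        mul_div_cancel₀ _ hA.ne']
      exact le_self_add
  exact ⟨(hmono.orderIsoOfSurjective f hsurj).toHomeomorph, fun t => rfl⟩

/-- `f` is quasisymmetric with a control function of the form `A (t ^ p + t ^ q)`. -/
def IsPowerQuasisymmetric {Z Z' : Type*} [MetricSpace Z] [MetricSpace Z'] (f : Z → Z') : Prop :=
  ∃ A p q : ℝ≥0, 0 < A ∧ 0 < p ∧ 0 < q ∧ ∀ (t : ℝ≥0) (x a b : Z),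
    dist x a ≤ t * dist x b →
      dist (f x) (f a) ≤ A * ((t : ℝ) ^ (p : ℝ) + (t : ℝ) ^ (q : ℝ)) * dist (f x) (f b)

/-- With a second point b fixed, d(x, a) small against d(x, b) allows a small t, and the control
function vanishes at 0. A one-point space has no such b. -/
theorem IsPowerQuasisymmetric.continuous {Z Z' : Type*} [MetricSpace Z] [MetricSpace Z']
    {f : Z → Z'} (hf : IsPowerQuasisymmetric f) : Continuous f := by
  obtain ⟨A, p, q, hA, hp, hq, h⟩ := hf
  obtain ⟨η, hη⟩ := exists_homeomorph_rpow_add_rpow hA hp hq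
  rw [continuous_iff_continuousAt]
  intro x
  by_cases hx : ∃ b, b ≠ x
  · obtain ⟨b, hb⟩ := hx
    have hd : 0 < dist x b := dist_pos.2 hb.symm
    rw [Metric.continuousAt_iff]
    intro ε hε
    have hlim : Tendsto (fun t : ℝ≥0 => (η t : ℝ) * dist (f x) (f b)) (𝓝 0) (𝓝 0) := by
      have h0 : η 0 = 0 := by
        rw [hη]
        simp [hp.ne', hq.ne']
      have : Continuous fun t : ℝ≥0 => (η t : ℝ) * dist (f x) (f b) := by fun_prop
      have := this.tendsto 0
      simpa [h0] using this
    obtain ⟨t, ht0, ht⟩ : ∃ t : ℝ≥0, 0 < t ∧ (η t : ℝ) * dist (f x) (f b) < ε := by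
      have h1 := hlim.eventually (gt_mem_nhds hε)
      have h2 : ∀ᶠ t in 𝓝[>] (0 : ℝ≥0), 0 < t ∧ (η t : ℝ) * dist (f x) (f b) < ε :=
        (eventually_mem_nhdsWithin (s := Set.Ioi (0 : ℝ≥0))).and (h1.filter_mono nhdsWithin_le_nhds)
      exact h2.exists
    refine ⟨t * dist x b, by positivity, fun {a} ha => ?_⟩
    rw [dist_comm] at ha ⊢
    refine (h t x a b ha.le).trans_lt ?_
    rw [hη] at ht
    push_cast at ht
    exact ht
  · push Not at hx
    have : Subsingleton Z := ⟨fun a b => (hx a).trans (hx b).symm⟩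
    exact continuous_of_const (fun a b => by rw [Subsingleton.elim a b]) |>.continuousAt

theorem IsPowerQuasisymmetric.isQuasisymmetry {Z Z' : Type*} [MetricSpace Z] [MetricSpace Z']
    {f : Z → Z'} {g : Z' → Z} (hf : IsPowerQuasisymmetric f) (hg : IsPowerQuasisymmetric g)
    (hgf : Function.LeftInverse g f) (hfg : Function.RightInverse g f) : IsQuasisymmetry f := by
  refine ⟨isHomeomorph_iff_exists_inverse.2 ⟨hf.continuous, g, hgf, hfg, hg.continuous⟩, ?_⟩
  obtain ⟨A, p, q, hA, hp, hq, h⟩ := hf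
  obtain ⟨η, hη⟩ := exists_homeomorph_rpow_add_rpow hA hp hq
  refine ⟨η, fun t x a b hab => ?_⟩
  have := h t x a b hab
  rw [hη]
  push_cast
  exact this

end Quasisymmetry

/-! ### Boundary maps of quasi-isometries -/

section BoundaryMap

variable {X X' : Type*} [MetricSpace X] [MetricSpace X'] {δ δ' : ℝ}

theorem IsHyperbolic.inducesOnBoundary_unique (hX' : IsHyperbolic X' δ') {F : X → X'}
    {f : GromovBoundary X → GromovBoundary X'} (h : InducesOnBoundary F f) {y : ℕ → X}
    {ξ : GromovBoundary X} (hy : ConvergesToBoundary y ξ) {ζ : GromovBoundary X'}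
    (hζ : ConvergesToBoundary (fun i => F (y i)) ζ) : f ξ = ζ :=
  hX'.convergesToBoundary_unique (h ξ y hy) hζ

/-- The Gromov product (x|y)_w is a difference of products with b = w, so F carries sequences with
divergent products to sequences with divergent products. -/
theorem IsQIEmbedding.exists_inducesOnBoundary [ProperSpace X'] {L ε : ℝ} {F : X → X'}
    (hF : IsQIEmbedding L ε F) (hX : IsHyperbolic X δ) (hX' : IsHyperbolic X' δ') :
    ∃ f : GromovBoundary X → GromovBoundary X', InducesOnBoundary F f := by
  obtain ⟨C, hC⟩ := hF.crossDiff_le hX.1 hX'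
  have hL := hF.one_le
  have gp : ∀ w x y, gromovProduct w x y ≤ L * gromovProduct (F w) (F x) (F y) + C := by
    intro w x y
    have := hC w w x y
    simp only [crossDiff_eq] at this
    have e : ∀ {Y : Type _} [MetricSpace Y] (w x : Y), gromovProduct w x w = 0 := by
      intro Y _ w x; simp [gromovProduct, dist_comm]
    have e' : gromovProduct (F w) (F x) (F w) = 0 := by simp [gromovProduct, dist_comm]
    rw [e, e', sub_zero, sub_zero, max_eq_left (gromovProduct_nonneg _ _ _)] at this
    exact this
  have large : ∀ (ξ : GromovBoundary X) (y z : ℕ → X) (w : X), ConvergesToBoundary y ξ →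
      ConvergesToBoundary z ξ → ∀ M : ℝ, ∃ N : ℕ, ∀ i ≥ N, ∀ j ≥ N,
        M ≤ gromovProduct (F w) (F (y i)) (F (z j)) := by
    intro ξ y z w hy hz M
    obtain ⟨N, hN⟩ := hX.gromovProduct_large hy hz w (L * M + C)
    refine ⟨N, fun i hi j hj => ?_⟩
    have h1 := (hN i hi j hj).trans (gp w (y i) (z j))
    have h2 : L * M ≤ L * gromovProduct (F w) (F (y i)) (F (z j)) := by linarith
    exact le_of_mul_le_mul_left h2 (by linarith)
  have ex : ∀ ξ : GromovBoundary X, ∃ ζ : GromovBoundary X', ∀ y : ℕ → X,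
      ConvergesToBoundary y ξ → ConvergesToBoundary (fun i => F (y i)) ζ := by
    intro ξ
    obtain ⟨c, rfl⟩ := exists_endpoint ξ
    obtain ⟨c', -, h⟩ := hX'.exists_ray_of_cauchy (F (c.toFun 0))
      (y := fun n : ℕ => F (c.toFun n))
      (large _ _ _ (c.toFun 0) c.convergesToBoundary c.convergesToBoundary)
    refine ⟨c'.endpoint, fun y hy => ?_⟩
    refine hX'.convergesToBoundary_of_gromovProduct h (F (c.toFun 0)) fun M => ?_
    obtain ⟨N, hN⟩ := large _ _ _ (c.toFun 0) c.convergesToBoundary hy M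
    exact ⟨N, fun i hi => hN i hi i hi⟩
  choose f hf using ex
  exact ⟨f, hf⟩

/-- The boundary map of a quasi-isometry quasi-preserves differences of Gromov products. -/
theorem IsQIEmbedding.boundary_crossDiff {L ε : ℝ} {F : X → X'} {G : X' → X}
    (hF : IsQIEmbedding L ε F) (hG : IsQIEmbedding L ε G) (hGF : ∀ a, dist (G (F a)) a ≤ ε)
    (hX : IsHyperbolic X δ) (hX' : IsHyperbolic X' δ')
    {f : GromovBoundary X → GromovBoundary X'} (hf : InducesOnBoundary F f)
    (hinj : Function.Injective f) (w : X) (w' : X') :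
    ∃ C : ℝ, ∀ ξ α β : GromovBoundary X, ξ ≠ α → ξ ≠ β →
      (boundaryGromovProduct w' (f ξ) (f β)).toReal -
          (boundaryGromovProduct w' (f ξ) (f α)).toReal ≤
        max (L * ((boundaryGromovProduct w ξ β).toReal - (boundaryGromovProduct w ξ α).toReal))
          (((boundaryGromovProduct w ξ β).toReal - (boundaryGromovProduct w ξ α).toReal) / L)
        + C := by
  obtain ⟨C, hC0, hC⟩ := hF.crossDiff_bounds hG hGF hX hX'
  have hL := hF.one_le
  have hδ := hX.nonneg w
  have hδ' := hX'.nonneg w'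
  refine ⟨2 * C + L * (16 * δ) + 16 * δ + 16 * δ' + 2 * dist w' (F w), fun ξ α β hα hβ => ?_⟩
  obtain ⟨c, rfl⟩ := exists_endpoint ξ
  obtain ⟨ca, rfl⟩ := exists_endpoint α
  obtain ⟨cb, rfl⟩ := exists_endpoint β
  have k := c.convergesToBoundary
  have ka := ca.convergesToBoundary
  have kb := cb.convergesToBoundary
  obtain ⟨i, ⟨⟨a1, a2⟩, a3⟩, a4⟩ :=
    ((((hX.boundaryGromovProduct_approx w hα).2 _ _ k ka).and
      ((hX.boundaryGromovProduct_approx w hβ).2 _ _ k kb)).and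
      ((hX'.boundaryGromovProduct_approx w' (hinj.ne hα)).2 _ _ (hf _ _ k) (hf _ _ ka))).and
      ((hX'.boundaryGromovProduct_approx w' (hinj.ne hβ)).2 _ _ (hf _ _ k) (hf _ _ kb)) |>.exists
  set pa := (boundaryGromovProduct w c.endpoint ca.endpoint).toReal
  set pb := (boundaryGromovProduct w c.endpoint cb.endpoint).toReal
  set pa' := (boundaryGromovProduct w' (f c.endpoint) (f ca.endpoint)).toReal
  set pb' := (boundaryGromovProduct w' (f c.endpoint) (f cb.endpoint)).toReal
  rw [abs_le] at a1 a2 a3 a4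
  obtain ⟨h1, h2⟩ := hC w (ca.toFun i) (c.toFun i) (cb.toFun i)
  obtain ⟨h3, h4⟩ := hC w (cb.toFun i) (c.toFun i) (ca.toFun i)
  rw [crossDiff_swap w (ca.toFun i), crossDiff_swap (F w) (F (ca.toFun i))] at h3
  have e1 := crossDiff_eq w (ca.toFun i) (c.toFun i) (cb.toFun i)
  have e2 := crossDiff_eq (F w) (F (ca.toFun i)) (F (c.toFun i)) (F (cb.toFun i))
  have b1 := gromovProduct_le_add_base w' (F w) (F (c.toFun i)) (F (cb.toFun i))
  have b2 := gromovProduct_le_add_base (F w) w' (F (c.toFun i)) (F (ca.toFun i))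
  rw [dist_comm (F w)] at b2
  set u := crossDiff w (ca.toFun i) (c.toFun i) (cb.toFun i)
  set u' := crossDiff (F w) (F (ca.toFun i)) (F (c.toFun i)) (F (cb.toFun i))
  have hu : u ≤ pb - pa + 16 * δ := by linarith
  have hu' : pb' - pa' ≤ u' + 16 * δ' + 2 * dist w' (F w) := by linarith
  have hL0 : 0 < L := by linarith
  have hLδ : 0 ≤ L * (16 * δ) := by positivity
  -- A difference u ≥ 0 grows by at most the factor L. For u < 0 the estimate with α and β exchanged
  -- shows that u' is at most about u / L. Hence the maximum of two slopes.
  rcases le_total 0 u with h0 | h0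
  · rw [max_eq_left h0] at h2
    have : L * u ≤ L * (pb - pa + 16 * δ) := by gcongr
    have := le_max_left (L * (pb - pa)) ((pb - pa) / L)
    linarith
  · have hm := le_max_right (L * (pb - pa)) ((pb - pa) / L)
    have hdiv : ∀ x y, x ≤ L * y → x / L ≤ y := fun x y hxy => by
      rwa [div_le_iff₀' hL0]
    have hb : u - 16 * δ ≤ pb - pa := by linarith
    have hb' : (u - 16 * δ) / L ≤ (pb - pa) / L := by gcongr
    have hd : (16 * δ) / L ≤ 16 * δ := div_le_self (by positivity) hL
    have hCd : C / L ≤ C := div_le_self hC0 hL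
    rw [sub_div] at hb'
    rw [max_eq_right h0, mul_zero, zero_add] at h2
    rcases le_total 0 u' with h0' | h0'
    · rw [max_eq_right (by linarith), mul_zero, zero_add] at h3
      have : -C / L ≤ u / L := by gcongr; linarith
      rw [neg_div] at this
      linarith
    · rw [max_eq_left (by linarith)] at h3
      have h5 : (-u - C) / L ≤ -u' := hdiv _ _ (by linarith)
      rw [sub_div, neg_div] at h5
      linarith

/-- Ratios of visual distances are exponentials of differences of Gromov products. The slopes L and
1 / L thus become exponents, and the factor κ = log a' / log a accounts for the different bases. -/
theorem IsVisualMetric.powerQuasisymmetric_of_bound {f : GromovBoundary X → GromovBoundary X'}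
    (hX : IsHyperbolic X δ) (hX' : IsHyperbolic X' δ') (hinj : Function.Injective f) {L : ℝ}
    (hL : 1 ≤ L)
    (hb : ∀ (w : X) (w' : X'), ∃ C : ℝ, ∀ ξ α β : GromovBoundary X, ξ ≠ α → ξ ≠ β →
      (boundaryGromovProduct w' (f ξ) (f β)).toReal -
          (boundaryGromovProduct w' (f ξ) (f α)).toReal ≤
        max (L * ((boundaryGromovProduct w ξ β).toReal - (boundaryGromovProduct w ξ α).toReal))
          (((boundaryGromovProduct w ξ β).toReal - (boundaryGromovProduct w ξ α).toReal) / L)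
        + C) {m : MetricSpace (GromovBoundary X)} {m' : MetricSpace (GromovBoundary X')}
    (hm : IsVisualMetric m) (hm' : IsVisualMetric m') :
    @IsPowerQuasisymmetric _ _ m m' f := by
  obtain ⟨w, a, c₁, c₂, ha, hc₁, hc₂, h⟩ := hm
  obtain ⟨w', a', c₁', c₂', ha', hc₁', hc₂', h'⟩ := hm'
  obtain ⟨C, hC⟩ := hb w w'
  have ha0 : 0 < a := by linarith
  have ha0' : 0 < a' := by linarith
  have hla := Real.log_pos ha
  have hla' := Real.log_pos ha'
  set κ := Real.log a' / Real.log a with hκ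
  have hκ0 : 0 < κ := by positivity
  have hpow : ∀ x : ℝ, a' ^ x = a ^ (κ * x) := fun x => by
    rw [Real.rpow_def_of_pos ha0', Real.rpow_def_of_pos ha0, hκ]
    congr 1
    field_simp
  set τ := c₂ / c₁ with hτ
  have hτ0 : 0 < τ := by positivity
  have hL0 : 0 < L := by linarith
  set p := κ * L
  set q := κ / L
  have hp : 0 < p := by positivity
  have hq : 0 < q := by positivity
  set A := c₂' / c₁' * a' ^ C * (τ ^ p + τ ^ q) with hA
  have hA0 : 0 < A := by positivity
  refine ⟨⟨A, hA0.le⟩, ⟨p, hp.le⟩, ⟨q, hq.le⟩, hA0, hp, hq, fun t ξ α β hab => ?_⟩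
  change m.dist ξ α ≤ t * m.dist ξ β at hab
  change m'.dist (f ξ) (f α) ≤ A * ((t : ℝ) ^ p + (t : ℝ) ^ q) * m'.dist (f ξ) (f β)
  have ht0 : (0 : ℝ) ≤ t := t.coe_nonneg
  have dn' : ∀ x y, 0 ≤ m'.dist x y := fun x y => @dist_nonneg _ m'.toPseudoMetricSpace x y
  have ds : ∀ x, m.dist x x = 0 := m.dist_self
  have ds' : ∀ x, m'.dist x x = 0 := m'.dist_self
  by_cases hα : ξ = α
  · subst hα
    rw [ds']
    have := dn' (f ξ) (f β)
    positivity
  by_cases hβ : ξ = β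
  · subst hβ
    rw [ds, mul_zero] at hab
    exact (hα (m.eq_of_dist_eq_zero (le_antisymm hab
      (@dist_nonneg _ m.toPseudoMetricSpace ξ α)))).elim
  have h1 := (h ξ α).1
  have h2 := (h ξ β).2
  have h1' := (h' (f ξ) (f α)).2
  have h2' := (h' (f ξ) (f β)).1
  have key := hC ξ α β hα hβ
  rw [negPow_of_ne_top _ (hX.boundaryGromovProduct_approx w hα).1] at h1
  rw [negPow_of_ne_top _ (hX.boundaryGromovProduct_approx w hβ).1] at h2
  rw [negPow_of_ne_top _ (hX'.boundaryGromovProduct_approx w' (hinj.ne hα)).1] at h1'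
  rw [negPow_of_ne_top _ (hX'.boundaryGromovProduct_approx w' (hinj.ne hβ)).1] at h2'
  set pa := (boundaryGromovProduct w ξ α).toReal
  set pb := (boundaryGromovProduct w ξ β).toReal
  set pa' := (boundaryGromovProduct w' (f ξ) (f α)).toReal
  set pb' := (boundaryGromovProduct w' (f ξ) (f β)).toReal
  have e1 : a ^ (pb - pa) ≤ τ * t := by
    have h3 : c₁ * a ^ (-pa) ≤ t * (c₂ * a ^ (-pb)) :=
      h1.trans (hab.trans (by gcongr))
    have h4 : a ^ (pb - pa) = a ^ (-pa) * a ^ pb := by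
      rw [← Real.rpow_add ha0]; congr 1; ring
    have h5 : a ^ (-pb) * a ^ pb = 1 := by
      rw [← Real.rpow_add ha0]; simp
    have h6 : c₁ * a ^ (-pa) * a ^ pb ≤ t * (c₂ * a ^ (-pb)) * a ^ pb := by gcongr
    rw [h4, hτ, div_mul_eq_mul_div, le_div_iff₀ hc₁]
    calc a ^ (-pa) * a ^ pb * c₁ = c₁ * a ^ (-pa) * a ^ pb := by ring
      _ ≤ t * (c₂ * a ^ (-pb)) * a ^ pb := h6
      _ = c₂ * t * (a ^ (-pb) * a ^ pb) := by ring
      _ = c₂ * t := by rw [h5, mul_one]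
  have e2 : a' ^ (pb' - pa') ≤ a' ^ C * ((τ * t) ^ p + (τ * t) ^ q) := by
    have h3 : a' ^ (pb' - pa') ≤
        a' ^ (max (L * (pb - pa)) ((pb - pa) / L) + C) :=
      Real.rpow_le_rpow_of_exponent_le ha'.le key
    rw [Real.rpow_add ha0', mul_comm] at h3
    refine h3.trans (mul_le_mul_of_nonneg_left ?_ (by positivity))
    have h4 : a' ^ (L * (pb - pa)) ≤ (τ * t) ^ p := by
      rw [hpow, show κ * (L * (pb - pa)) = (pb - pa) * p by ring, Real.rpow_mul ha0.le]
      exact Real.rpow_le_rpow (by positivity) e1 hp.le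
    have h5 : a' ^ ((pb - pa) / L) ≤ (τ * t) ^ q := by
      rw [hpow, show κ * ((pb - pa) / L) = (pb - pa) * q by ring, Real.rpow_mul ha0.le]
      exact Real.rpow_le_rpow (by positivity) e1 hq.le
    have n1 : 0 ≤ (τ * t) ^ p := by positivity
    have n2 : 0 ≤ (τ * t) ^ q := by positivity
    rcases max_choice (L * (pb - pa)) ((pb - pa) / L) with hm | hm <;> rw [hm] <;> linarith
  have e3 : (τ * t) ^ p + (τ * t) ^ q ≤ (τ ^ p + τ ^ q) * ((t : ℝ) ^ p + (t : ℝ) ^ q) := by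
    rw [Real.mul_rpow hτ0.le ht0, Real.mul_rpow hτ0.le ht0]
    have n1 : 0 ≤ τ ^ p * (t : ℝ) ^ q := by positivity
    have n2 : 0 ≤ τ ^ q * (t : ℝ) ^ p := by positivity
    linarith
  have e4 : a' ^ (-pa') = a' ^ (pb' - pa') * a' ^ (-pb') := by
    rw [← Real.rpow_add ha0']; congr 1; ring
  have e5 : a' ^ (-pb') ≤ m'.dist (f ξ) (f β) / c₁' := by
    rw [le_div_iff₀ hc₁', mul_comm]; exact h2'
  have nd := dn' (f ξ) (f β)
  calc m'.dist (f ξ) (f α) ≤ c₂' * (a' ^ (pb' - pa') * a' ^ (-pb')) := by rw [← e4]; exact h1'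
    _ ≤ c₂' * ((a' ^ C * ((τ ^ p + τ ^ q) * ((t : ℝ) ^ p + (t : ℝ) ^ q))) *
        (m'.dist (f ξ) (f β) / c₁')) := by
      gcongr
      exact e2.trans (by gcongr)
    _ = _ := by rw [hA]; field_simp

/-- A quasi-isometry of proper hyperbolic spaces induces a quasisymmetry of their boundaries. -/
theorem IsQuasiIsometry.exists_boundaryQuasisymmetry [Nonempty X] [Nonempty X'] [ProperSpace X]
    [ProperSpace X'] (hX : IsHyperbolic X δ) (hX' : IsHyperbolic X' δ') {F : X → X'}
    (hF : IsQuasiIsometry dist dist F) :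
    ∃ f : GromovBoundary X → GromovBoundary X', InducesOnBoundary F f ∧
      IsBoundaryQuasisymmetry f := by
  obtain ⟨G, L, ε, hF, hG, hGF, hFG⟩ := hF.exists_isQIEmbedding
  obtain ⟨f, hf⟩ := hF.exists_inducesOnBoundary hX hX'
  obtain ⟨g, hg⟩ := hG.exists_inducesOnBoundary hX' hX
  have hgf : Function.LeftInverse g f := fun ξ => by
    obtain ⟨c, rfl⟩ := exists_endpoint ξ
    have h := c.convergesToBoundary
    exact hX.inducesOnBoundary_unique hg (hf _ _ h) (hX.convergesToBoundary_of_dist h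
      (B := ε) fun i => by rw [dist_comm]; exact hGF _)
  have hfg : Function.RightInverse g f := fun ξ => by
    obtain ⟨c, rfl⟩ := exists_endpoint ξ
    have h := c.convergesToBoundary
    exact hX'.inducesOnBoundary_unique hf (hg _ _ h) (hX'.convergesToBoundary_of_dist h
      (B := ε) fun i => by rw [dist_comm]; exact hFG _)
  refine ⟨f, hf, hX.exists_visualMetric (Classical.arbitrary X),
    hX'.exists_visualMetric (Classical.arbitrary X'), fun m m' hm hm' => ?_⟩
  have qf := hm.powerQuasisymmetric_of_bound hX hX' hgf.injective hF.one_le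
    (fun w w' => hF.boundary_crossDiff hG hGF hX hX' hf hgf.injective w w') hm'
  have qg := hm'.powerQuasisymmetric_of_bound hX' hX hfg.injective hF.one_le
    (fun w w' => hG.boundary_crossDiff hF hFG hX' hX hg hfg.injective w w') hm
  exact @IsPowerQuasisymmetric.isQuasisymmetry _ _ m m' f g qf qg hgf hfg

end BoundaryMap

/-! ### Horofunctions -/

section Horofunctions

variable {X : Type*} [MetricSpace X] {δ : ℝ}

/-- The ray `t ↦ c (t + s)`. -/
def GeodesicRay.shift (c : GeodesicRay X) (s : ℝ≥0) : GeodesicRay X where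
  toFun t := c.toFun (t + s)
  isometry := c.isometry.comp (Isometry.of_dist_eq fun a b => by simp [NNReal.dist_eq])

theorem GeodesicRay.endpoint_shift (c : GeodesicRay X) (s : ℝ≥0) :
    (c.shift s).endpoint = c.endpoint :=
  endpoint_eq_iff.2 ⟨s, fun t => by simp [GeodesicRay.shift, c.dist_eq]⟩

/-- `h` is a horofunction about `η` with constant `D`. -/
structure IsHorofunctionWith (δ : ℝ) (η : GromovBoundary X) (h : X → ℝ) (D : ℝ) : Prop where
  nonneg : 0 ≤ D
  bound : ∀ (x w : X) (c : GeodesicRay X), c.toFun 0 = x → c.endpoint = η →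
    (∃ t : ℝ≥0, dist w (c.toFun t) ≤ 5 * δ) → |h w - h x - dist x w| ≤ D

theorem IsHorofunction.exists_with {η : GromovBoundary X} {h : X → ℝ}
    (hh : IsHorofunction δ η h) : ∃ D, IsHorofunctionWith δ η h D := by
  obtain ⟨D, hD⟩ := hh
  exact ⟨max D 0, le_max_right _ _, fun x w c h1 h2 h3 => (hD x w c h1 h2 h3).trans (le_max_left _ _)⟩

theorem IsHorofunctionWith.smul {G : Type*} [Group G] [MulAction G X] [IsIsometricSMul G X]
    {η : GromovBoundary X} {h : X → ℝ} {D : ℝ} (hh : IsHorofunctionWith δ η h D) (g : G) :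
    IsHorofunctionWith δ (g • η) (fun x => h (g⁻¹ • x)) D := by
  refine ⟨hh.nonneg, fun x w c h1 h2 ⟨t, ht⟩ => ?_⟩
  have := hh.bound (g⁻¹ • x) (g⁻¹ • w) (g⁻¹ • c) (by rw [← h1]; rfl)
    (by
      change g⁻¹ • c.endpoint = η
      rw [h2, inv_smul_smul])
    ⟨t, by
      change dist (g⁻¹ • w) (g⁻¹ • c.toFun t) ≤ _
      rwa [dist_smul]⟩
  rwa [dist_smul] at this

theorem IsHorofunctionWith.along_ray {η : GromovBoundary X} {h : X → ℝ} {D : ℝ}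
    (hh : IsHorofunctionWith δ η h D) (hX : IsHyperbolic X δ) {c : GeodesicRay X}
    (hc : c.endpoint = η) (t : ℝ≥0) : |h (c.toFun t) - h (c.toFun 0) - t| ≤ D := by
  have := hh.bound _ (c.toFun t) c rfl hc
    ⟨t, by simpa using hX.nonneg (c.toFun 0)⟩
  rwa [c.dist_zero] at this

/-- The Busemann function of a ray: t - d(x, c(t)) is nondecreasing in t and bounded by d(c(0), x),
so its supremum is attained up to 1 at all large t. -/
theorem IsHyperbolic.exists_horofunction (hX : IsHyperbolic X δ) (η : GromovBoundary X) :
    ∃ h : X → ℝ, IsHorofunctionWith δ η h (14 * δ + 2) := by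
  obtain ⟨c, rfl⟩ := exists_endpoint η
  have hδ := hX.nonneg (c.toFun 0)
  let f : X → ℝ≥0 → ℝ := fun x t => t - dist x (c.toFun t)
  have fmono : ∀ x, Monotone (f x) := fun x s t hst => by
    have := dist_triangle x (c.toFun s) (c.toFun t)
    rw [c.dist_of_le hst] at this
    simp only [f]
    linarith
  have fbdd : ∀ x, BddAbove (Set.range (f x)) := fun x => by
    refine ⟨dist (c.toFun 0) x, ?_⟩
    rintro _ ⟨t, rfl⟩
    have := dist_triangle (c.toFun 0) x (c.toFun t)
    rw [c.dist_zero] at this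
    simp only [f]
    linarith
  have approx : ∀ x, ∃ T, ∀ t ≥ T, |(⨆ t, f x t) - f x t| ≤ 1 := fun x => by
    obtain ⟨T, hT⟩ := exists_lt_of_lt_ciSup (show (⨆ t, f x t) - 1 < ⨆ t, f x t by linarith)
    refine ⟨T, fun t ht => ?_⟩
    have h1 := le_ciSup (fbdd x) t
    have h2 := fmono x ht
    rw [abs_le]
    constructor <;> linarith
  refine ⟨fun x => ⨆ t, f x t, by linarith, fun x w c' hc0 hc' ⟨t₁, ht₁⟩ => ?_⟩
  obtain ⟨Tx, hTx⟩ := approx x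
  obtain ⟨Tw, hTw⟩ := approx w
  -- Besides making both suprema nearly attained, t is so large that the point of c' within 2δ of
  -- c(t) lies beyond c'(t₁).
  set t : ℝ≥0 := max (max Tx Tw) (t₁ + nndist (c.toFun 0) x + ⟨2 * δ, by positivity⟩ +
    nndist (c.toFun 0) x) with ht
  have h1 := hTx t ((le_max_left _ _).trans (le_max_left _ _))
  have h2 := hTw t ((le_max_right _ _).trans (le_max_left _ _))
  have ht' : (t₁ : ℝ) + dist (c.toFun 0) x + 2 * δ + dist (c.toFun 0) x ≤ t := by
    have : t₁ + nndist (c.toFun 0) x + ⟨2 * δ, by positivity⟩ + nndist (c.toFun 0) x ≤ t :=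
      le_max_right _ _
    exact_mod_cast this
  have hd0 : 0 ≤ dist (c.toFun 0) x := dist_nonneg
  have ht1 : (0 : ℝ) ≤ t₁ := t₁.coe_nonneg
  obtain ⟨s, hs⟩ := hX.exists_dist_le_two_mul
    (gromovProduct_unbounded_of_endpoint_eq hc'.symm) t (by rw [hc0]; linarith)
  have a1 := dist_triangle4 (c.toFun 0) x (c'.toFun s) (c.toFun t)
  have a2 := dist_triangle x (c.toFun t) (c'.toFun s)
  have a3 := dist_triangle x (c'.toFun s) (c.toFun t)
  have a4 := dist_triangle4 w (c'.toFun t₁) (c'.toFun s) (c.toFun t)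
  have a5 := dist_triangle4 (c'.toFun t₁) w (c.toFun t) (c'.toFun s)
  have a6 := dist_triangle x (c'.toFun t₁) w
  have a7 := dist_triangle x w (c'.toFun t₁)
  have b1 := c'.dist_zero s
  have b2 := c'.dist_zero t₁
  rw [hc0] at b1 b2
  rw [c.dist_zero] at a1
  have hs1 : t₁ ≤ s := by
    rw [← NNReal.coe_le_coe]
    rw [dist_comm (c'.toFun s)] at a1
    linarith
  have b3 := c'.dist_of_le hs1
  rw [dist_comm (c'.toFun s) (c.toFun t)] at a1 a3 a4
  rw [dist_comm (c'.toFun t₁) w] at a5 a6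
  simp only [f] at h1 h2
  rw [abs_le] at *
  constructor <;> linarith [h1.1, h1.2, h2.1, h2.2]

variable [ProperSpace X]

/-- The defining inequality speaks only of rays that start at x. Any ray to η is within 2δ of such a
ray from time d(c(0), x) on, so one point far along c can serve as a reference for several x at
once. -/
theorem IsHorofunctionWith.far_along_ray {η : GromovBoundary X} {h : X → ℝ} {D : ℝ}
    (hh : IsHorofunctionWith δ η h D) (hX : IsHyperbolic X δ) {c : GeodesicRay X}
    (hc : c.endpoint = η) (x : X) {t : ℝ≥0} (ht : dist (c.toFun 0) x ≤ t) :
    |h (c.toFun t) - h x - dist x (c.toFun t)| ≤ D := by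
  obtain ⟨c', hc0, hc'⟩ := hX.exists_ray x η
  obtain ⟨s, hs⟩ := hX.exists_dist_le_two_mul
    (gromovProduct_unbounded_of_endpoint_eq (hc.trans hc'.symm)) t (by rwa [hc0])
  exact hh.bound x _ c' hc0 hc' ⟨s, by linarith [hX.nonneg x]⟩

theorem IsHorofunctionWith.sub_le {η : GromovBoundary X} {h : X → ℝ} {D : ℝ}
    (hh : IsHorofunctionWith δ η h D) (hX : IsHyperbolic X δ) (x y : X) :
    h x - h y ≤ dist x y + 2 * D := by
  obtain ⟨c, hc0, hc⟩ := hX.exists_ray x η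
  obtain ⟨t, ht⟩ : ∃ t : ℝ≥0, dist x y ≤ t := ⟨⟨_, dist_nonneg⟩, le_rfl⟩
  have h1 := hh.far_along_ray hX hc x (t := t) (by rw [hc0]; simp)
  have h2 := hh.far_along_ray hX hc y (t := t) (by rwa [hc0])
  have := dist_triangle_left y (c.toFun t) x
  rw [abs_le] at h1 h2
  linarith [h1.1, h2.2]

theorem IsHorofunctionWith.abs_sub_le {η : GromovBoundary X} {h : X → ℝ} {D : ℝ}
    (hh : IsHorofunctionWith δ η h D) (hX : IsHyperbolic X δ) (x y : X) :
    |h x - h y| ≤ dist x y + 2 * D := by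
  rw [abs_le]
  have := hh.sub_le hX x y
  have := hh.sub_le hX y x
  rw [dist_comm y x] at this
  constructor <;> linarith

theorem IsHorofunctionWith.gromovProduct_approx {η : GromovBoundary X} {h : X → ℝ} {D : ℝ}
    (hh : IsHorofunctionWith δ η h D) (hX : IsHyperbolic X δ) {c : GeodesicRay X}
    (hc : c.endpoint = η) (x : X) {t : ℝ≥0} (ht : dist (c.toFun 0) x ≤ t) :
    |h x - h (c.toFun 0) -
      (2 * gromovProduct (c.toFun 0) x (c.toFun t) - dist (c.toFun 0) x)| ≤ 2 * D := by
  have h1 := hh.far_along_ray hX hc x ht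
  have h2 := hh.along_ray hX hc t
  simp only [gromovProduct, c.dist_zero]
  rw [abs_le] at *
  constructor <;> linarith [h1.1, h1.2, h2.1, h2.2]

/-- Up to bounded error both differences equal d(y, c(t)) - d(x, c(t)) for t large, so a
horofunction is coarsely unique up to an additive constant. -/
theorem IsHorofunctionWith.sub_sub_sub {η : GromovBoundary X} {h₁ h₂ : X → ℝ} {D₁ D₂ : ℝ}
    (hh₁ : IsHorofunctionWith δ η h₁ D₁) (hh₂ : IsHorofunctionWith δ η h₂ D₂)
    (hX : IsHyperbolic X δ) (x y : X) :
    |(h₁ x - h₁ y) - (h₂ x - h₂ y)| ≤ 2 * (D₁ + D₂) := by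
  obtain ⟨c, hc0, hc⟩ := hX.exists_ray x η
  obtain ⟨t, ht⟩ : ∃ t : ℝ≥0, dist x y ≤ t := ⟨⟨_, dist_nonneg⟩, le_rfl⟩
  have a1 := hh₁.far_along_ray hX hc x (t := t) (by rw [hc0]; simp)
  have a2 := hh₁.far_along_ray hX hc y (t := t) (by rwa [hc0])
  have b1 := hh₂.far_along_ray hX hc x (t := t) (by rw [hc0]; simp)
  have b2 := hh₂.far_along_ray hX hc y (t := t) (by rwa [hc0])
  rw [abs_le] at *
  constructor <;> linarith [a1.1, a1.2, a2.1, a2.2, b1.1, b1.2, b2.1, b2.2]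

/-- h ∘ g is another horofunction about η, hence differs from h by a coarse constant. Every element
that fixes η therefore has a well-defined coarse drift towards η. -/
theorem IsHorofunctionWith.displacement {G : Type*} [Group G] [MulAction G X]
    [IsIsometricSMul G X] {η : GromovBoundary X} {h : X → ℝ} {D : ℝ}
    (hh : IsHorofunctionWith δ η h D) (hX : IsHyperbolic X δ) {g : G} (hg : g • η = η) (x y : X) :
    |(h (g • x) - h x) - (h (g • y) - h y)| ≤ 4 * D := by
  have h1 := hh.smul g⁻¹
  rw [← hg, inv_smul_smul] at h1
  simp only [inv_inv] at h1
  have := h1.sub_sub_sub hh hX x y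
  rw [abs_le] at *
  constructor <;> linarith [this.1, this.2]

/-- Rays to distinct points have bounded Gromov products, and h(c(t)) - h(c(0)) is about twice such
a product minus t. -/
theorem IsHorofunctionWith.le_sub_along_ray {η : GromovBoundary X} {h : X → ℝ} {D : ℝ}
    (hh : IsHorofunctionWith δ η h D) (hX : IsHyperbolic X δ) {c : GeodesicRay X}
    (hc : c.endpoint ≠ η) : ∃ K : ℝ, ∀ t, h (c.toFun t) ≤ K - t := by
  obtain ⟨c', hc0, hc'⟩ := hX.exists_ray (c.toFun 0) η
  obtain ⟨Q, hQ⟩ := hX.gromovProduct_bounded (hc.trans_eq hc'.symm) (c.toFun 0)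
  refine ⟨h (c.toFun 0) + 2 * Q + 2 * D, fun t => ?_⟩
  have h1 := hh.gromovProduct_approx hX hc' (c.toFun t) (t := t) (by rw [hc0, c.dist_zero])
  rw [hc0, c.dist_zero, abs_le] at h1
  linarith [h1.2, hQ t t]

variable {G : Type*} [Group G] [MulAction G X] [IsIsometricSMul G X]

/-- The displacement far along a ray is controlled by the displacement of a horofunction. -/
theorem IsHorofunctionWith.dist_smul_ray_le {η : GromovBoundary X} {h : X → ℝ} {D : ℝ}
    (hh : IsHorofunctionWith δ η h D) (hX : IsHyperbolic X δ) {g : G} (hg : g • η = η)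
    {c : GeodesicRay X} (hc : c.endpoint = η) {t : ℝ≥0}
    (ht : dist (g • c.toFun 0) (c.toFun 0) ≤ t) :
    dist (g • c.toFun t) (c.toFun t) ≤ |h (g • c.toFun 0) - h (c.toFun 0)| + 4 * D + 4 * δ := by
  have hgc : (g • c).endpoint = η := by
    change g • c.endpoint = η
    rw [hc, hg]
  obtain ⟨s, hs⟩ := hX.exists_dist_le_two_mul (c := g • c) (c' := c)
    (gromovProduct_unbounded_of_endpoint_eq (hgc.trans hc.symm)) t ht
  have h1 := hh.along_ray hX hgc t
  have h2 := hh.along_ray hX hc s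
  have h3 := hh.abs_sub_le hX ((g • c).toFun t) (c.toFun s)
  have h4 : dist (g • c.toFun t) (c.toFun s) ≤ 2 * δ := hs
  change |h (g • c.toFun t) - h (g • c.toFun 0) - t| ≤ D at h1
  change |h (g • c.toFun t) - _| ≤ dist (g • c.toFun t) _ + _ at h3
  have h5 : |(s : ℝ) - t| ≤ |h (g • c.toFun 0) - h (c.toFun 0)| + 4 * D + 2 * δ := by
    have := neg_abs_le (h (g • c.toFun 0) - h (c.toFun 0))
    have := le_abs_self (h (g • c.toFun 0) - h (c.toFun 0))
    rw [abs_le] at h1 h2 h3 ⊢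
    constructor <;> linarith [h1.1, h1.2, h2.1, h2.2, h3.1, h3.2]
  have h6 := dist_triangle (g • c.toFun t) (c.toFun s) (c.toFun t)
  rw [c.dist_eq] at h6
  linarith

/-- If `g` fixes `η` and coarsely preserves a horofunction about `η`, then a ray `c` ending at `η`
merges with `g c` at half the distance between their origins. -/
theorem IsHorofunctionWith.dist_ray_smul_le {η : GromovBoundary X} {h : X → ℝ} {D E : ℝ}
    (hh : IsHorofunctionWith δ η h D) (hX : IsHyperbolic X δ) {g : G} (hg : g • η = η)
    {c : GeodesicRay X} (hc : c.endpoint = η)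
    (hE : |h (g • c.toFun 0) - h (c.toFun 0)| ≤ E) {t : ℝ≥0}
    (ht : dist (c.toFun 0) (g • c.toFun 0) / 2 ≤ t) :
    dist (c.toFun t) (g • c.toFun t) ≤ 3 * (E + 6 * D + 2 * δ) + 4 * δ := by
  have hD := hh.nonneg
  have hδ := hX.nonneg (c.toFun 0)
  have hgc : (g • c).endpoint = η := by
    change g • c.endpoint = η
    rw [hc, hg]
  set o := c.toFun 0 with ho
  set d := dist o (g • o) with hd
  have hE0 : 0 ≤ E := (abs_nonneg _).trans hE
  rcases le_or_gt d (E + 6 * D) with hsmall | hbig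
  · have := hX.dist_ray_le_of_endpoint_eq (hc.trans hgc.symm) t
    change dist (c.toFun t) (g • c.toFun t) ≤ 3 * d + 4 * δ at this
    linarith
  -- A common lower bound for the Gromov products at o of c(T) with g o and with g⁻¹ o. So c(s₀) is
  -- δ-close to e(s₀) and, after translating by g, g c(s₀) is δ-close to e(d - s₀). These two points
  -- are only E + 6D apart.
  obtain ⟨s₀, hs₀⟩ : ∃ s₀ : ℝ≥0, (s₀ : ℝ) = (d - E - 6 * D) / 2 :=
    ⟨⟨_, by linarith⟩, rfl⟩
  have hs0 : (0 : ℝ) ≤ s₀ := s₀.coe_nonneg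
  have hdinv : dist o (g⁻¹ • o) = d := by
    rw [hd, dist_comm o (g • o), ← dist_smul g⁻¹ (g • o) o, inv_smul_smul]
  obtain ⟨T, hT⟩ : ∃ T : ℝ≥0, (T : ℝ) = d := ⟨⟨d, dist_nonneg⟩, rfl⟩
  have hsT : s₀ ≤ T := by
    rw [← NNReal.coe_le_coe]; linarith
  have p1 := hh.gromovProduct_approx hX hc (g • o) (t := T) (by rw [hT])
  have p2 := hh.gromovProduct_approx hX hc (g⁻¹ • o) (t := T) (by rw [hT, ← ho, hdinv])
  have p3 := hh.displacement hX hg o (g⁻¹ • o)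
  rw [smul_inv_smul] at p3
  rw [← ho] at p1 p2
  rw [hdinv] at p2
  rw [abs_le] at hE p1 p2 p3
  have q1 : (s₀ : ℝ) ≤ gromovProduct o (g • o) (c.toFun T) := by linarith [p1.1]
  have q2 : (s₀ : ℝ) ≤ gromovProduct o (g⁻¹ • o) (c.toFun T) := by linarith [p2.1, p3.1, p3.2]
  rw [gromovProduct_comm] at q1 q2
  obtain ⟨e, he0, he1, he⟩ := hX.1 o (g • o)
  have m0 : (0 : ℝ) ∈ Set.Icc 0 d := ⟨le_rfl, dist_nonneg⟩
  have md : d ∈ Set.Icc 0 d := ⟨dist_nonneg, le_rfl⟩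
  have m1 : (s₀ : ℝ) ∈ Set.Icc 0 d := ⟨hs0, by linarith⟩
  have m2 : d - s₀ ∈ Set.Icc 0 d := ⟨by linarith, by linarith⟩
  have f1 := he 0 m0 _ m1
  have f2 := he _ m1 d md
  have f3 := he 0 m0 _ m2
  have f4 := he _ m2 d md
  have f5 := he _ m1 _ m2
  rw [he0, zero_sub, abs_neg, abs_of_nonneg hs0] at f1
  rw [he1, abs_sub_comm, abs_of_nonneg (by linarith)] at f2
  rw [he0, zero_sub, abs_neg, abs_of_nonneg (by linarith)] at f3
  rw [he1, abs_sub_comm, abs_of_nonneg (by linarith)] at f4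
  rw [abs_sub_comm, abs_of_nonneg (by linarith)] at f5
  have c1 : dist o (c.toFun s₀) = s₀ := c.dist_zero s₀
  have c2 : dist o (c.toFun s₀) + dist (c.toFun s₀) (c.toFun T) = dist o (c.toFun T) := by
    rw [c1, c.dist_of_le hsT, ho, c.dist_zero]; ring
  have r1 : dist (c.toFun s₀) (e s₀) ≤ δ :=
    hX.2 o (c.toFun T) (g • o) _ _ c2 (by rw [f1, f2]; ring) (by rw [c1, f1])
      (by rw [c1]; exact q1)
  have r2 : dist (c.toFun s₀) (g⁻¹ • e (d - s₀)) ≤ δ := by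
    have k1 : dist o (g⁻¹ • e (d - s₀)) = s₀ := by
      rw [← dist_smul g, smul_inv_smul, dist_comm, f4]; ring
    have k2 : dist (g⁻¹ • e (d - s₀)) (g⁻¹ • o) = d - s₀ := by
      rw [dist_smul, dist_comm, f3]
    exact hX.2 o (c.toFun T) (g⁻¹ • o) _ _ c2 (by rw [k1, k2, hdinv]; ring) (by rw [c1, k1])
      (by rw [c1]; exact q2)
  rw [← dist_smul g, smul_inv_smul] at r2
  have r3 := dist_triangle4 (c.toFun s₀) (e s₀) (e (d - s₀)) (g • c.toFun s₀)
  rw [dist_comm (e (d - s₀)) (g • c.toFun s₀)] at r3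
  have hst : s₀ ≤ t := by
    rw [← NNReal.coe_le_coe]; linarith
  have e1 : (c.shift s₀).endpoint = ((g • c).shift s₀).endpoint := by
    rw [c.endpoint_shift, (g • c).endpoint_shift, hc, hgc]
  have := hX.dist_ray_le_of_endpoint_eq e1 (t - s₀)
  change dist (c.toFun (t - s₀ + s₀)) (g • c.toFun (t - s₀ + s₀)) ≤
    3 * dist (c.toFun (0 + s₀)) (g • c.toFun (0 + s₀)) + 4 * δ at this
  rw [tsub_add_cancel_of_le hst, zero_add] at this
  linarith

end Horofunctions

/-! ### Conical limit points are not parabolic -/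

section Conical

variable {X : Type*} [MetricSpace X]

theorem convergesToBoundary_comp {y : ℕ → X} {ξ : GromovBoundary X}
    (h : ConvergesToBoundary y ξ) {φ : ℕ → ℕ} (hφ : Tendsto φ atTop atTop) :
    ConvergesToBoundary (fun n => y (φ n)) ξ := by
  obtain ⟨c, hc, hy⟩ := h
  exact ⟨c, hc, hy.comp ((hφ.comp tendsto_fst).prodMk tendsto_snd)⟩

variable [ProperSpace X] {δ : ℝ} {G : Type*} [Group G] [MulAction G X]
  [IsIsometricSMul G X]

/-- A subgroup that fixes a conical limit point `η` and coarsely preserves a horofunction about `η`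
is finite. -/
theorem IsHorofunctionWith.finite_of_conical (hX : IsHyperbolic X δ) {o : X} {r : ℝ}
    (hfin : ∀ R, {g : G | dist o (g • o) ≤ R}.Finite) {η : GromovBoundary X} {h : X → ℝ} {D M : ℝ}
    (hh : IsHorofunctionWith δ η h D) {c : GeodesicRay X} (hc : c.endpoint = η)
    (hcon : ∀ T : ℝ≥0, ∃ t ≥ T, ∃ g : G, dist (c.toFun t) (g • o) ≤ r) {H : Subgroup G}
    (hH : ∀ k ∈ H, k • η = η) (hM : ∀ k ∈ H, |h (k • c.toFun 0) - h (c.toFun 0)| ≤ M) :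
    Finite H := by
  by_contra hinf
  rw [not_finite_iff_infinite] at hinf
  have hFfin := hfin (M + 4 * D + 4 * δ + 2 * r)
  -- Take one more element of H than there are group elements with the displacement allowed below.
  -- At a return c(t) ≈ g o after all their displacements of c(0), conjugation by g maps them
  -- injectively into that finite set.
  obtain ⟨A, hA⟩ := Infinite.exists_subset_card_eq H (hFfin.toFinset.card + 1)
  obtain ⟨T, hT⟩ : ∃ T : ℝ≥0, ∀ k ∈ A, dist ((k : G) • c.toFun 0) (c.toFun 0) ≤ T := by
    obtain ⟨T, hT⟩ :=
      (A.image fun k : H => nndist ((k : G) • c.toFun 0) (c.toFun 0)).exists_le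
    exact ⟨T, fun k hk => hT _ (Finset.mem_image_of_mem _ hk)⟩
  obtain ⟨t, ht, g, hg⟩ := hcon T
  have hcard : A.card ≤ hFfin.toFinset.card := by
    refine Finset.card_le_card_of_injOn (fun k : H => g⁻¹ * k * g) (fun k hk => ?_) ?_
    · simp only [Set.Finite.coe_toFinset, Set.mem_ofPred_eq]
      have h1 := hh.dist_smul_ray_le hX (hH k k.2) hc
        ((hT k hk).trans (by exact_mod_cast ht))
      have h2 := hM k k.2
      have h3 := dist_triangle4 (g • o) (c.toFun t) ((k : G) • c.toFun t) ((k : G) • g • o)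
      rw [dist_smul, dist_comm (g • o) (c.toFun t), dist_comm (c.toFun t) ((k : G) • _)] at h3
      rw [← dist_smul g, mul_smul, mul_smul, smul_inv_smul]
      linarith
    · intro k _ k' _ hkk
      simpa using hkk
  omega

/-- A subgroup that fixes a conical limit point `η` and does not coarsely preserve a horofunction
about `η` fixes a second point of the boundary. -/
theorem IsHorofunctionWith.exists_fixed_of_unbounded (hX : IsHyperbolic X δ) {o : X}
    (hfin : ∀ R, {g : G | dist o (g • o) ≤ R}.Finite) {η : GromovBoundary X} {h : X → ℝ} {D : ℝ}
    (hh : IsHorofunctionWith δ η h D) {c : GeodesicRay X} (hc : c.endpoint = η) {H : Subgroup G}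
    (hH : ∀ k ∈ H, k • η = η) (hM : ∀ M, ∃ k ∈ H, M < |h (k • c.toFun 0) - h (c.toFun 0)|) :
    ∃ ζ ≠ η, ∀ k ∈ H, k • ζ = ζ := by
  have hD := hh.nonneg
  have hδ := hX.nonneg o
  -- an element that moves every point far towards `η`
  obtain ⟨a, haH, ha⟩ : ∃ a ∈ H, ∀ y, 16 * D + 6 * δ + 1 ≤ h (a • y) - h y := by
    obtain ⟨k, hk, hkM⟩ := hM (16 * D + 6 * δ + 1 + 4 * D)
    rcases lt_abs.1 hkM with hpos | hneg
    · refine ⟨k, hk, fun y => ?_⟩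
      have := (abs_le.1 (hh.displacement hX (hH k hk) y (c.toFun 0))).1
      linarith
    · refine ⟨k⁻¹, inv_mem hk, fun y => ?_⟩
      have := (abs_le.1 (hh.displacement hX (hH k hk) (k⁻¹ • y) (c.toFun 0))).2
      rw [smul_inv_smul] at this
      linarith
  have haη := hH a haH
  have hapow : ∀ n : ℕ, a ^ n • η = η := fun n => hH _ (pow_mem haH n)
  -- a point `x` on a ray `c₁` such that `a x` is close to `c₁`
  obtain ⟨c₁, hc₁, s₀, hs₀, hax⟩ : ∃ c₁ : GeodesicRay X, c₁.endpoint = η ∧ ∃ s₀ : ℝ≥0,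
      4 * δ ≤ s₀ ∧ dist (a • c₁.toFun 0) (c₁.toFun s₀) ≤ 2 * δ := by
    obtain ⟨t₀, ht₀⟩ : ∃ t₀ : ℝ≥0, dist (a • c.toFun 0) (c.toFun 0) ≤ t₀ :=
      ⟨⟨_, dist_nonneg⟩, le_rfl⟩
    have hac : (a • c).endpoint = c.endpoint := by
      change a • c.endpoint = _
      rw [hc, haη]
    obtain ⟨s, hs⟩ := hX.exists_dist_le_two_mul (gromovProduct_unbounded_of_endpoint_eq hac) t₀ ht₀
    change dist (a • c.toFun t₀) _ ≤ _ at hs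
    have h1 := hh.along_ray hX hc t₀
    have h2 := hh.along_ray hX hc s
    have h3 := hh.abs_sub_le hX (a • c.toFun t₀) (c.toFun s)
    have h4 := ha (c.toFun t₀)
    rw [abs_le] at h1 h2 h3
    have hst : (t₀ : ℝ) + 4 * δ ≤ s := by linarith [h1.1, h2.2, h3.2]
    have hst' : t₀ ≤ s := by
      rw [← NNReal.coe_le_coe]; linarith
    refine ⟨c.shift t₀, (c.endpoint_shift t₀).trans hc, s - t₀, ?_, ?_⟩
    · rw [NNReal.coe_sub hst']; linarith
    · change dist (a • c.toFun (0 + t₀)) (c.toFun (s - t₀ + t₀)) ≤ _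
      rwa [zero_add, tsub_add_cancel_of_le hst']
  set x := c₁.toFun 0 with hx
  have hgc : ∀ {k : G}, k • η = η → (k • c₁).endpoint = η := fun {k} hk => by
    change k • c₁.endpoint = η
    rw [hc₁, hk]
  -- The error does not accumulate. The ray a ^ n c₁ is asymptotic to c₁ and starts within 4δ ≤ s₀
  -- of it, so at time s₀ it is already within 2δ of c₁, and a ^ (n + 1) x is within 2δ of it.
  have near : ∀ n : ℕ, ∃ s : ℝ≥0, dist (a ^ n • x) (c₁.toFun s) ≤ 4 * δ := by
    intro n
    induction n with
    | zero => exact ⟨0, by simpa [hx] using hδ⟩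
    | succ n ih =>
      obtain ⟨s, hs⟩ := ih
      have e : (a ^ n • c₁).endpoint = (c₁.shift s).endpoint := by
        rw [hgc (hapow n), c₁.endpoint_shift, hc₁]
      obtain ⟨s', hs'⟩ := hX.exists_dist_le_two_mul
        (gromovProduct_unbounded_of_endpoint_eq e) s₀ (by
          change dist (a ^ n • x) (c₁.toFun (0 + s)) ≤ _
          rw [zero_add]
          linarith)
      refine ⟨s' + s, ?_⟩
      change dist (a ^ n • c₁.toFun s₀) (c₁.toFun (s' + s)) ≤ 2 * δ at hs'
      have := dist_triangle (a ^ (n + 1) • x) (a ^ n • c₁.toFun s₀) (c₁.toFun (s' + s))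
      rw [pow_succ, mul_smul, dist_smul] at this
      rw [pow_succ, mul_smul]
      linarith
  choose s hs using near
  -- The drift b n, the position s n on c₁ and the distance d(x, a ^ n x) agree up to constants, and
  -- b is coarsely additive. So the orbit of x under powers of a is quasigeodesic.
  set b : ℕ → ℝ := fun n => h (a ^ n • x) - h x with hb
  have hb1 : ∀ n : ℕ, (n : ℝ) ≤ b n := by
    intro n
    induction n with
    | zero => simp [hb]
    | succ n ih =>
      have := ha (a ^ n • x)
      rw [← mul_smul, ← pow_succ'] at this
      simp only [hb] at ih ⊢
      push_cast
      linarith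
  have sb : ∀ n, |(s n : ℝ) - b n| ≤ 4 * δ + 3 * D := fun n => by
    have h1 := hh.along_ray hX hc₁ (s n)
    have h2 := hh.abs_sub_le hX (a ^ n • x) (c₁.toFun (s n))
    have h3 := hs n
    simp only [hb]
    rw [abs_le] at *
    constructor <;> linarith [h1.1, h1.2, h2.1, h2.2]
  have pb : ∀ n, |dist x (a ^ n • x) - b n| ≤ 8 * δ + 3 * D := fun n => by
    have h1 := c₁.dist_zero (s n)
    have h2 := dist_triangle x (c₁.toFun (s n)) (a ^ n • x)
    have h3 := dist_triangle x (a ^ n • x) (c₁.toFun (s n))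
    have h4 := hs n
    have h5 := sb n
    rw [dist_comm (c₁.toFun (s n))] at h2
    rw [← hx] at h1
    rw [abs_le] at *
    constructor <;> linarith [h5.1, h5.2]
  have badd : ∀ n m, |b (n + m) - b n - b m| ≤ 4 * D := fun n m => by
    have := hh.displacement hX (hapow n) (a ^ m • x) x
    rw [← mul_smul, ← pow_add] at this
    simp only [hb]
    rw [abs_le] at *
    constructor <;> linarith [this.1, this.2]
  -- Far along c₁ the element k displaces a ^ m x by a bounded amount, so its conjugates by large
  -- powers of a lie in a finite set. Two of them coincide, and k commutes with the quotient of the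
  -- two powers.
  have commutes : ∀ k ∈ H, ∃ j : ℕ, 1 ≤ j ∧ Commute k (a ^ j) := by
    intro k hk
    obtain ⟨N, hN⟩ := exists_nat_ge (dist (k • c₁.toFun 0) (c₁.toFun 0) + (4 * δ + 3 * D))
    set R := |h (k • c₁.toFun 0) - h (c₁.toFun 0)| + 4 * D + 4 * δ + 8 * δ + 2 * dist o x with hR
    have hmem : ∀ n : ℕ, (a ^ (N + n))⁻¹ * k * a ^ (N + n) ∈ {g : G | dist o (g • o) ≤ R} := by
      intro n
      set m := N + n with hm
      have h1 := (abs_le.1 (sb m)).1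
      have h2 := hb1 m
      have h3 : (N : ℝ) ≤ m := by rw [hm]; push_cast; linarith [n.cast_nonneg (α := ℝ)]
      have h4 := hh.dist_smul_ray_le hX (hH k hk) hc₁ (t := s m) (by linarith)
      have h5 := dist_triangle4 (a ^ m • x) (c₁.toFun (s m)) (k • c₁.toFun (s m)) (k • a ^ m • x)
      rw [dist_smul, dist_comm (c₁.toFun (s m)) (k • _), dist_comm (c₁.toFun (s m)) (a ^ m • x)]
        at h5
      have h6 := dist_triangle4 o x (((a ^ m)⁻¹ * k * a ^ m) • x) (((a ^ m)⁻¹ * k * a ^ m) • o)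
      have h7 : dist x (((a ^ m)⁻¹ * k * a ^ m) • x) = dist (a ^ m • x) (k • a ^ m • x) := by
        rw [← dist_smul (a ^ m), mul_smul, mul_smul, smul_inv_smul]
      rw [dist_smul, h7, dist_comm x o] at h6
      simp only [Set.mem_ofPred_eq, hR]
      linarith [hs m]
    have : ¬ Function.Injective fun n : ℕ =>
        (⟨(a ^ (N + n))⁻¹ * k * a ^ (N + n), hmem n⟩ : {g : G | dist o (g • o) ≤ R}) := fun hi => by
      have := (hfin R).to_subtype
      exact not_injective_infinite_finite _ hi
    simp only [Function.Injective, not_forall] at this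
    obtain ⟨n, m, hnm, hne⟩ := this
    have hnm : (a ^ (N + n))⁻¹ * k * a ^ (N + n) = (a ^ (N + m))⁻¹ * k * a ^ (N + m) :=
      congrArg Subtype.val hnm
    have comm : ∀ n m : ℕ, n < m →
        (a ^ (N + n))⁻¹ * k * a ^ (N + n) = (a ^ (N + m))⁻¹ * k * a ^ (N + m) →
        ∃ j : ℕ, 1 ≤ j ∧ Commute k (a ^ j) := by
      intro n m hlt hnm
      refine ⟨m - n, by omega, ?_⟩
      have e : a ^ (N + m) = a ^ (m - n) * a ^ (N + n) := by
        rw [← pow_add]; congr 1; omega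
      rw [e] at hnm
      have : k = (a ^ (m - n))⁻¹ * k * a ^ (m - n) := by
        calc k = a ^ (N + n) * ((a ^ (N + n))⁻¹ * k * a ^ (N + n)) * (a ^ (N + n))⁻¹ := by group
          _ = _ := by rw [hnm]; group
      change k * a ^ (m - n) = a ^ (m - n) * k
      conv_rhs => rw [this]
      group
    rcases lt_or_gt_of_ne hne with hlt | hlt
    · exact comm n m hlt hnm
    · exact comm m n hlt hnm.symm
  -- the repelling point of `a`
  have dinv : ∀ n m : ℕ, dist ((a ^ (n + m))⁻¹ • x) ((a ^ n)⁻¹ • x) = dist x (a ^ m • x) := by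
    intro n m
    rw [← dist_smul (a ^ (n + m)), smul_inv_smul, ← mul_smul, add_comm n m, pow_add,
      mul_inv_cancel_right]
  have dinv0 : ∀ n : ℕ, dist x ((a ^ n)⁻¹ • x) = dist x (a ^ n • x) := by
    intro n
    rw [← dist_smul (a ^ n) x ((a ^ n)⁻¹ • x), smul_inv_smul, dist_comm]
  have gpl : ∀ n m : ℕ, (n : ℝ) - (20 * δ + 20 * D) ≤
      gromovProduct x ((a ^ (n + m))⁻¹ • x) ((a ^ n)⁻¹ • x) := by
    intro n m
    simp only [gromovProduct, dinv, dinv0]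
    have h1 := abs_le.1 (pb (n + m))
    have h2 := abs_le.1 (pb n)
    have h3 := abs_le.1 (pb m)
    have h4 := abs_le.1 (badd n m)
    linarith [h1.1, h2.1, h3.2, h4.1, hb1 n]
  obtain ⟨c₂, -, hc₂⟩ := hX.exists_ray_of_cauchy x (y := fun n => (a ^ n)⁻¹ • x) (by
    intro M
    obtain ⟨N, hN⟩ := exists_nat_ge (M + (20 * δ + 20 * D))
    refine ⟨N, fun i hi j hj => ?_⟩
    rcases le_total i j with hij | hij
    · obtain ⟨m, rfl⟩ := Nat.exists_eq_add_of_le hij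
      have := gpl i m
      rw [gromovProduct_comm] at this
      have hi' : (N : ℝ) ≤ i := by exact_mod_cast hi
      linarith
    · obtain ⟨m, rfl⟩ := Nat.exists_eq_add_of_le hij
      have := gpl j m
      have hj' : (N : ℝ) ≤ j := by exact_mod_cast hj
      linarith)
  refine ⟨c₂.endpoint, fun hη => ?_, fun k hk => ?_⟩
  -- Along a⁻ⁿ x the horofunction falls about as fast as the distance from x grows, which keeps the
  -- Gromov product with the ray c₁ bounded.
  · rw [hη, ← hc₁, convergesToBoundary_iff x] at hc₂
    obtain ⟨N, hN⟩ := hc₂ (10 * δ + 20 * D + 1)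
    obtain ⟨t, ht⟩ : ∃ t : ℝ≥0, t = max (N : ℝ≥0) (nndist x ((a ^ N)⁻¹ • x)) := ⟨_, rfl⟩
    have h1 := hN N le_rfl t (by rw [ht]; exact le_max_left _ _)
    have h2 := hh.gromovProduct_approx hX hc₁ ((a ^ N)⁻¹ • x) (t := t) (by
      rw [ht]
      exact_mod_cast le_max_right _ _)
    rw [← hx, dinv0] at h2
    have h3 := hh.displacement hX (hapow N) ((a ^ N)⁻¹ • x) x
    rw [smul_inv_smul] at h3
    have h4 := abs_le.1 (pb N)
    rw [abs_le] at h2 h3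
    simp only [hb] at h4
    linarith [h2.1, h2.2, h3.1, h3.2, h4.1, h4.2]
  · obtain ⟨j, hj, hcomm⟩ := commutes k hk
    have hsub : Tendsto (fun n : ℕ => j * n) atTop atTop :=
      tendsto_id.const_mul_atTop' (by omega)
    have h1 := convergesToBoundary_comp hc₂ hsub
    have h2 := convergesToBoundary_smul k h1
    refine hX.convergesToBoundary_unique h2
      (hX.convergesToBoundary_of_dist h1 (B := dist x (k • x)) fun n => ?_)
    -- By commutation, k moves each point of the subsequence a⁻ʲⁿ x by the constant distance d(x, k
    -- x).
    have e : k * (a ^ (j * n))⁻¹ = (a ^ (j * n))⁻¹ * k := by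
      rw [pow_mul]
      exact ((hcomm.pow_right n).inv_right).eq
    rw [← mul_smul, e, mul_smul, dist_smul]

theorem IsHyperbolic.not_isParabolicPoint_of_conical (hX : IsHyperbolic X δ) {o : X} {r : ℝ}
    (hfin : ∀ R, {g : G | dist o (g • o) ≤ R}.Finite) {c : GeodesicRay X}
    (hcon : ∀ T : ℝ≥0, ∃ t ≥ T, ∃ g : G, dist (c.toFun t) (g • o) ≤ r) :
    ¬ IsParabolicPoint G c.endpoint := by
  rintro ⟨H, hinf, hH⟩
  obtain ⟨h, hh⟩ := hX.exists_horofunction c.endpoint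
  have hfix := (hH c.endpoint).2 rfl
  by_cases hM : ∃ M, ∀ k ∈ H, |h (k • c.toFun 0) - h (c.toFun 0)| ≤ M
  · obtain ⟨M, hM⟩ := hM
    have := hh.finite_of_conical hX hfin rfl hcon hfix hM
    exact not_finite H
  · push Not at hM
    obtain ⟨ζ, hζ, hk⟩ := hh.exists_fixed_of_unbounded hX hfin rfl hfix hM
    exact hζ ((hH ζ).1 hk)

end Conical

/-! ### Horoballs in cusp uniform actions -/

section Horoballs

variable {X : Type*} [MetricSpace X] {δ : ℝ}

theorem inter_frontier_nonempty_of_isPreconnected {Y : Type*} [TopologicalSpace Y] {s u : Set Y}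
    (hs : IsPreconnected s) (h : (s ∩ u).Nonempty) (h' : (s ∩ uᶜ).Nonempty) :
    (s ∩ frontier u).Nonempty := by
  by_contra hne
  have hf : ∀ x ∈ s, x ∉ frontier u := fun x hx hxf => hne ⟨x, hx, hxf⟩
  have hin : ∀ x ∈ s, x ∈ u → x ∈ interior u := fun x hx hxu => by
    by_contra hni
    exact hf x hx ⟨subset_closure hxu, hni⟩
  have hout : ∀ x ∈ s, x ∉ u → x ∈ (closure u)ᶜ := fun x hx hxu hcl =>
    hf x hx ⟨hcl, fun hi => hxu (interior_subset hi)⟩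
  obtain ⟨a, has, hau⟩ := h
  obtain ⟨b, hbs, hbu⟩ := h'
  obtain ⟨z, -, hz, hz'⟩ := hs (interior u) (closure u)ᶜ isOpen_interior isClosed_closure.isOpen_compl
    (fun x hx => (em (x ∈ u)).imp (hin x hx) (hout x hx)) ⟨a, has, hin a has hau⟩
    ⟨b, hbs, hout b hbs hbu⟩
  exact hz' (subset_closure (interior_subset hz))

theorem IsGeodesicSpace.inter_frontier_nonempty (hX : IsGeodesicSpace X) {B : Set X} {x y : X}
    (hx : x ∈ B) (hy : y ∉ B) : ∃ z ∈ frontier B, dist x z ≤ dist x y := by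
  obtain ⟨e, he0, he1, he⟩ := hX x y
  have hcont : ContinuousOn e (Set.Icc 0 (dist x y)) := by
    intro s hs
    rw [Metric.continuousWithinAt_iff]
    intro ε hε
    refine ⟨ε, hε, fun {t} ht hts => ?_⟩
    rwa [he t ht s hs, ← Real.dist_eq]
  have hpre : IsPreconnected (e '' Set.Icc 0 (dist x y)) := isPreconnected_Icc.image e hcont
  obtain ⟨z, ⟨s, hs, rfl⟩, hz⟩ := inter_frontier_nonempty_of_isPreconnected (u := B) hpre
    ⟨x, ⟨0, ⟨le_rfl, dist_nonneg⟩, he0⟩, hx⟩ ⟨y, ⟨_, ⟨dist_nonneg, le_rfl⟩, he1⟩, hy⟩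
  refine ⟨e s, hz, ?_⟩
  have := he 0 ⟨le_rfl, dist_nonneg⟩ s hs
  rw [he0, zero_sub, abs_neg, abs_of_nonneg hs.1] at this
  rw [this]
  exact hs.2

theorem GeodesicRay.inter_frontier_nonempty (c : GeodesicRay X) {B : Set X} {t : ℝ≥0}
    (h0 : c.toFun 0 ∉ B) (ht : c.toFun t ∈ B) : ∃ s ≤ t, c.toFun s ∈ frontier B := by
  have hpre : IsPreconnected (c.toFun '' Set.Icc 0 t) :=
    isPreconnected_Icc.image _ c.isometry.continuous.continuousOn
  obtain ⟨z, ⟨s, hs, rfl⟩, hz⟩ := inter_frontier_nonempty_of_isPreconnected (u := B) hpre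
    ⟨_, ⟨t, ⟨zero_le, le_rfl⟩, rfl⟩, ht⟩ ⟨_, ⟨0, ⟨le_rfl, zero_le⟩, rfl⟩, h0⟩
  exact ⟨s, hs.2, hz⟩

/-- Two centers near the same point of a finite 1/2-net are less than 1 apart, so their sets meet
and must coincide. -/
theorem finite_of_disjoint_balls [ProperSpace X] {𝒜 : Set (Set X)} (hd : 𝒜.PairwiseDisjoint id)
    (o : X) (R : ℝ) (h : ∀ A ∈ 𝒜, ∃ a, dist a o ≤ R ∧ Metric.ball a 1 ⊆ A) : 𝒜.Finite := by
  obtain ⟨t, -, htf, ht⟩ :=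
    (isCompact_closedBall o R).finite_cover_balls (e := 1 / 2) (by norm_num)
  have : Nonempty X := ⟨o⟩
  choose! a ha1 ha2 using h
  have hb : ∀ A ∈ 𝒜, ∃ b ∈ t, dist (a A) b < 1 / 2 := fun A hA => by
    have := ht (Metric.mem_closedBall.2 (ha1 A hA))
    simpa using this
  choose! b hbt hb using hb
  refine htf.of_injOn (f := b) (fun A hA => hbt A hA) fun A hA A' hA' hAA => ?_
  by_contra hne
  have h1 := hb A hA
  have h2 := hb A' hA'
  rw [hAA] at h1
  have h3 := dist_triangle_right (a A) (a A') (b A')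
  exact Set.disjoint_left.1 (hd hA hA' hne)
    (ha2 A hA (show a A' ∈ _ by rw [Metric.mem_ball, dist_comm]; linarith))
    (ha2 A' hA' (Metric.mem_ball_self one_pos))

theorem IsHorofunctionWith.mem_of_dist_ray {η : GromovBoundary X} {h : X → ℝ} {D : ℝ}
    [ProperSpace X] (hh : IsHorofunctionWith δ η h D) (hX : IsHyperbolic X δ) {c : GeodesicRay X}
    (hc : c.endpoint = η) {t : ℝ≥0} {y : X} {R : ℝ} (hy : dist (c.toFun t) y ≤ R)
    (ht : R + 3 * D - h (c.toFun 0) < t) : 0 < h y := by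
  have h1 := (abs_le.1 (hh.along_ray hX hc t)).1
  have h2 := hh.sub_le hX (c.toFun t) y
  linarith

theorem IsHyperbolic.visual_from [ProperSpace X] (hX : IsHyperbolic X δ) (hv : IsVisual X)
    (z : X) : ∃ C : ℝ, ∀ x : X, ∃ c : GeodesicRay X, c.toFun 0 = z ∧
      ∃ t : ℝ≥0, dist x (c.toFun t) ≤ C := by
  obtain ⟨w, C, hC⟩ := hv
  refine ⟨C + (3 * dist w z + 4 * δ), fun x => ?_⟩
  obtain ⟨c, hc, t, ht⟩ := hC x
  obtain ⟨c', hc', he⟩ := hX.exists_ray z c.endpoint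
  have h1 := hX.dist_ray_le_of_endpoint_eq he.symm t
  rw [hc, hc'] at h1
  exact ⟨c', hc', t, (dist_triangle _ _ _).trans (add_le_add ht h1)⟩

/-- In a visual space every point is close to a ray that ends at `η` and starts outside of a
given horoball about `η`. -/
theorem IsHorofunctionWith.exists_ray_near [ProperSpace X] {η : GromovBoundary X} {h : X → ℝ}
    {D : ℝ} (hh : IsHorofunctionWith δ η h D) (hX : IsHyperbolic X δ) (hv : IsVisual X)
    {z : X} (hz : h z ≤ 0) : ∃ C : ℝ, ∀ x : X, ∃ c : GeodesicRay X, c.endpoint = η ∧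
      h (c.toFun 0) ≤ 0 ∧ ∃ t : ℝ≥0, dist x (c.toFun t) ≤ C := by
  have hδ := hX.nonneg z
  obtain ⟨C, hC⟩ := hX.visual_from hv z
  refine ⟨C + 2 * δ, fun x => ?_⟩
  obtain ⟨c, hc0, t, ht⟩ := hC x
  by_cases hcη : c.endpoint = η
  · exact ⟨c, hcη, by rwa [hc0], t, by linarith⟩
  obtain ⟨K, hK⟩ := hh.le_sub_along_ray hX hcη
  -- The ray is continued past c(t) to a point y with h y ≤ 0. In the ideal triangle z, y, η, cut
  -- off at a far point u of c₁, the point c(t) of [z,y] is close to one of the sides ending at η,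
  -- and both of these start outside the horoball.
  obtain ⟨s, hs⟩ : ∃ s : ℝ≥0, s = max t K.toNNReal := ⟨_, rfl⟩
  have hts : t ≤ s := hs ▸ le_max_left _ _
  have hKs : K ≤ s := (Real.le_coe_toNNReal K).trans
    (by exact_mod_cast (hs ▸ le_max_right t K.toNNReal : K.toNNReal ≤ s))
  have hy : h (c.toFun s) ≤ 0 := by linarith [hK s]
  obtain ⟨c₁, hc₁0, hc₁⟩ := hX.exists_ray z η
  obtain ⟨c₂, hc₂0, hc₂⟩ := hX.exists_ray (c.toFun s) η
  obtain ⟨T', T, hTT⟩ := gromovProduct_unbounded_of_endpoint_eq (hc₂.trans hc₁.symm) s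
  set y := c.toFun s with hydef
  set u := c₁.toFun T with hu
  rw [hc₂0] at hTT
  have d1 : dist z (c.toFun t) = t := by rw [← hc0, c.dist_zero]
  have d2 : dist (c.toFun t) y = s - t := c.dist_of_le hts
  have d3 : dist z y = s := by rw [← hc0, hydef, c.dist_zero]
  have d4 : dist z u = T := by rw [← hc₁0, hu, c₁.dist_zero]
  rcases le_total (t : ℝ) (gromovProduct z y u) with hcase | hcase
  · have htT : t ≤ T := by
      have := hcase.trans (gromovProduct_le_right _ _ _)
      rw [d4] at this
      exact this
    have e1 : dist z (c₁.toFun t) = t := by rw [← hc₁0, c₁.dist_zero]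
    have := hX.2 z y u (c.toFun t) (c₁.toFun t) (by linarith)
      (by rw [e1, hu, c₁.dist_of_le htT, ← hu, d4]; ring) (by rw [d1, e1]) (by rw [d1]; exact hcase)
    refine ⟨c₁, hc₁, by rwa [hc₁0], t, ?_⟩
    have := dist_triangle x (c.toFun t) (c₁.toFun t)
    linarith
  · have hg : gromovProduct y z u = s - gromovProduct z y u := by
      simp only [gromovProduct, dist_comm y z, d3, d4]; ring
    have hst0 : (0 : ℝ) ≤ (s : ℝ) - t := by
      have : (t : ℝ) ≤ s := hts
      linarith
    obtain ⟨v, hv1, hv2⟩ := hX.1.exists_between y u hst0 (by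
      have := gromovProduct_le_right y z u
      linarith)
    have e1 := hX.2 y z u (c.toFun t) v
      (by rw [dist_comm y (c.toFun t), dist_comm (c.toFun t) z, dist_comm y z]; linarith)
      (by linarith) (by rw [dist_comm, d2, hv1]) (by rw [dist_comm, d2]; linarith)
    have hstT : s - t ≤ T' := by
      have h1 := hTT.trans (gromovProduct_le_left _ _ _)
      rw [← hc₂0, c₂.dist_zero] at h1
      exact tsub_le_self.trans (by exact_mod_cast h1)
    have e2 : dist y (c₂.toFun (s - t)) = s - t := by
      rw [← hc₂0, c₂.dist_zero, NNReal.coe_sub hts]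
    have e3 : dist (c₂.toFun (s - t)) (c₂.toFun T') = T' - (s - t) := by
      rw [c₂.dist_of_le hstT, NNReal.coe_sub hts]
    have e4 := hX.2 y u (c₂.toFun T') v (c₂.toFun (s - t)) (by linarith)
      (by
        have : dist y (c₂.toFun T') = T' := by rw [← hc₂0, c₂.dist_zero]
        rw [e2, e3, this]; ring)
      (by rw [hv1, e2])
      (by
        rw [hv1, gromovProduct_comm]
        have : (0 : ℝ) ≤ t := t.coe_nonneg
        linarith)
    refine ⟨c₂, hc₂, by rwa [hc₂0], s - t, ?_⟩
    have := dist_triangle4 x (c.toFun t) v (c₂.toFun (s - t))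
    linarith

/-- `B` is an open horoball about `η`, with horofunction `h`. -/
structure IsHoroballWith (δ : ℝ) (η : GromovBoundary X) (B : Set X) (h : X → ℝ) (D : ℝ) : Prop where
  isOpen : IsOpen B
  horofunction : IsHorofunctionWith δ η h D
  eq : B = {x | 0 < h x}

theorem IsHoroballWith.mem_iff {η : GromovBoundary X} {B : Set X} {h : X → ℝ} {D : ℝ}
    (hB : IsHoroballWith δ η B h D) {x : X} : x ∈ B ↔ 0 < h x := by
  rw [hB.eq]; rfl

theorem IsOpenHoroball.exists_with {η : GromovBoundary X} {B : Set X}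
    (hB : IsOpenHoroball δ η B) : ∃ h D, IsHoroballWith δ η B h D := by
  obtain ⟨ho, h, hh, he⟩ := hB
  obtain ⟨D, hD⟩ := hh.exists_with
  exact ⟨h, D, ho, hD, he⟩

variable {G : Type*} [Group G] [MulAction G X] [IsIsometricSMul G X]

theorem IsHoroballWith.smul {η : GromovBoundary X} {B : Set X} {h : X → ℝ} {D : ℝ}
    (hB : IsHoroballWith δ η B h D) (g : G) :
    IsHoroballWith δ (g • η) (g • B) (fun x => h (g⁻¹ • x)) D := by
  refine ⟨hB.isOpen.smul g, hB.horofunction.smul g, ?_⟩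
  ext x
  rw [Set.mem_smul_set_iff_inv_smul_mem, hB.mem_iff]
  rfl

variable {ℙ : Set (Subgroup G)} {ℬ : Set (Set X)}

namespace IsCuspUniform

theorem exists_dist_smul_le (hC : IsCuspUniform ℙ δ ℬ) (o : X) :
    ∃ r : ℝ, 0 ≤ r ∧ ∀ x ∉ ⋃₀ ℬ, ∃ g : G, dist x (g • o) ≤ r := by
  obtain ⟨K, hK, hcov⟩ := hC.cocompact
  obtain ⟨r, hr⟩ := hK.isBounded.subset_closedBall o
  refine ⟨|r|, abs_nonneg r, fun x hx => ?_⟩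
  obtain ⟨g, k, hk, rfl⟩ := Set.mem_iUnion.1 (hcov hx)
  exact ⟨g, by
    change dist (g • k) (g • o) ≤ _
    rw [dist_smul]
    exact (hr hk).trans (le_abs_self r)⟩

theorem eq_of_mem (hC : IsCuspUniform ℙ δ ℬ) {B B' : Set X} (hB : B ∈ ℬ) (hB' : B' ∈ ℬ) {x : X}
    (hx : x ∈ B) (hx' : x ∈ B') : B = B' := by
  by_contra hne
  exact Set.disjoint_left.1 (hC.disjoint hB hB' hne) hx hx'

theorem isOpen_of_mem (hC : IsCuspUniform ℙ δ ℬ) {B : Set X} (hB : B ∈ ℬ) : IsOpen B := by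
  obtain ⟨_, _, h⟩ := hC.horoball B hB
  exact h.1

/-- Another open horoball containing a frontier point of B would meet B. So cocompactness on the
complement applies to frontier points. -/
theorem notMem_sUnion_of_mem_frontier (hC : IsCuspUniform ℙ δ ℬ) {B : Set X} (hB : B ∈ ℬ) {z : X}
    (hz : z ∈ frontier B) : z ∉ ⋃₀ ℬ := by
  rintro ⟨B', hB', hzB'⟩
  obtain ⟨y, hy', hy⟩ := mem_closure_iff.1 hz.1 B' (hC.isOpen_of_mem hB') hzB'
  have := hC.eq_of_mem hB hB' hy hy'
  subst this
  exact (hC.isOpen_of_mem hB).inter_frontier_eq.subset ⟨hzB', hz⟩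

end IsCuspUniform

variable [ProperSpace X]

theorem IsHoroballWith.eventually_mem {η : GromovBoundary X} {B : Set X} {h : X → ℝ} {D : ℝ}
    (hB : IsHoroballWith δ η B h D) (hX : IsHyperbolic X δ) {c : GeodesicRay X}
    (hc : c.endpoint = η) : ∀ᶠ t in atTop, c.toFun t ∈ B := by
  filter_upwards [eventually_gt_atTop (3 * D - h (c.toFun 0)).toNNReal] with t ht
  rw [hB.mem_iff]
  refine hB.horofunction.mem_of_dist_ray hX hc (t := t) (R := 0) (by simp) ?_
  rw [zero_add]
  exact (Real.le_coe_toNNReal _).trans_lt (by exact_mod_cast ht)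

/-- A ray to η' ends up in B, whereas a horofunction about a different point tends to -∞ along it.
-/
theorem IsHoroballWith.center_unique {η η' : GromovBoundary X} {B : Set X} {h h' : X → ℝ}
    {D D' : ℝ} (hB : IsHoroballWith δ η B h D) (hB' : IsHoroballWith δ η' B h' D')
    (hX : IsHyperbolic X δ) : η = η' := by
  obtain ⟨c, rfl⟩ := exists_endpoint η'
  by_contra hne
  obtain ⟨K, hK⟩ := hB.horofunction.le_sub_along_ray hX (Ne.symm hne)
  obtain ⟨t, ht1, ht2⟩ :=
    ((hB'.eventually_mem hX rfl).and (eventually_ge_atTop K.toNNReal)).exists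
  rw [hB.mem_iff] at ht1
  have h1 := hK t
  have h2 : K ≤ t := (Real.le_coe_toNNReal K).trans (by exact_mod_cast ht2)
  linarith

namespace IsCuspUniform

theorem finite_dist_le (hC : IsCuspUniform ℙ δ ℬ) (o : X) (R : ℝ) :
    {g : G | dist o (g • o) ≤ R}.Finite := by
  have := hC.properlyDiscontinuous
  refine (ProperlyDiscontinuousSMul.finite_disjoint_inter_image (Γ := G)
    (isCompact_closedBall o |R|) (isCompact_closedBall o |R|)).subset fun g hg => ?_
  refine ⟨g • o, ⟨o, by simp, rfl⟩, ?_⟩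
  rw [Metric.mem_closedBall, dist_comm]
  exact le_trans hg (le_abs_self R)

theorem eq_of_center_eq (hC : IsCuspUniform ℙ δ ℬ) {B B' : Set X} (hB : B ∈ ℬ) (hB' : B' ∈ ℬ)
    {η : GromovBoundary X} {h h' : X → ℝ} {D D' : ℝ} (k : IsHoroballWith δ η B h D)
    (k' : IsHoroballWith δ η B' h' D') : B = B' := by
  obtain ⟨c, rfl⟩ := exists_endpoint η
  obtain ⟨t, ht, ht'⟩ := ((k.eventually_mem hC.hyperbolic rfl).and
    (k'.eventually_mem hC.hyperbolic rfl)).exists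
  exact hC.eq_of_mem hB hB' ht ht'

theorem stabilizer_eq (hC : IsCuspUniform ℙ δ ℬ) {B : Set X} (hB : B ∈ ℬ)
    {η : GromovBoundary X} {h : X → ℝ} {D : ℝ} (k : IsHoroballWith δ η B h D) :
    MulAction.stabilizer G B = MulAction.stabilizer G η := by
  ext g
  rw [MulAction.mem_stabilizer_iff, MulAction.mem_stabilizer_iff]
  have kg := k.smul g
  constructor
  · intro hg
    rw [hg] at kg
    exact kg.center_unique k hC.hyperbolic
  · intro hg
    rw [hg] at kg
    exact hC.eq_of_center_eq (hC.smul_mem g B hB) hB kg k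

/-- Every parabolic point is the center of a horoball of the family. -/
theorem exists_horoball (hC : IsCuspUniform ℙ δ ℬ) {η : GromovBoundary X}
    (hη : IsParabolicPoint G η) : ∃ B ∈ ℬ, ∃ h D, IsHoroballWith δ η B h D := by
  by_contra! hno
  have hX := hC.hyperbolic
  obtain ⟨o, -⟩ := hC.visual
  obtain ⟨c, -, rfl⟩ := hX.exists_ray o η
  obtain ⟨r, -, hr⟩ := hC.exists_dist_smul_le o
  refine hX.not_isParabolicPoint_of_conical (hC.finite_dist_le o) (r := r) (fun T => ?_) hη
  by_contra! hT
  have hin : ∀ t ≥ T, c.toFun t ∈ ⋃₀ ℬ := fun t ht => by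
    by_contra hnot
    obtain ⟨g, hg⟩ := hr _ hnot
    exact absurd (hT t ht g) (not_lt.2 hg)
  obtain ⟨B, hB, hTB⟩ := hin T le_rfl
  -- A ray that avoids the orbit neighborhood stays in the union of the disjoint open horoballs,
  -- hence by connectedness in a single one, whose center must be its endpoint.
  have hpre : IsPreconnected (c.toFun '' Set.Ici T) :=
    isPreconnected_Ici.image _ c.isometry.continuous.continuousOn
  have hsub : c.toFun '' Set.Ici T ⊆ B := by
    refine hpre.subset_left_of_subset_union (v := ⋃₀ (ℬ \ {B})) (hC.isOpen_of_mem hB)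
      (isOpen_sUnion fun B' hB' => hC.isOpen_of_mem hB'.1) ?_ ?_
      ⟨_, ⟨T, Set.mem_Ici.2 le_rfl, rfl⟩, hTB⟩
    · rw [Set.disjoint_sUnion_right]
      exact fun B' hB' => hC.disjoint hB hB'.1 (Ne.symm hB'.2)
    · rintro _ ⟨t, ht, rfl⟩
      obtain ⟨B', hB', htB'⟩ := hin t ht
      by_cases h : B' = B
      · exact Or.inl (h ▸ htB')
      · exact Or.inr ⟨B', ⟨hB', h⟩, htB'⟩
  obtain ⟨η', -, hη'⟩ := hC.horoball B hB
  obtain ⟨h, D, k⟩ := hη'.exists_with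
  by_cases he : c.endpoint = η'
  · exact hno B hB h D (he ▸ k)
  · obtain ⟨K, hK⟩ := k.horofunction.le_sub_along_ray hX he
    have h1 := k.mem_iff.1 (hsub ⟨max T K.toNNReal, Set.mem_Ici.2 (le_max_left _ _), rfl⟩)
    have h2 := hK (max T K.toNNReal)
    have h3 : K ≤ (max T K.toNNReal : ℝ≥0) :=
      (Real.le_coe_toNNReal K).trans (by exact_mod_cast le_max_right _ _)
    linarith

theorem exists_large_displacement (hC : IsCuspUniform ℙ δ ℬ) {η : GromovBoundary X}
    (hη : IsParabolicPoint G η) (o : X) (R : ℝ) :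
    ∃ p : G, p • η = η ∧ R < dist o (p • o) := by
  obtain ⟨H, hinf, hH⟩ := hη
  by_contra! hno
  have : (H : Set G).Finite := (hC.finite_dist_le o R).subset fun p hp =>
    hno p ((hH η).2 rfl p hp)
  exact (Set.infinite_coe_iff.1 hinf) this

/-- No horoball about a parabolic point is the whole space. -/
theorem exists_notMem (hC : IsCuspUniform ℙ δ ℬ) {η : GromovBoundary X}
    (hη : IsParabolicPoint G η) {B : Set X} {h : X → ℝ} {D : ℝ}
    (k : IsHoroballWith δ η B h D) : ∃ z, z ∉ B := by
  by_contra! hall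
  have hX := hC.hyperbolic
  have hh := k.horofunction
  obtain ⟨w, C, hC'⟩ := hC.visual
  have hδ := hX.nonneg w
  obtain ⟨c₀, hc₀, hc₀η⟩ := hX.exists_ray w η
  -- If h were positive everywhere, no ray could end away from η, so by visuality X would be a
  -- neighborhood of one ray.
  have near : ∀ x, ∃ t, dist x (c₀.toFun t) ≤ C + 4 * δ := fun x => by
    obtain ⟨c, hc, t, ht⟩ := hC' x
    have he : c.endpoint = η := by
      by_contra hne
      obtain ⟨K, hK⟩ := hh.le_sub_along_ray hX hne
      have h1 := k.mem_iff.1 (hall (c.toFun K.toNNReal))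
      linarith [hK K.toNNReal, Real.le_coe_toNNReal K]
    have h2 := hX.dist_ray_le_of_endpoint_eq (he.trans hc₀η.symm) t
    rw [hc, hc₀, dist_self] at h2
    exact ⟨t, (dist_triangle _ _ _).trans (by linarith)⟩
  -- Then h grows with the distance from w in every direction. An element p fixing η and moving w
  -- far would raise h at both p w and p⁻¹ w, although the drifts of p and p⁻¹ are nearly opposite.
  have low : ∀ x, h w + dist w x - (2 * (C + 4 * δ) + 3 * D) ≤ h x := fun x => by
    obtain ⟨t, ht⟩ := near x
    have h1 := hh.along_ray hX hc₀η t
    have h2 := hh.abs_sub_le hX x (c₀.toFun t)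
    have h3 := dist_triangle w (c₀.toFun t) x
    have h4 := c₀.dist_zero t
    rw [dist_comm (c₀.toFun t) x] at h3
    rw [hc₀] at h1 h4
    rw [abs_le] at h1 h2
    linarith [h1.1, h2.1]
  obtain ⟨p, hp, hpR⟩ := hC.exists_large_displacement hη w (2 * (C + 4 * δ) + 5 * D)
  have h1 := low (p • w)
  have h2 := low (p⁻¹ • w)
  have h3 := hh.displacement hX hp w (p⁻¹ • w)
  rw [smul_inv_smul] at h3
  have h4 : dist w (p⁻¹ • w) = dist w (p • w) := by
    rw [← dist_smul p, smul_inv_smul, dist_comm]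
  rw [abs_le] at h3
  linarith [h3.2]

theorem frontier_nonempty (hC : IsCuspUniform ℙ δ ℬ) {η : GromovBoundary X}
    (hη : IsParabolicPoint G η) {B : Set X} {h : X → ℝ} {D : ℝ}
    (k : IsHoroballWith δ η B h D) : (frontier B).Nonempty := by
  obtain ⟨z, hz⟩ := hC.exists_notMem hη k
  obtain ⟨c, rfl⟩ := exists_endpoint η
  obtain ⟨t, ht⟩ := (k.eventually_mem hC.hyperbolic rfl).exists
  obtain ⟨y, hy, -⟩ := hC.hyperbolic.1.inter_frontier_nonempty ht hz
  exact ⟨y, hy⟩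

/-- The stabilizer of a horoball acts cocompactly on its frontier. -/
theorem exists_dist_smul_le_of_frontier (hC : IsCuspUniform ℙ δ ℬ) {B : Set X} (hB : B ∈ ℬ)
    {η : GromovBoundary X} {h : X → ℝ} {D : ℝ} (k : IsHoroballWith δ η B h D) (o : X) :
    ∃ ρ : ℝ, 0 ≤ ρ ∧ ∀ z ∈ frontier B, ∃ p : G, p • η = η ∧ dist z (p • o) ≤ ρ := by
  have hX := hC.hyperbolic
  have hh := k.horofunction
  have hD := hh.nonneg
  obtain ⟨r, hr0, hr⟩ := hC.exists_dist_smul_le o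
  -- The translates of B that have a frontier point near o. They are disjoint and each contains a
  -- unit ball near o, found a distance 3D + 2 along a ray to its center, so there are finitely
  -- many.
  set 𝒜 : Set (Set X) := {A | ∃ γ : G, A = γ⁻¹ • B ∧ ∃ z ∈ frontier B, dist z (γ • o) ≤ r}
  have hsub : 𝒜 ⊆ ℬ := by
    rintro _ ⟨γ, rfl, -⟩
    exact hC.smul_mem _ B hB
  have hfin : 𝒜.Finite := by
    refine finite_of_disjoint_balls (hC.disjoint.subset hsub) o (r + 1 + (3 * D + 2)) ?_
    rintro _ ⟨γ, rfl, z, hz, hzr⟩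
    obtain ⟨y, hyB, hyz⟩ := Metric.mem_closure_iff.1 hz.1 1 one_pos
    obtain ⟨c, hc0, hc⟩ := hX.exists_ray y η
    obtain ⟨t, ht⟩ : ∃ t : ℝ≥0, (t : ℝ) = 3 * D + 2 := ⟨⟨3 * D + 2, by positivity⟩, rfl⟩
    refine ⟨γ⁻¹ • c.toFun t, ?_, fun x hx => ?_⟩
    · rw [← dist_smul γ, smul_inv_smul]
      have h1 := c.dist_zero t
      have h2 := dist_triangle4 (c.toFun t) y z (γ • o)
      rw [hc0, dist_comm] at h1
      rw [dist_comm y z] at h2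
      linarith
    · rw [Set.mem_smul_set_iff_inv_smul_mem, inv_inv, k.mem_iff]
      have h1 := k.mem_iff.1 hyB
      rw [Metric.mem_ball, ← dist_smul γ, smul_inv_smul] at hx
      refine hh.mem_of_dist_ray hX hc (t := t) (R := 1) (by rw [dist_comm]; exact hx.le) ?_
      rw [hc0]
      linarith
  have hch : ∀ A ∈ 𝒜, ∃ γ : G, A = γ⁻¹ • B := fun A ⟨γ, hγ, _⟩ => ⟨γ, hγ⟩
  choose! γ hγ using hch
  obtain ⟨ρ, hρ⟩ := (hfin.image fun A => dist o ((γ A)⁻¹ • o)).bddAbove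
  refine ⟨r + |ρ|, by positivity, fun z hz => ?_⟩
  obtain ⟨g, hg⟩ := hr z (hC.notMem_sUnion_of_mem_frontier hB hz)
  have hA : g⁻¹ • B ∈ 𝒜 := ⟨g, rfl, z, hz, hg⟩
  -- Correcting g by the chosen representative of the translate g⁻¹ B gives an element that
  -- stabilizes B, at a cost bounded over the finitely many translates.
  refine ⟨g * (γ (g⁻¹ • B))⁻¹, ?_, ?_⟩
  · rw [← MulAction.mem_stabilizer_iff, ← hC.stabilizer_eq hB k, MulAction.mem_stabilizer_iff,
      mul_smul, ← hγ _ hA, smul_inv_smul]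
  · have h1 := dist_triangle z (g • o) ((g * (γ (g⁻¹ • B))⁻¹) • o)
    rw [mul_smul, dist_smul] at h1
    rw [mul_smul]
    have h2 := hρ (Set.mem_image_of_mem _ hA)
    have := le_abs_self ρ
    linarith

theorem abs_horofunction_le_of_frontier (hC : IsCuspUniform ℙ δ ℬ) {B : Set X}
    {η : GromovBoundary X} {h : X → ℝ} {D : ℝ} (k : IsHoroballWith δ η B h D) {z : X}
    (hz : z ∈ frontier B) : |h z| ≤ 1 + 2 * D := by
  have hD := k.horofunction.nonneg
  obtain ⟨y, hyB, hyz⟩ := Metric.mem_closure_iff.1 hz.1 1 one_pos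
  have h1 := k.mem_iff.1 hyB
  have h2 : h z ≤ 0 := not_lt.1 fun hpos =>
    k.isOpen.inter_frontier_eq.subset ⟨k.mem_iff.2 hpos, hz⟩
  have h3 := k.horofunction.sub_le hC.hyperbolic y z
  rw [dist_comm] at h3
  rw [abs_le]
  constructor <;> linarith

/-- The stabilizer of a horoball coarsely preserves its horofunction. -/
theorem exists_abs_horofunction_smul_le (hC : IsCuspUniform ℙ δ ℬ) {B : Set X} (hB : B ∈ ℬ)
    {η : GromovBoundary X} (hη : IsParabolicPoint G η) {h : X → ℝ} {D : ℝ}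
    (k : IsHoroballWith δ η B h D) (o : X) :
    ∃ E : ℝ, ∀ p : G, p • η = η → |h (p • o) - h o| ≤ E := by
  obtain ⟨z, hz⟩ := hC.frontier_nonempty hη k
  refine ⟨2 * (1 + 2 * D) + 4 * D, fun p hp => ?_⟩
  have hpB : p • B = B := by
    rwa [← MulAction.mem_stabilizer_iff, hC.stabilizer_eq hB k, MulAction.mem_stabilizer_iff]
  have hpz : p • z ∈ frontier B := by
    have := Set.mem_image_of_mem (Homeomorph.smul p) hz
    rw [(Homeomorph.smul p).image_frontier] at this
    change p • z ∈ frontier (p • B) at this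
    rwa [hpB] at this
  have h1 := hC.abs_horofunction_le_of_frontier k hz
  have h2 := hC.abs_horofunction_le_of_frontier k hpz
  have h3 := k.horofunction.displacement hC.hyperbolic hp o z
  rw [abs_le] at *
  constructor <;> linarith [h1.1, h1.2, h2.1, h2.2, h3.1, h3.2]

/-- Every point of a horoball about `η` is close to a translate, by the stabilizer of `η`, of a
given ray that ends at `η`. -/
theorem exists_dist_ray_le (hC : IsCuspUniform ℙ δ ℬ) {B : Set X} (hB : B ∈ ℬ)
    {η : GromovBoundary X} (hη : IsParabolicPoint G η) {h : X → ℝ} {D : ℝ}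
    (k : IsHoroballWith δ η B h D) {c : GeodesicRay X} (hc : c.endpoint = η) :
    ∃ C : ℝ, ∀ x ∈ B, ∃ p : G, ∃ t, dist x (p • c.toFun t) ≤ C := by
  have hX := hC.hyperbolic
  have hδ := hX.nonneg (c.toFun 0)
  obtain ⟨ρ, hρ0, hρ⟩ := hC.exists_dist_smul_le_of_frontier hB k (c.toFun 0)
  obtain ⟨z, hz⟩ := hC.exists_notMem hη k
  obtain ⟨C, hC'⟩ := k.horofunction.exists_ray_near hX hC.visual
    (not_lt.1 fun hpos => hz (k.mem_iff.2 hpos))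
  refine ⟨C + 3 * ρ + 4 * δ, fun x hx => ?_⟩
  obtain ⟨c', hc', h0, t, ht⟩ := hC' x
  by_cases htB : c'.toFun t ∈ B
  -- The ray c' starts outside B and enters it through the frontier, near some p c(0) with p fixing
  -- η; from there it is asymptotic to p c.
  · obtain ⟨s, hst, hs⟩ := c'.inter_frontier_nonempty (B := B)
      (fun hmem => absurd (k.mem_iff.1 hmem) (not_lt.2 h0)) htB
    obtain ⟨p, hp, hpz⟩ := hρ _ hs
    refine ⟨p, t - s, ?_⟩
    have e : (c'.shift s).endpoint = (p • c).endpoint := by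
      change _ = p • c.endpoint
      rw [c'.endpoint_shift, hc', hc, hp]
    have h1 := hX.dist_ray_le_of_endpoint_eq e (t - s)
    change dist (c'.toFun (t - s + s)) (p • c.toFun (t - s)) ≤
      3 * dist (c'.toFun (0 + s)) (p • c.toFun 0) + 4 * δ at h1
    rw [tsub_add_cancel_of_le hst, zero_add] at h1
    have := dist_triangle x (c'.toFun t) (p • c.toFun (t - s))
    linarith
  · obtain ⟨y, hy, hxy⟩ := hX.1.inter_frontier_nonempty hx htB
    obtain ⟨p, -, hpz⟩ := hρ _ hy
    refine ⟨p, 0, ?_⟩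
    have := dist_triangle x y (p • c.toFun 0)
    linarith

end IsCuspUniform

end Horoballs

/-! ### Word metrics -/

section WordMetric

variable {G : Type*} [Group G] {S : Set G}

theorem exists_list_prod_eq (hS : Subgroup.closure S = ⊤) (g : G) :
    ∃ l : List G, l.length = wordLength S g ∧ (∀ s ∈ l, s ∈ S ∨ s⁻¹ ∈ S) ∧ l.prod = g := by
  have hg : g ∈ Submonoid.closure (S ∪ S⁻¹) := by
    rw [← Subgroup.closure_toSubmonoid, hS]
    exact Subgroup.mem_top g
  obtain ⟨l, hl, hp⟩ := Submonoid.exists_list_of_mem_closure hg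
  exact Nat.sInf_mem (s := {n : ℕ | ∃ l : List G, l.length = n ∧ (∀ s ∈ l, s ∈ S ∨ s⁻¹ ∈ S) ∧
    l.prod = g}) ⟨l.length, l, rfl, hl, hp⟩

theorem wordLength_one : wordLength S (1 : G) = 0 :=
  Nat.sInf_eq_zero.2 (Or.inl ⟨[], rfl, by simp, rfl⟩)

theorem wordDist_self (g : G) : wordDist S g g = 0 := by
  simp [wordDist, wordLength_one]

theorem wordDist_nonneg (g h : G) : 0 ≤ wordDist S g h := Nat.cast_nonneg _

theorem wordDist_eq_one_inv_mul (g h : G) : wordDist S g h = wordDist S 1 (g⁻¹ * h) := by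
  simp [wordDist]

theorem wordLength_mul_le (hS : Subgroup.closure S = ⊤) (g h : G) :
    wordLength S (g * h) ≤ wordLength S g + wordLength S h := by
  obtain ⟨l, hl, hlS, hlg⟩ := exists_list_prod_eq hS g
  obtain ⟨l', hl', hlS', hlg'⟩ := exists_list_prod_eq hS h
  refine Nat.sInf_le ⟨l ++ l', by simp [hl, hl'], fun s hs => ?_, by simp [hlg, hlg']⟩
  rcases List.mem_append.1 hs with hs | hs
  · exact hlS s hs
  · exact hlS' s hs

theorem wordDist_triangle (hS : Subgroup.closure S = ⊤) (g h k : G) :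
    wordDist S g k ≤ wordDist S g h + wordDist S h k := by
  have := wordLength_mul_le hS (g⁻¹ * h) (h⁻¹ * k)
  rw [mul_assoc, mul_inv_cancel_left] at this
  simp only [wordDist]
  exact_mod_cast this

/-- A function that grows by at most `A` along each edge of the Cayley graph grows at most
linearly. -/
theorem le_add_mul_wordDist (hS : Subgroup.closure S = ⊤) {f : G → ℝ} {A : ℝ}
    (h : ∀ g s : G, s ∈ S ∨ s⁻¹ ∈ S → f (g * s) ≤ f g + A) (g : G) :
    f g ≤ f 1 + A * wordDist S 1 g := by
  have key : ∀ l : List G, (∀ s ∈ l, s ∈ S ∨ s⁻¹ ∈ S) → f l.prod ≤ f 1 + A * l.length := by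
    intro l
    induction l using List.reverseRecOn with
    | nil => simp
    | append_singleton l s ih =>
      intro hl
      have h1 := ih fun t ht => hl t (List.mem_append_left _ ht)
      have h2 := h l.prod s (hl s (by simp))
      simp only [List.prod_append, List.prod_singleton, List.length_append, List.length_singleton]
      push_cast
      linarith
  obtain ⟨l, hl, hlS, rfl⟩ := exists_list_prod_eq hS g
  have := key l hlS
  rw [hl] at this
  simpa [wordDist] using this

theorem exists_dist_smul_le_wordDist (hS : IsFiniteGeneratingSet S) {X : Type*} [MetricSpace X]
    [MulAction G X] [IsIsometricSMul G X] (o : X) :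
    ∃ A : ℝ, 0 ≤ A ∧ ∀ g h : G, dist (g • o) (h • o) ≤ A * wordDist S g h := by
  obtain ⟨A, hA⟩ := (hS.finite.image fun s => dist o (s • o)).bddAbove
  have hA' : ∀ s : G, s ∈ S ∨ s⁻¹ ∈ S → dist o (s • o) ≤ |A| := by
    rintro s (hs | hs)
    · exact (hA (Set.mem_image_of_mem _ hs)).trans (le_abs_self A)
    · have := hA (Set.mem_image_of_mem _ hs)
      rw [← dist_smul s, smul_inv_smul, dist_comm] at this
      exact this.trans (le_abs_self A)
  refine ⟨|A|, abs_nonneg A, fun g h => ?_⟩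
  have := le_add_mul_wordDist hS.closure_eq (f := fun g => dist o (g • o)) (A := |A|)
    (fun g s hs => by
      have h1 := dist_triangle o (g • o) ((g * s) • o)
      rw [mul_smul, dist_smul] at h1
      simp only [mul_smul]
      linarith [hA' s hs]) (g⁻¹ * h)
  rw [one_smul, dist_self, zero_add, ← wordDist_eq_one_inv_mul] at this
  rwa [← dist_smul g⁻¹, inv_smul_smul, ← mul_smul]

theorem exists_wordDist_le {X : Type*} [MetricSpace X] [MulAction G X] [IsIsometricSMul G X]
    {o : X} (hfin : ∀ R, {g : G | dist o (g • o) ≤ R}.Finite) (R : ℝ) :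
    ∃ N : ℝ, ∀ g h : G, dist (g • o) (h • o) ≤ R → wordDist S g h ≤ N := by
  obtain ⟨N, hN⟩ := ((hfin R).image fun g => wordDist S 1 g).bddAbove
  refine ⟨N, fun g h hgh => ?_⟩
  rw [wordDist_eq_one_inv_mul]
  refine hN (Set.mem_image_of_mem _ ?_)
  rw [Set.mem_ofPred_eq, ← dist_smul g, ← mul_smul, mul_inv_cancel_left]
  exact hgh

end WordMetric

/-! ### A coarse model of a cusped space -/

section Model

theorem exists_uniform_bound {ι : Type*} {s : Set ι} (hs : s.Finite) {Q : ι → ℝ → Prop}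
    (hmono : ∀ i a b, a ≤ b → Q i a → Q i b) (h : ∀ i ∈ s, ∃ a, Q i a) : ∃ a, ∀ i ∈ s, Q i a := by
  choose! f hf using h
  obtain ⟨a, ha⟩ := (hs.image f).bddAbove
  exact ⟨a, fun i hi => hmono i _ _ (ha (Set.mem_image_of_mem f hi)) (hf i hi)⟩

/-- The coarse geometry of a cusped space `X` for `(G, ℙ)`: the space is the coarse union of an
orbit `G o` and of translates of the rays `c P` from `o`, for `P ∈ ℙ`. The rays `γ c P` and
`γ' c P` with `γ⁻¹ γ' = p ∈ P` merge at the depth `t` for which `exp (g P t)` is the word length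
of `p` in `P`, and there are no other coarse coincidences far from the orbit. -/
structure CuspModel (G X : Type*) [Group G] [MetricSpace X] [MulAction G X]
    (ℙ : Set (Subgroup G)) where
  o : X
  c : Subgroup G → ℝ≥0 → X
  T : ∀ P : Subgroup G, Set P
  g : Subgroup G → ℝ≥0 ≃ₜ ℝ≥0
  finite_dist_le : ∀ R, {γ : G | dist o (γ • o) ≤ R}.Finite
  c_zero : ∀ P ∈ ℙ, c P 0 = o
  dist_c : ∀ P ∈ ℙ, ∀ s t, dist (c P s) (c P t) = |(s : ℝ) - t|
  infinite : ∀ P ∈ ℙ, Infinite P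
  generates : ∀ P ∈ ℙ, IsFiniteGeneratingSet (T P)
  mono : ∀ P ∈ ℙ, StrictMono (g P)
  bilipschitz : ∃ K : ℝ, 0 ≤ K ∧ ∀ P ∈ ℙ, ∀ s t,
    |(g P s : ℝ) - g P t| ≤ K * |(s : ℝ) - t| ∧ |(s : ℝ) - t| ≤ K * |(g P s : ℝ) - g P t|
  cover : ∃ C : ℝ, ∀ x : X, (∃ γ : G, dist x (γ • o) ≤ C) ∨
    ∃ P ∈ ℙ, ∃ (γ : G) (t : ℝ≥0), dist x (γ • c P t) ≤ C
  separation : ∀ R : ℝ, ∃ T : ℝ, ∀ P ∈ ℙ, ∀ Q ∈ ℙ, ∀ (γ γ' : G) (t s : ℝ≥0),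
    dist (γ • c P t) (γ' • c Q s) ≤ R →
      ((t : ℝ) ≤ T ∧ (s : ℝ) ≤ T) ∨ (P = Q ∧ γ⁻¹ * γ' ∈ P ∧ |(t : ℝ) - s| ≤ T)
  merge : ∃ C : ℝ, ∀ P ∈ ℙ, ∀ p ∈ P, ∀ t : ℝ≥0, dist o (p • o) / 2 ≤ t →
    dist (c P t) (p • c P t) ≤ C
  -- This and the next field exchange additive errors in distance with multiplicative errors in word
  -- length.
  wordDist_le : ∀ C : ℝ, ∃ A : ℝ, ∀ P ∈ ℙ, ∀ (p : P) (t : ℝ≥0),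
    dist o ((p : G) • o) ≤ 2 * t + C → wordDist (T P) 1 p ≤ A * Real.exp (g P t)
  dist_le : ∀ A : ℝ, ∃ C : ℝ, ∀ P ∈ ℙ, ∀ (p : P) (t : ℝ≥0),
    wordDist (T P) 1 p ≤ A * Real.exp (g P t) → dist o ((p : G) • o) ≤ 2 * t + C

variable {G X : Type*} [Group G] [MetricSpace X] [MulAction G X] [IsIsometricSMul G X]
  {ℙ : Set (Subgroup G)} {δ : ℝ} {ℬ : Set (Set X)}

theorem AreConjugate.refl (P : Subgroup G) : AreConjugate P P := by
  refine ⟨1, ?_⟩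
  ext x
  simp

theorem stabilizer_smul_eq_map (k : G) {A : Type*} [MulAction G A] (a : A) :
    MulAction.stabilizer G (k • a) =
      (MulAction.stabilizer G a).map (MulAut.conj k).toMonoidHom :=
  MulAction.stabilizer_smul_eq_stabilizer_map_conj k a

theorem IsParabolicPoint.eq_of_stabilizer_le {η ζ : GromovBoundary X} (hη : IsParabolicPoint G η)
    (h : MulAction.stabilizer G η ≤ MulAction.stabilizer G ζ) : η = ζ := by
  obtain ⟨H, -, hH⟩ := hη
  exact ((hH ζ).1 fun k hk => h ((hH η).2 rfl k hk)).symm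

theorem IsParabolicPoint.infinite_stabilizer {η : GromovBoundary X} (hη : IsParabolicPoint G η) :
    Infinite (MulAction.stabilizer G η) := by
  obtain ⟨H, hinf, hH⟩ := hη
  have hle : H ≤ MulAction.stabilizer G η := fun k hk => (hH η).2 rfl k hk
  exact Infinite.of_injective _ (Subgroup.inclusion_injective hle)

theorem strictMono_of_homeomorph_nnreal (e : ℝ≥0 ≃ₜ ℝ≥0) : StrictMono e := by
  rcases e.continuous.strictMono_of_inj e.injective with h | h
  · exact h
  · obtain ⟨x, hx⟩ := e.surjective (e 0 + 1)
    have h1 := h.antitone (zero_le (a := x))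
    rw [hx] at h1
    exact absurd h1 (not_le.2 (lt_add_of_pos_right _ one_pos))

/-- Constant horospherical distortion, for a base point that need not lie in the horoball, in terms
of the depth at which rays merge. -/
theorem HasConstantHorosphericalDistortion.exists_distortion {P : Subgroup G} {B : Set X}
    (h : HasConstantHorosphericalDistortion P B) (o : X) :
    ∃ (T : Set P) (g : ℝ≥0 ≃ₜ ℝ≥0), IsFiniteGeneratingSet T ∧
      (∃ K : ℝ, 0 ≤ K ∧ ∀ s t, |(g s : ℝ) - g t| ≤ K * |(s : ℝ) - t| ∧
        |(s : ℝ) - t| ≤ K * |(g s : ℝ) - g t|) ∧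
      (∀ C : ℝ, ∃ A : ℝ, ∀ (p : P) (t : ℝ≥0), dist o ((p : G) • o) ≤ 2 * t + C →
        wordDist T 1 p ≤ A * Real.exp (g t)) ∧
      ∀ A : ℝ, ∃ C : ℝ, ∀ (p : P) (t : ℝ≥0), wordDist T 1 p ≤ A * Real.exp (g t) →
        dist o ((p : G) • o) ≤ 2 * t + C := by
  obtain ⟨y, -, T, hT, g₀, K, b, hK, hK', hb, hd⟩ := h
  have hmono := strictMono_of_homeomorph_nnreal g₀
  have lip : ∀ s t, |(g₀ s : ℝ) - g₀ t| ≤ K * |(s : ℝ) - t| := fun s t => by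
    have := hK.dist_le_mul s t
    rwa [NNReal.dist_eq, NNReal.dist_eq] at this
  have lip' : ∀ s t : ℝ≥0, |(s : ℝ) - t| ≤ K * |(g₀ s : ℝ) - g₀ t| := fun s t => by
    have := hK'.le_mul_dist s t
    rwa [NNReal.dist_eq, NNReal.dist_eq] at this
  have hK0 : (0 : ℝ) ≤ K := K.coe_nonneg
  have hy : ∀ p : P, dist y ((p : G) • y) ≤ dist o ((p : G) • o) + 2 * dist o y ∧
      dist o ((p : G) • o) ≤ dist y ((p : G) • y) + 2 * dist o y := fun p => by
    have h1 := dist_triangle4 y o ((p : G) • o) ((p : G) • y)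
    have h2 := dist_triangle4 o y ((p : G) • y) ((p : G) • o)
    rw [dist_smul] at h1 h2
    rw [dist_comm y o] at h1 h2
    constructor <;> linarith
  have hd1 : ∀ p : P, 1 ≠ p → b⁻¹ * Real.exp (g₀ (nndist y ((p : G) • y))) ≤ wordDist T 1 p ∧
      wordDist T 1 p ≤ b * Real.exp (g₀ (nndist y ((p : G) • y))) := fun p hp => by
    have := hd 1 p hp
    rwa [one_smul] at this
  -- The new function is t ↦ g₀ (2t): merging at depth t means displacement about 2t.
  refine ⟨T, (Homeomorph.mulLeft₀ (2 : ℝ≥0) two_ne_zero).trans g₀, hT, ⟨2 * K, by positivity,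
    fun s t => ?_⟩, fun C => ?_, fun A => ?_⟩
  · have e1 := lip (2 * s) (2 * t)
    have e2 := lip' (2 * s) (2 * t)
    have e3 : |((2 * s : ℝ≥0) : ℝ) - (2 * t : ℝ≥0)| = 2 * |(s : ℝ) - t| := by
      push_cast
      rw [← mul_sub, abs_mul, abs_two]
    rw [e3] at e1 e2
    change |(g₀ (2 * s) : ℝ) - g₀ (2 * t)| ≤ _ ∧ _ ≤ 2 * K * |(g₀ (2 * s) : ℝ) - g₀ (2 * t)|
    have e4 : 0 ≤ K * |(g₀ (2 * s) : ℝ) - g₀ (2 * t)| := by positivity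
    have e5 : 0 ≤ |(s : ℝ) - t| := abs_nonneg _
    constructor <;> linarith
  · obtain ⟨M, hM⟩ : ∃ M : ℝ≥0, (M : ℝ) = |C| + 2 * dist o y := ⟨⟨_, by positivity⟩, rfl⟩
    refine ⟨b * Real.exp (K * M), fun p t hpt => ?_⟩
    change _ ≤ _ * Real.exp (g₀ (2 * t))
    by_cases hp : 1 = p
    · rw [← hp, wordDist_self]; positivity
    refine (hd1 p hp).2.trans ?_
    rw [mul_assoc, ← Real.exp_add]
    gcongr
    have e1 : nndist y ((p : G) • y) ≤ 2 * t + M := by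
      rw [← NNReal.coe_le_coe]
      push_cast
      linarith [(hy p).1, le_abs_self C]
    have e2 : (g₀ (nndist y ((p : G) • y)) : ℝ) ≤ g₀ (2 * t + M) := hmono.monotone e1
    have e3 := (le_abs_self _).trans (lip (2 * t + M) (2 * t))
    push_cast at e3
    rw [add_sub_cancel_left, abs_of_nonneg M.coe_nonneg] at e3
    linarith
  · refine ⟨K * |Real.log (b * A)| + 2 * dist o y, fun p t hpt => ?_⟩
    change _ ≤ _ * Real.exp (g₀ (2 * t)) at hpt
    have n0 : 0 ≤ K * |Real.log (b * A)| := by positivity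
    have n1 : 0 ≤ dist o y := dist_nonneg
    have n2 : (0 : ℝ) ≤ t := t.coe_nonneg
    by_cases hp : 1 = p
    · rw [← hp, OneMemClass.coe_one, one_smul, dist_self]; positivity
    have e1 := (hd1 p hp).1.trans hpt
    have hA : 0 < A := by
      have : 0 < A * Real.exp (g₀ (2 * t)) := lt_of_lt_of_le (by positivity) e1
      exact pos_of_mul_pos_left this (Real.exp_pos _).le
    have e2 : Real.exp (g₀ (nndist y ((p : G) • y))) ≤
        Real.exp (Real.log (b * A) + g₀ (2 * t)) := by
      rw [Real.exp_add, Real.exp_log (by positivity)]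
      rw [inv_mul_le_iff₀ hb] at e1
      linarith
    rw [Real.exp_le_exp] at e2
    have e3 : dist y ((p : G) • y) ≤ 2 * t + K * |Real.log (b * A)| := by
      rcases le_total (nndist y ((p : G) • y)) (2 * t) with hle | hle
      · have : dist y ((p : G) • y) ≤ 2 * t := by exact_mod_cast hle
        linarith
      · have e4 := (le_abs_self _).trans (lip' (nndist y ((p : G) • y)) (2 * t))
        have e5 : (g₀ (2 * t) : ℝ) ≤ g₀ (nndist y ((p : G) • y)) := hmono.monotone hle
        rw [abs_of_nonneg (sub_nonneg.2 e5)] at e4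
        push_cast at e4
        have e6 : (K : ℝ) * (g₀ (nndist y ((p : G) • y)) - g₀ (2 * t)) ≤
            K * |Real.log (b * A)| := by
          gcongr
          linarith [le_abs_self (Real.log (b * A))]
        linarith
    linarith [(hy p).2]

/-- Each P ∈ ℙ gets a horoball of the family about its parabolic point and a ray from o. Finiteness
of ℙ makes all constants uniform. -/
theorem exists_cuspModel (hX : IsCuspedSpace X ℙ) : Nonempty (CuspModel G X ℙ) := by
  obtain ⟨δ, ℬ, hC, hdist⟩ := hX
  have := hC.proper
  have hX := hC.hyperbolic
  obtain ⟨o, _, hvis⟩ := hC.visual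
  obtain ⟨c₀, -, -⟩ := hvis o
  have : Nonempty (GeodesicRay X) := ⟨c₀⟩
  have : Nonempty (GromovBoundary X) := ⟨c₀.endpoint⟩
  have hδ := hX.nonneg o
  have hfinP := hC.finite_peripheral
  have data : ∀ P ∈ ℙ, ∃ (η : GromovBoundary X) (B : Set X) (h : X → ℝ) (D : ℝ)
      (c : GeodesicRay X), IsParabolicPoint G η ∧ P = MulAction.stabilizer G η ∧ B ∈ ℬ ∧
        IsHoroballWith δ η B h D ∧ c.toFun 0 = o ∧ c.endpoint = η := by
    intro P hP
    obtain ⟨η, hη, hPη⟩ := hC.peripheral_parabolic P hP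
    obtain ⟨B, hB, h, D, k⟩ := hC.exists_horoball hη
    obtain ⟨c, hc0, hc⟩ := hX.exists_ray o η
    exact ⟨η, B, h, D, c, hη, hPη, hB, k, hc0, hc⟩
  choose! η B h D c hη hPη hB k hc0 hc using data
  have hfix : ∀ P ∈ ℙ, ∀ p : G, p ∈ P ↔ p • η P = η P := fun P hP p => by
    conv_lhs => rw [hPη P hP]
    exact MulAction.mem_stabilizer_iff
  have hstab : ∀ P ∈ ℙ, MulAction.stabilizer G (B P) = P := fun P hP => by
    rw [hC.stabilizer_eq (hB P hP) (k P hP), ← hPη P hP]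
  have dd : ∀ P ∈ ℙ, ∃ (T : Set P) (g : ℝ≥0 ≃ₜ ℝ≥0), IsFiniteGeneratingSet T ∧
      (∃ K : ℝ, 0 ≤ K ∧ ∀ s t, |(g s : ℝ) - g t| ≤ K * |(s : ℝ) - t| ∧
        |(s : ℝ) - t| ≤ K * |(g s : ℝ) - g t|) ∧
      (∀ C : ℝ, ∃ A : ℝ, ∀ (p : P) (t : ℝ≥0), dist o ((p : G) • o) ≤ 2 * t + C →
        wordDist T 1 p ≤ A * Real.exp (g t)) ∧
      ∀ A : ℝ, ∃ C : ℝ, ∀ (p : P) (t : ℝ≥0), wordDist T 1 p ≤ A * Real.exp (g t) →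
        dist o ((p : G) • o) ≤ 2 * t + C := fun P hP => by
    have := hdist (B P) (hB P hP)
    rw [hstab P hP] at this
    exact this.exists_distortion o
  have : Nonempty (ℝ≥0 ≃ₜ ℝ≥0) := ⟨Homeomorph.refl _⟩
  choose! T g hT hbil hwd hdl using dd
  -- uniform constants
  obtain ⟨D₀, hD₀⟩ := exists_uniform_bound hfinP (Q := fun P a => D P ≤ a)
    (fun _ _ _ hab h => h.trans hab) fun P _ => ⟨D P, le_rfl⟩
  obtain ⟨H₀, hH₀⟩ := exists_uniform_bound hfinP (Q := fun P a => -h P o ≤ a)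
    (fun _ _ _ hab h => h.trans hab) fun P _ => ⟨_, le_rfl⟩
  obtain ⟨E₀, hE₀⟩ := exists_uniform_bound hfinP
    (Q := fun P a => ∀ p : G, p • η P = η P → |h P (p • o) - h P o| ≤ a)
    (fun _ _ _ hab h p hp => (h p hp).trans hab)
    fun P hP => hC.exists_abs_horofunction_smul_le (hB P hP) (hη P hP) (k P hP) o
  -- A point outside all horoballs at bounded distance from o, which prevents deep points of rays
  -- from being near the orbit.
  obtain ⟨r₀, hr₀⟩ := exists_uniform_bound hfinP
    (Q := fun _ a => ∃ z ∉ ⋃₀ ℬ, dist o z ≤ a)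
    (fun _ _ _ hab ⟨z, hz, h⟩ => ⟨z, hz, h.trans hab⟩) fun P hP => by
      obtain ⟨z, hz⟩ := hC.frontier_nonempty (hη P hP) (k P hP)
      exact ⟨_, z, hC.notMem_sUnion_of_mem_frontier (hB P hP) hz, le_rfl⟩
  obtain ⟨K₀, hK₀⟩ := exists_uniform_bound hfinP
    (Q := fun P K => ∀ s t, |(g P s : ℝ) - g P t| ≤ K * |(s : ℝ) - t| ∧
      |(s : ℝ) - t| ≤ K * |(g P s : ℝ) - g P t|)
    (fun _ _ _ hab h s t => ⟨(h s t).1.trans (by gcongr), (h s t).2.trans (by gcongr)⟩)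
    fun P hP => by
      obtain ⟨K, -, hK⟩ := hbil P hP
      exact ⟨K, hK⟩
  obtain ⟨C₁, hC₁⟩ := exists_uniform_bound hfinP
    (Q := fun P a => ∀ x ∈ B P, ∃ p : G, ∃ t, dist x (p • (c P).toFun t) ≤ a)
    (fun _ _ _ hab h x hx => by
      obtain ⟨p, t, h⟩ := h x hx
      exact ⟨p, t, h.trans hab⟩)
    fun P hP => hC.exists_dist_ray_le (hB P hP) (hη P hP) (k P hP) (hc P hP)
  obtain ⟨r, hr0, hr⟩ := hC.exists_dist_smul_le o
  have deep : ∀ P ∈ ℙ, ∀ (R : ℝ) (t : ℝ≥0) (y : X), dist ((c P).toFun t) y ≤ R →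
      R + 3 * D₀ + H₀ < t → y ∈ B P := by
    intro P hP R t y hy ht
    rw [(k P hP).mem_iff]
    refine (k P hP).horofunction.mem_of_dist_ray hX (hc P hP) hy ?_
    rw [hc0 P hP]
    linarith [hD₀ P hP, hH₀ P hP]
  have deep_smul : ∀ P ∈ ℙ, ∀ (γ : G) (R : ℝ) (t : ℝ≥0) (y : X),
      dist (γ • (c P).toFun t) y ≤ R → R + 3 * D₀ + H₀ < t → y ∈ γ • B P := by
    intro P hP γ R t y hy ht
    rw [Set.mem_smul_set_iff_inv_smul_mem]
    refine deep P hP R t _ ?_ ht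
    rwa [← dist_smul γ, smul_inv_smul]
  refine ⟨⟨o, fun P => (c P).toFun, T, g, hC.finite_dist_le o, hc0, fun P _ => (c P).dist_eq, ?_,
    hT, fun P _ => strictMono_of_homeomorph_nnreal _, ⟨|K₀|, abs_nonneg _, fun P hP s t => ?_⟩,
    ⟨max r C₁, fun x => ?_⟩, fun R => ?_, ?_, fun C => ?_, fun A => ?_⟩⟩
  · intro P hP
    rw [hPη P hP]
    exact (hη P hP).infinite_stabilizer
  · refine ⟨(hK₀ P hP s t).1.trans ?_, (hK₀ P hP s t).2.trans ?_⟩ <;>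
    · gcongr
      exact le_abs_self _
  · by_cases hx : x ∈ ⋃₀ ℬ
    · right
      obtain ⟨A, hA, hxA⟩ := hx
      obtain ⟨ζ, hζ, hAζ⟩ := hC.horoball A hA
      obtain ⟨h', D', k'⟩ := hAζ.exists_with
      obtain ⟨P, ⟨hP, γ, hγ⟩, -⟩ := hC.parabolic_conj _ ⟨ζ, hζ, rfl⟩
      -- Parabolic points are determined by their stabilizers, so every horoball of the family is a
      -- translate of some B P.
      have hζη : ζ = γ • η P := hζ.eq_of_stabilizer_le (by
        rw [stabilizer_smul_eq_map, ← hPη P hP, hγ])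
      subst hζη
      have hAB : A = γ • B P :=
        hC.eq_of_center_eq hA (hC.smul_mem γ _ (hB P hP)) k' ((k P hP).smul γ)
      subst hAB
      rw [Set.mem_smul_set_iff_inv_smul_mem] at hxA
      obtain ⟨p, t, ht⟩ := hC₁ P hP _ hxA
      refine ⟨P, hP, γ * p, t, ?_⟩
      rw [mul_smul, ← dist_smul γ⁻¹, inv_smul_smul]
      exact ht.trans (le_max_right _ _)
    · left
      obtain ⟨γ, hγ⟩ := hr x hx
      exact ⟨γ, hγ.trans (le_max_left _ _)⟩
  · set T₁ : ℝ := |R| + 3 * |D₀| + |H₀| with hT₁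
    set T₂ : ℝ := |R| + T₁ + |r₀| + 3 * |D₀| + |H₀| with hT₂
    set T₃ : ℝ := |R| + 8 * |D₀| + |E₀| with hT₃
    have aR := le_abs_self R
    have aD := le_abs_self D₀
    have aH := le_abs_self H₀
    have aE := le_abs_self E₀
    have ar := le_abs_self r₀
    have nR := abs_nonneg R
    have nD := abs_nonneg D₀
    have nH := abs_nonneg H₀
    have nE := abs_nonneg E₀
    have nr := abs_nonneg r₀
    -- If the second point is shallow, it is near a translate of the point outside all horoballs. A
    -- deep first point would put that translate inside γ B.
    have mixed : ∀ P ∈ ℙ, ∀ Q ∈ ℙ, ∀ (γ γ' : G) (t s : ℝ≥0),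
        dist (γ • (c P).toFun t) (γ' • (c Q).toFun s) ≤ R → (s : ℝ) ≤ T₁ → (t : ℝ) ≤ T₂ := by
      intro P hP Q hQ γ γ' t s hd hs
      by_contra! ht
      obtain ⟨z, hz, hzo⟩ := hr₀ P hP
      have h1 := (c Q).dist_zero s
      rw [hc0 Q hQ, dist_comm] at h1
      have h2 := dist_triangle4 (γ • (c P).toFun t) (γ' • (c Q).toFun s) (γ' • o) (γ' • z)
      rw [dist_smul, dist_smul] at h2
      have := deep_smul P hP γ (R + T₁ + r₀) t (γ' • z) (by linarith) (by linarith)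
      refine hz ⟨γ'⁻¹ • γ • B P, hC.smul_mem _ _ (hC.smul_mem _ _ (hB P hP)), ?_⟩
      rw [Set.mem_smul_set_iff_inv_smul_mem, inv_inv]
      exact this
    refine ⟨max T₂ T₃, fun P hP Q hQ γ γ' t s hd => ?_⟩
    have hT12 : T₁ ≤ T₂ := by linarith
    have hT2 := le_max_left T₂ T₃
    have hT3 := le_max_right T₂ T₃
    rcases le_or_gt (s : ℝ) T₁ with hs | hs
    · have := mixed P hP Q hQ γ γ' t s hd hs
      exact Or.inl ⟨by linarith, by linarith⟩
    rcases le_or_gt (t : ℝ) T₁ with ht | ht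
    · have := mixed Q hQ P hP γ' γ s t (by rwa [dist_comm]) ht
      exact Or.inl ⟨by linarith, by linarith⟩
    right
    have m1 := deep_smul P hP γ R t _ hd (by linarith)
    have m2 := deep_smul Q hQ γ' 0 s (γ' • (c Q).toFun s) (by simp) (by linarith)
    have hBB := hC.eq_of_mem (hC.smul_mem γ _ (hB P hP)) (hC.smul_mem γ' _ (hB Q hQ)) m1 m2
    have k1 := (k P hP).smul γ
    rw [hBB] at k1
    have hηη : γ • η P = γ' • η Q := k1.center_unique ((k Q hQ).smul γ') hX
    have hPQ : P = Q := by
      have hconj : AreConjugate P Q := by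
        refine ⟨γ'⁻¹ * γ, ?_⟩
        have : (γ'⁻¹ * γ) • η P = η Q := by rw [mul_smul, hηη, inv_smul_smul]
        conv_lhs => rw [hPη P hP]
        rw [← stabilizer_smul_eq_map, this, ← hPη Q hQ]
      obtain ⟨Q', -, hQ'⟩ := hC.parabolic_conj Q (hC.peripheral_parabolic Q hQ)
      exact (hQ' P ⟨hP, hconj⟩).trans (hQ' Q ⟨hQ, AreConjugate.refl Q⟩).symm
    subst hPQ
    have hp : (γ⁻¹ * γ') • η P = η P := by
      rw [mul_smul, ← hηη, inv_smul_smul]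
    refine ⟨rfl, (hfix P hP _).2 hp, ?_⟩
    -- The depths are compared through the horofunction. It grows like depth along the ray, and
    -- elements of P change it by a bounded amount.
    have hh := (k P hP).horofunction
    have e0 := hD₀ P hP
    have e1 := hh.along_ray hX (hc P hP) t
    have e2 := hh.along_ray hX (hc P hP) s
    have e3 := hh.displacement hX hp ((c P).toFun s) o
    have e4 := hE₀ P hP _ hp
    have e5 := hh.abs_sub_le hX ((c P).toFun t) ((γ⁻¹ * γ') • (c P).toFun s)
    have e6 : dist ((c P).toFun t) ((γ⁻¹ * γ') • (c P).toFun s) ≤ R := by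
      rwa [← dist_smul γ, ← mul_smul, mul_inv_cancel_left]
    rw [hc0 P hP] at e1 e2
    rw [abs_le] at e1 e2 e3 e4 e5 ⊢
    constructor <;>
      linarith [e1.1, e1.2, e2.1, e2.2, e3.1, e3.2, e4.1, e4.2, e5.1, e5.2]
  · refine ⟨3 * (|E₀| + 6 * |D₀| + 2 * δ) + 4 * δ, fun P hP p hp t ht => ?_⟩
    have hp' := (hfix P hP p).1 hp
    have h1 := (k P hP).horofunction.dist_ray_smul_le hX hp' (hc P hP) (E := E₀)
      (by rw [hc0 P hP]; exact hE₀ P hP p hp') (t := t) (by rwa [hc0 P hP])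
    linarith [le_abs_self E₀, le_abs_self D₀, hD₀ P hP]
  · obtain ⟨A, hA⟩ := exists_uniform_bound hfinP (Q := fun P A => ∀ (p : P) (t : ℝ≥0),
      dist o ((p : G) • o) ≤ 2 * t + C → wordDist (T P) 1 p ≤ A * Real.exp (g P t))
      (fun _ _ _ hab h p t ht => (h p t ht).trans (by gcongr)) fun P hP => hwd P hP C
    exact ⟨A, fun P hP p t => hA P hP p t⟩
  · obtain ⟨C, hC'⟩ := exists_uniform_bound hfinP (Q := fun P C => ∀ (p : P) (t : ℝ≥0),
      wordDist (T P) 1 p ≤ A * Real.exp (g P t) → dist o ((p : G) • o) ≤ 2 * t + C)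
      (fun _ _ _ hab h p t ht => (h p t ht).trans (by gcongr)) fun P hP => hdl P hP A
    exact ⟨C, fun P hP p t => hC' P hP p t⟩

end Model

/-! ### Consequences of the coarse model -/

section ModelLemmas

variable {G X : Type*} [Group G] [MetricSpace X] [MulAction G X] {ℙ : Set (Subgroup G)}
  {P Q : Subgroup G}

theorem CuspModel.g_zero (M : CuspModel G X ℙ) (hP : P ∈ ℙ) : M.g P 0 = 0 := by
  obtain ⟨x, hx⟩ := (M.g P).surjective 0
  have := (M.mono P hP).monotone (zero_le (a := x))
  rw [hx] at this
  exact le_antisymm this (zero_le (a := _))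

theorem CuspModel.dist_o_c (M : CuspModel G X ℙ) (hP : P ∈ ℙ) (t : ℝ≥0) :
    dist M.o (M.c P t) = t := by
  rw [← M.c_zero P hP, M.dist_c P hP]
  simp

theorem wordDist_one_le_of_mem {S : Set G} {s : G} (hs : s ∈ S ∨ s⁻¹ ∈ S) :
    wordDist S 1 s ≤ 1 := by
  have : wordLength S s ≤ 1 := Nat.sInf_le ⟨[s], rfl, by simpa using hs, by simp⟩
  simpa [wordDist] using this

theorem CuspModel.exists_dist_letter_le (M : CuspModel G X ℙ) :
    ∃ C : ℝ, ∀ P ∈ ℙ, ∀ s : P, s ∈ M.T P ∨ s⁻¹ ∈ M.T P → dist M.o ((s : G) • M.o) ≤ C := by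
  obtain ⟨C, hC⟩ := M.dist_le 1
  refine ⟨C, fun P hP s hs => ?_⟩
  have := hC P hP s 0 (by rw [M.g_zero hP]; simpa using wordDist_one_le_of_mem hs)
  simpa using this

theorem CuspModel.exists_wordDist_le (M : CuspModel G X ℙ) (B : ℝ) :
    ∃ N : ℝ, ∀ P ∈ ℙ, ∀ p : P, dist M.o ((p : G) • M.o) ≤ B → wordDist (M.T P) 1 p ≤ N := by
  obtain ⟨A, hA⟩ := M.wordDist_le B
  refine ⟨A, fun P hP p hp => ?_⟩
  have := hA P hP p 0 (by simpa using hp)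
  rw [M.g_zero hP] at this
  simpa using this

theorem CuspModel.exists_mem_lt_dist (M : CuspModel G X ℙ) (hP : P ∈ ℙ) (D : ℝ) :
    ∃ p ∈ P, D < dist M.o (p • M.o) := by
  by_contra! H
  have := M.infinite P hP
  exact (Set.infinite_coe_iff.1 this) ((M.finite_dist_le D).subset fun p hp => H p hp)

variable [IsIsometricSMul G X]

/-- Going |B| / 2 deeper reaches the merging depth, and the detour down and back costs |B|. -/
theorem CuspModel.dist_c_smul_le_of_le (M : CuspModel G X ℙ) (B : ℝ) :
    ∃ C : ℝ, ∀ P ∈ ℙ, ∀ p ∈ P, ∀ t : ℝ≥0, dist M.o (p • M.o) ≤ 2 * t + B →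
      dist (M.c P t) (p • M.c P t) ≤ C := by
  obtain ⟨C, hC⟩ := M.merge
  refine ⟨C + |B|, fun P hP p hp t ht => ?_⟩
  obtain ⟨b, hb⟩ : ∃ b : ℝ≥0, (b : ℝ) = |B| / 2 := ⟨⟨_, by positivity⟩, rfl⟩
  have h1 := hC P hP p hp (t + b) (by push_cast; linarith [le_abs_self B])
  have h2 := dist_triangle4 (M.c P t) (M.c P (t + b)) (p • M.c P (t + b)) (p • M.c P t)
  rw [dist_smul, dist_comm (M.c P (t + b)) (M.c P t), M.dist_c P hP] at h2
  push_cast at h2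
  rw [sub_add_cancel_left, abs_neg, hb, abs_of_nonneg (by positivity)] at h2
  linarith

theorem IsHyperbolic.dist_le_of_coarse_midpoints {δ : ℝ} (hX : IsHyperbolic X δ) {a b u v : X}
    {E : ℝ} (hau : dist a u ≤ dist a b / 2 + E) (hub : dist u b ≤ dist a b / 2 + E)
    (hav : dist a v ≤ dist a b / 2 + E) (hvb : dist v b ≤ dist a b / 2 + E) :
    dist u v ≤ 4 * E + 2 * δ := by
  have h := hX.four_point a u b v
  have h1 := dist_triangle a u b
  have h2 := dist_triangle a v b
  rw [sub_le_iff_le_add, min_le_iff] at h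
  simp only [gromovProduct, dist_comm b v] at h
  rcases h with h | h <;> linarith

/-- Distinct peripheral cosets have bounded coarse intersection. -/
theorem CuspModel.eq_of_coset_near {δ : ℝ} (hX : IsHyperbolic X δ) (M : CuspModel G X ℙ)
    (hP : P ∈ ℙ) (hQ : Q ∈ ℙ) {γ r : G} {B : ℝ}
    (h : ∀ p ∈ P, ∃ q ∈ Q, dist ((γ * p) • M.o) ((r * q) • M.o) ≤ B) :
    P = Q ∧ γ⁻¹ * r ∈ P := by
  obtain ⟨C₁, hC₁⟩ := M.dist_c_smul_le_of_le 0
  obtain ⟨C₂, hC₂⟩ := M.dist_c_smul_le_of_le (2 * B)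
  obtain ⟨T, hT⟩ := M.separation (4 * (|B| + |C₁| + |C₂|) + 2 * δ)
  -- At half the displacement of p, the rays of both cosets pass coarse midpoints of γ o and γ p o.
  -- These are close by hyperbolicity and deeper than T, so separation identifies the cosets.
  obtain ⟨p, hp, hpD⟩ := M.exists_mem_lt_dist hP (2 * T)
  obtain ⟨q₀, hq₀, h₀⟩ := h 1 P.one_mem
  obtain ⟨q₁, hq₁, h₁⟩ := h p hp
  rw [mul_one] at h₀
  obtain ⟨t, ht⟩ : ∃ t : ℝ≥0, (t : ℝ) = dist M.o (p • M.o) / 2 := ⟨⟨_, by positivity⟩, rfl⟩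
  have nB := le_abs_self B
  have nC₁ := le_abs_self C₁
  have nC₂ := le_abs_self C₂
  have pB := abs_nonneg B
  have pC₁ := abs_nonneg C₁
  have pC₂ := abs_nonneg C₂
  have hab : dist (γ • M.o) ((γ * p) • M.o) = dist M.o (p • M.o) := by rw [mul_smul, dist_smul]
  have e1 := hC₁ P hP p hp t (by linarith)
  have e2 := hC₂ Q hQ (q₀⁻¹ * q₁) (Q.mul_mem (Q.inv_mem hq₀) hq₁) t (by
    rw [← dist_smul (r * q₀), ← mul_smul, mul_assoc r, mul_inv_cancel_left]
    have := dist_triangle4 ((r * q₀) • M.o) (γ • M.o) ((γ * p) • M.o) ((r * q₁) • M.o)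
    rw [dist_comm ((r * q₀) • M.o) (γ • M.o)] at this
    linarith)
  rw [← dist_smul (r * q₀), ← mul_smul, mul_assoc r, mul_inv_cancel_left] at e2
  have key := hX.dist_le_of_coarse_midpoints (a := γ • M.o) (b := (γ * p) • M.o)
    (u := γ • M.c P t) (v := (r * q₀) • M.c Q t) (E := |B| + |C₁| + |C₂|)
    (by rw [dist_smul, M.dist_o_c hP]; linarith)
    (by
      have := dist_triangle (γ • M.c P t) ((γ * p) • M.c P t) ((γ * p) • M.o)
      rw [dist_smul (γ * p), dist_comm (M.c P t) M.o, M.dist_o_c hP, mul_smul γ p (M.c P t),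
        dist_smul γ (M.c P t)] at this
      linarith)
    (by
      have := dist_triangle (γ • M.o) ((r * q₀) • M.o) ((r * q₀) • M.c Q t)
      rw [dist_smul, M.dist_o_c hQ] at this
      linarith)
    (by
      have := dist_triangle4 ((r * q₀) • M.c Q t) ((r * q₁) • M.c Q t) ((r * q₁) • M.o)
        ((γ * p) • M.o)
      rw [dist_smul (r * q₁), dist_comm (M.c Q t) M.o, M.dist_o_c hQ,
        dist_comm ((r * q₁) • M.o)] at this
      linarith)
  rcases hT P hP Q hQ γ (r * q₀) t t key with ⟨h1, -⟩ | ⟨rfl, h1, -⟩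
  · linarith
  · refine ⟨rfl, ?_⟩
    rwa [← mul_assoc, P.mul_mem_cancel_right hq₀] at h1

end ModelLemmas

/-! ### Maps between coarse models -/

section CosetMap

variable {G G' X X' : Type*} [Group G] [Group G'] [MetricSpace X] [MetricSpace X']
  [MulAction G X] [MulAction G' X'] {ℙ : Set (Subgroup G)} {ℙ' : Set (Subgroup G')}

/-- The change of depth between the cusps of `P` and `P'` that matches their distortions. -/
noncomputable def depthMap (M : CuspModel G X ℙ) (M' : CuspModel G' X' ℙ') (P : Subgroup G)
    (P' : Subgroup G') (t : ℝ≥0) : ℝ≥0 :=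
  (M'.g P').symm (M.g P t)

theorem g_depthMap (M : CuspModel G X ℙ) (M' : CuspModel G' X' ℙ') (P : Subgroup G)
    (P' : Subgroup G') (t : ℝ≥0) : M'.g P' (depthMap M M' P P' t) = M.g P t :=
  (M'.g P').apply_symm_apply _

theorem depthMap_depthMap (M : CuspModel G X ℙ) (M' : CuspModel G' X' ℙ') (P : Subgroup G)
    (P' : Subgroup G') (t : ℝ≥0) : depthMap M' M P' P (depthMap M M' P P' t) = t := by
  rw [depthMap, g_depthMap, Homeomorph.symm_apply_apply]

theorem depthMap_zero (M : CuspModel G X ℙ) (M' : CuspModel G' X' ℙ') {P : Subgroup G}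
    {P' : Subgroup G'} (hP : P ∈ ℙ) (hP' : P' ∈ ℙ') : depthMap M M' P P' 0 = 0 := by
  rw [depthMap, M.g_zero hP, Homeomorph.symm_apply_eq, M'.g_zero hP']

theorem exists_abs_depthMap_sub_le (M : CuspModel G X ℙ) (M' : CuspModel G' X' ℙ') :
    ∃ K : ℝ, 0 ≤ K ∧ ∀ P ∈ ℙ, ∀ P' ∈ ℙ', ∀ s t : ℝ≥0,
      |(depthMap M M' P P' s : ℝ) - depthMap M M' P P' t| ≤ K * |(s : ℝ) - t| := by
  obtain ⟨K, hK, h⟩ := M.bilipschitz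
  obtain ⟨K', hK', h'⟩ := M'.bilipschitz
  refine ⟨K' * K, by positivity, fun P hP P' hP' s t => ?_⟩
  refine (h' P' hP' _ _).2.trans ?_
  rw [g_depthMap, g_depthMap, mul_assoc]
  gcongr
  exact (h P hP s t).1

/-- `φ` is bornologous for the orbit metrics, and `A P γ P' q` is a relation which assigns to each
coset `γ P` a coset `q P'` near which `φ` maps it, represented by some `q` near `φ γ`. -/
structure IsCosetMap (M : CuspModel G X ℙ) (M' : CuspModel G' X' ℙ') (φ : G → G') (R : ℝ)
    (A : Subgroup G → G → Subgroup G' → G' → Prop) : Prop where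
  bornologous : ∀ B : ℝ, ∃ B' : ℝ, ∀ γ₁ γ₂ : G, dist (γ₁ • M.o) (γ₂ • M.o) ≤ B →
    dist (φ γ₁ • M'.o) (φ γ₂ • M'.o) ≤ B'
  mem : ∀ {P γ P' q}, A P γ P' q → P' ∈ ℙ'
  dist_le : ∀ {P γ P' q}, A P γ P' q → dist (φ γ • M'.o) (q • M'.o) ≤ R
  near : ∀ {P γ P' q}, A P γ P' q → ∀ p ∈ P, ∃ p' ∈ P',
    dist (φ (γ * p) • M'.o) ((q * p') • M'.o) ≤ R
  total : ∀ P ∈ ℙ, ∀ γ : G, ∃ P' q, A P γ P' q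
  functional : ∀ {P γ₁ γ₂ P₁ P₂ q₁ q₂}, A P γ₁ P₁ q₁ → A P γ₂ P₂ q₂ → γ₁⁻¹ * γ₂ ∈ P →
    P₁ = P₂ ∧ q₁⁻¹ * q₂ ∈ P₁

/-- `x` and `x'` are within `C` of corresponding points of the coarse models: of `γ o` and
`φ(γ) o'`, or of points of corresponding depth on the rays attached to corresponding cosets. -/
def Corresponds (M : CuspModel G X ℙ) (M' : CuspModel G' X' ℙ') (φ : G → G')
    (A : Subgroup G → G → Subgroup G' → G' → Prop) (C : ℝ) (x : X) (x' : X') : Prop :=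
  (∃ γ : G, dist x (γ • M.o) ≤ C ∧ dist x' (φ γ • M'.o) ≤ C) ∨
    ∃ P ∈ ℙ, ∃ γ P' q, A P γ P' q ∧ ∃ t : ℝ≥0, dist x (γ • M.c P t) ≤ C ∧
      dist x' (q • M'.c P' (depthMap M M' P P' t)) ≤ C

variable {M : CuspModel G X ℙ} {M' : CuspModel G' X' ℙ'} {φ : G → G'} {R : ℝ}
  {A : Subgroup G → G → Subgroup G' → G' → Prop}

theorem IsCosetMap.exists_corresponds (h : IsCosetMap M M' φ R A) :
    ∃ C : ℝ, 0 ≤ C ∧ ∀ x, ∃ x', Corresponds M M' φ A C x x' := by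
  obtain ⟨C, hC⟩ := M.cover
  refine ⟨|C|, abs_nonneg C, fun x => ?_⟩
  rcases hC x with ⟨γ, hγ⟩ | ⟨P, hP, γ, t, ht⟩
  · exact ⟨φ γ • M'.o, Or.inl ⟨γ, hγ.trans (le_abs_self C), by simp⟩⟩
  · obtain ⟨P', q, hA⟩ := h.total P hP γ
    exact ⟨_, Or.inr ⟨P, hP, γ, P', q, hA, t, ht.trans (le_abs_self C), by rw [dist_self]; positivity⟩⟩

theorem corresponds_orbit {C : ℝ} (hC : 0 ≤ C) (γ : G) :
    Corresponds M M' φ A C (γ • M.o) (φ γ • M'.o) :=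
  Or.inl ⟨γ, by simpa, by simpa⟩

theorem Corresponds.mono {C C' : ℝ} (hC : C ≤ C') {x : X} {x' : X'}
    (h : Corresponds M M' φ A C x x') : Corresponds M M' φ A C' x x' := by
  rcases h with ⟨γ, h1, h2⟩ | ⟨P, hP, γ, P', q, hA, t, h1, h2⟩
  · exact Or.inl ⟨γ, h1.trans hC, h2.trans hC⟩
  · exact Or.inr ⟨P, hP, γ, P', q, hA, t, h1.trans hC, h2.trans hC⟩

/-- The target coset is chosen at one representative of each coset γ P. All r in that target coset
near φ γ are then admitted, which makes the relation compatible with every other representative. -/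
theorem exists_isCosetMap
    (hb : ∀ B : ℝ, ∃ B' : ℝ, ∀ γ₁ γ₂ : G, dist (γ₁ • M.o) (γ₂ • M.o) ≤ B →
      dist (φ γ₁ • M'.o) (φ γ₂ • M'.o) ≤ B')
    (hR : ∀ P ∈ ℙ, ∀ γ : G, ∃ P' ∈ ℙ', ∃ q : G', ∀ p ∈ P, ∃ p' ∈ P',
      dist (φ (γ * p) • M'.o) ((q * p') • M'.o) ≤ R) :
    ∃ A, IsCosetMap M M' φ R A := by
  choose! P' hP' q hq using hR
  let out : Subgroup G → G → G := fun P γ => ((γ : G ⧸ P).out : G)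
  have hout : ∀ P γ, γ⁻¹ * out P γ ∈ P := fun P γ => by
    rw [← QuotientGroup.eq, QuotientGroup.out_eq']
  refine ⟨fun P γ Q r => P ∈ ℙ ∧ Q = P' P (out P γ) ∧ (q P (out P γ))⁻¹ * r ∈ Q ∧
    dist (φ γ • M'.o) (r • M'.o) ≤ R, hb, ?_, fun h => h.2.2.2, ?_, ?_, ?_⟩
  · rintro P γ Q r ⟨hP, rfl, -⟩
    exact hP' P hP _
  · rintro P γ Q r ⟨hP, rfl, hr, -⟩ p hp
    obtain ⟨p', hp', h⟩ := hq P hP (out P γ) ((γ⁻¹ * out P γ)⁻¹ * p)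
      (P.mul_mem (P.inv_mem (hout P γ)) hp)
    refine ⟨((q P (out P γ))⁻¹ * r)⁻¹ * p', Subgroup.mul_mem _ (Subgroup.inv_mem _ hr) hp', ?_⟩
    convert h using 3 <;> group
  · intro P hP γ
    obtain ⟨p', hp', h⟩ := hq P hP (out P γ) (γ⁻¹ * out P γ)⁻¹ (P.inv_mem (hout P γ))
    refine ⟨_, q P (out P γ) * p', hP, rfl, by simpa using hp', ?_⟩
    convert h using 3
    group
  · rintro P γ₁ γ₂ P₁ P₂ q₁ q₂ ⟨hP, rfl, h1, -⟩ ⟨-, rfl, h2, -⟩ hγ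
    have e : out P γ₁ = out P γ₂ := by
      simp only [out, (QuotientGroup.eq (s := P)).2 hγ]
    rw [e] at h1 ⊢
    refine ⟨rfl, ?_⟩
    have := Subgroup.mul_mem _ (Subgroup.inv_mem _ h1) h2
    rwa [mul_inv_rev, inv_inv, mul_assoc, mul_inv_cancel_left] at this

variable [IsIsometricSMul G X]

/-- Corresponding points for `φ` also correspond for a coarse inverse `ψ` of `φ`. -/
theorem IsCosetMap.corresponds_symm {δ : ℝ} (hX : IsHyperbolic X δ) {ψ : G' → G} {R' : ℝ}
    {A' : Subgroup G' → G' → Subgroup G → G → Prop} (h : IsCosetMap M M' φ R A)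
    (h' : IsCosetMap M' M ψ R' A') {E : ℝ} (hE : ∀ γ, dist (ψ (φ γ) • M.o) (γ • M.o) ≤ E) (C : ℝ) :
    ∃ C' : ℝ, ∀ x x', Corresponds M M' φ A C x x' → Corresponds M' M ψ A' C' x' x := by
  obtain ⟨B, hB⟩ := h'.bornologous R
  obtain ⟨D, hD⟩ := M.dist_c_smul_le_of_le (E + B + R')
  refine ⟨|C| + |E| + |D|, fun x x' hxx' => ?_⟩
  have pE := abs_nonneg E
  have pD := abs_nonneg D
  have nE := le_abs_self E
  have nD := le_abs_self D
  have nC := le_abs_self C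
  rcases hxx' with ⟨γ, h1, h2⟩ | ⟨P, hP, γ, P', q, hA, t, h1, h2⟩
  · refine Or.inl ⟨φ γ, by linarith, ?_⟩
    have := dist_triangle_right x (ψ (φ γ) • M.o) (γ • M.o)
    linarith [hE γ]
  · obtain ⟨Q, r, hA'⟩ := h'.total P' (h.mem hA) q
    -- ψ ∘ φ moves γ P by a bounded amount and carries it near r Q, so the two cosets coincide.
    have near : ∀ p ∈ P, ∃ k ∈ Q, dist ((γ * p) • M.o) ((r * k) • M.o) ≤ E + B + R' := by
      intro p hp
      obtain ⟨p', hp', e1⟩ := h.near hA p hp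
      obtain ⟨k, hk, e2⟩ := h'.near hA' p' hp'
      refine ⟨k, hk, ?_⟩
      have e3 := hB _ _ e1
      have e4 := dist_triangle4 ((γ * p) • M.o) (ψ (φ (γ * p)) • M.o) (ψ (q * p') • M.o)
        ((r * k) • M.o)
      rw [dist_comm ((γ * p) • M.o) (ψ _ • M.o)] at e4
      linarith [hE (γ * p)]
    obtain ⟨rfl, hr⟩ := M.eq_of_coset_near hX hP (h'.mem hA') near
    refine Or.inr ⟨P', h.mem hA, q, P, r, hA', depthMap M M' P P' t, by linarith, ?_⟩
    rw [depthMap_depthMap]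
    have e1 := hB _ _ (h.dist_le hA)
    have e2 := h'.dist_le hA'
    have e3 := dist_triangle4 (γ • M.o) (ψ (φ γ) • M.o) (ψ q • M.o) (r • M.o)
    rw [dist_comm (γ • M.o) (ψ _ • M.o)] at e3
    have e4 := hD P hP _ hr t (by
      rw [← dist_smul γ, ← mul_smul, mul_inv_cancel_left]
      linarith [hE γ, t.coe_nonneg])
    rw [← dist_smul γ, ← mul_smul, mul_inv_cancel_left] at e4
    have e5 := dist_triangle x (γ • M.c P t) (r • M.c P t)
    linarith

variable [IsIsometricSMul G' X']

/-- The distances in the orbits of corresponding cosets, in terms of the word metrics. -/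
theorem IsCosetMap.exists_wordDist_le (h : IsCosetMap M M' φ R A) :
    ∃ L : ℝ, 0 ≤ L ∧ ∀ P ∈ ℙ, ∀ γ₁ γ₂ P' q₁ q₂, A P γ₁ P' q₁ → A P γ₂ P' q₂ →
      ∀ (hp : γ₁⁻¹ * γ₂ ∈ P) (hp' : q₁⁻¹ * q₂ ∈ P'),
        wordDist (M'.T P') 1 ⟨_, hp'⟩ ≤ L * (wordDist (M.T P) 1 ⟨_, hp⟩ + 1) := by
  obtain ⟨D, hD⟩ := M.exists_dist_letter_le
  obtain ⟨B, hB⟩ := h.bornologous D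
  obtain ⟨N, hN⟩ := M'.exists_wordDist_le (2 * R + |B|)
  refine ⟨2 * |N|, by positivity, fun P hP γ₁ γ₂ P' q₁ q₂ h₁ h₂ hp hp' => ?_⟩
  choose κ hκ' hκ using h.near h₁
  -- A coarse version of φ on the coset. It moves by at most |N| along an edge of the Cayley graph
  -- of P; at the two ends it differs from 1 and from q₁⁻¹ q₂ by at most |N|.
  let f : P → P' := fun p => ⟨κ p p.2, hκ' p p.2⟩
  have hf : ∀ (p : P), dist (φ (γ₁ * p) • M'.o) ((q₁ * f p) • M'.o) ≤ R := fun p => hκ p p.2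
  have hP' := h.mem h₁
  have hgen := (M'.generates P' hP').closure_eq
  have step : ∀ a b : P', dist ((q₁ * a) • M'.o) ((q₁ * b) • M'.o) ≤ 2 * R + |B| →
      wordDist (M'.T P') a b ≤ |N| := fun a b hab => by
    rw [wordDist_eq_one_inv_mul]
    refine (hN P' hP' _ ?_).trans (le_abs_self N)
    rwa [mul_smul, mul_smul, dist_smul, ← dist_smul (a⁻¹ : G'), inv_smul_smul,
      ← mul_smul] at hab
  have e1 := le_add_mul_wordDist (M.generates P hP).closure_eq
    (f := fun p => wordDist (M'.T P') 1 (f p)) (A := |N|) (fun p s hs => by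
      refine (wordDist_triangle hgen 1 (f p) (f (p * s))).trans ?_
      gcongr
      refine step _ _ ?_
      have d1 := hB (γ₁ * p) (γ₁ * ↑(p * s)) (by
        rw [Subgroup.coe_mul, ← mul_assoc, mul_smul _ (s : G), dist_smul]
        exact hD P hP s hs)
      have d2 := dist_triangle4 ((q₁ * f p) • M'.o) (φ (γ₁ * p) • M'.o)
        (φ (γ₁ * ↑(p * s)) • M'.o) ((q₁ * f (p * s)) • M'.o)
      rw [dist_comm ((q₁ * f p) • M'.o) (φ (γ₁ * p) • M'.o)] at d2
      linarith [hf p, hf (p * s), le_abs_self B]) ⟨_, hp⟩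
  have e2 : wordDist (M'.T P') 1 (f 1) ≤ |N| := step _ _ (by
    have d1 := dist_triangle_left (q₁ • M'.o) ((q₁ * f 1) • M'.o) (φ γ₁ • M'.o)
    have d2 := hf 1
    rw [OneMemClass.coe_one, mul_one] at d2
    rw [OneMemClass.coe_one, mul_one]
    linarith [h.dist_le h₁, abs_nonneg B])
  have e3 : wordDist (M'.T P') (f ⟨_, hp⟩) ⟨_, hp'⟩ ≤ |N| := step _ _ (by
    have d1 := hf ⟨_, hp⟩
    simp only [mul_inv_cancel_left] at d1 ⊢
    have d2 := dist_triangle_left ((q₁ * f ⟨_, hp⟩) • M'.o) (q₂ • M'.o) (φ γ₂ • M'.o)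
    linarith [h.dist_le h₂, abs_nonneg B])
  have e4 := wordDist_triangle hgen 1 (f ⟨_, hp⟩) ⟨_, hp'⟩
  have e5 := wordDist_nonneg (S := M.T P) 1 ⟨_, hp⟩
  have e6 : 0 ≤ |N| * wordDist (M.T P) 1 ⟨_, hp⟩ := by positivity
  linarith

/-- Closeness at depth t bounds the word length in P by a multiple of exp (g_P t), hence that in P'
by a multiple of the same number, which is the exponential at the image depth. So the image rays
have merged there up to a bounded error. -/
theorem IsCosetMap.exists_dist_cusp_le (h : IsCosetMap M M' φ R A) (B : ℝ) :
    ∃ B' : ℝ, ∀ P ∈ ℙ, ∀ γ₁ γ₂ P₁ P₂ q₁ q₂, A P γ₁ P₁ q₁ → A P γ₂ P₂ q₂ → γ₁⁻¹ * γ₂ ∈ P →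
      ∀ t s : ℝ≥0, |(t : ℝ) - s| ≤ B → dist (γ₁ • M.c P t) (γ₂ • M.c P s) ≤ B →
        dist (q₁ • M'.c P₁ (depthMap M M' P P₁ t)) (q₂ • M'.c P₂ (depthMap M M' P P₂ s)) ≤ B' := by
  obtain ⟨L, hL, hLw⟩ := h.exists_wordDist_le
  obtain ⟨K, hK, hρ⟩ := exists_abs_depthMap_sub_le M M'
  obtain ⟨a, ha⟩ := M.wordDist_le (2 * B)
  obtain ⟨C, hC⟩ := M'.dist_le (L * (a + 1))
  obtain ⟨C', hC'⟩ := M'.dist_c_smul_le_of_le C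
  refine ⟨C' + K * B, fun P hP γ₁ γ₂ P' P₂ q₁ q₂ h₁ h₂ hp t s hts hd => ?_⟩
  obtain ⟨rfl, hp'⟩ := h.functional h₁ h₂ hp
  have hP' := h.mem h₁
  have e1 : dist M.o ((γ₁⁻¹ * γ₂) • M.o) ≤ 2 * t + 2 * B := by
    have d1 := dist_triangle4 (γ₁ • M.o) (γ₁ • M.c P t) (γ₂ • M.c P s) (γ₂ • M.o)
    rw [dist_smul, dist_smul, dist_comm (M.c P s), M.dist_o_c hP, M.dist_o_c hP] at d1
    rw [← dist_smul γ₁, ← mul_smul, mul_inv_cancel_left]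
    linarith [(abs_le.1 hts).1]
  have e2 := ha P hP ⟨_, hp⟩ t e1
  have e3 : wordDist (M'.T P') 1 ⟨_, hp'⟩ ≤
      L * (a + 1) * Real.exp (M'.g P' (depthMap M M' P P' t)) := by
    rw [g_depthMap]
    refine (hLw P hP γ₁ γ₂ P' q₁ q₂ h₁ h₂ hp hp').trans ?_
    -- The additive 1 in the word length estimate is absorbed because the exponential is at least 1.
    have := Real.one_le_exp (M.g P t).coe_nonneg
    rw [mul_assoc, add_mul, one_mul]
    gcongr
  have e4 := hC' P' hP' _ hp' _ (hC P' hP' _ _ e3)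
  have e5 := dist_triangle (M'.c P' (depthMap M M' P P' t))
    ((q₁⁻¹ * q₂) • M'.c P' (depthMap M M' P P' t)) ((q₁⁻¹ * q₂) • M'.c P' (depthMap M M' P P' s))
  rw [dist_smul, M'.dist_c P' hP'] at e5
  have e6 := hρ P hP P' hP' t s
  have e7 : K * |(t : ℝ) - s| ≤ K * B := by gcongr
  rw [← dist_smul q₁⁻¹, inv_smul_smul, ← mul_smul]
  linarith

theorem IsCosetMap.corresponds_of_shallow (h : IsCosetMap M M' φ R A) (C T : ℝ) :
    ∃ C' : ℝ, ∀ P ∈ ℙ, ∀ γ P' q, A P γ P' q → ∀ (t : ℝ≥0) x x', (t : ℝ) ≤ T →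
      dist x (γ • M.c P t) ≤ C → dist x' (q • M'.c P' (depthMap M M' P P' t)) ≤ C →
        dist x (γ • M.o) ≤ C' ∧ dist x' (φ γ • M'.o) ≤ C' := by
  obtain ⟨K, hK, hρ⟩ := exists_abs_depthMap_sub_le M M'
  refine ⟨C + |T| + K * |T| + |R|, fun P hP γ P' q hA t x x' ht hx hx' => ?_⟩
  have hP' := h.mem hA
  have e1 := hρ P hP P' hP' t 0
  rw [depthMap_zero M M' hP hP'] at e1
  simp only [NNReal.coe_zero, sub_zero, NNReal.abs_eq] at e1
  have e2 : K * t ≤ K * |T| := by gcongr; exact ht.trans (le_abs_self T)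
  have e3 := dist_triangle x (γ • M.c P t) (γ • M.o)
  have e4 := dist_triangle4 x' (q • M'.c P' (depthMap M M' P P' t)) (q • M'.o) (φ γ • M'.o)
  rw [dist_smul, dist_comm _ M.o, M.dist_o_c hP] at e3
  rw [dist_smul, dist_comm _ M'.o, M'.dist_o_c hP', dist_comm (q • M'.o)] at e4
  have := h.dist_le hA
  have : 0 ≤ K * |T| := by positivity
  constructor <;> linarith [le_abs_self T, abs_nonneg T, le_abs_self R, abs_nonneg R]

/-- By separation, nearby points are either both at bounded depth, where φ on the orbit controls
their correspondents, or at similar depths in the same cusp. With r = 0 it says that correspondents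
are unique up to bounded distance. -/
theorem IsCosetMap.exists_dist_le (h : IsCosetMap M M' φ R A) (C r : ℝ) :
    ∃ r' : ℝ, ∀ x y x' y', Corresponds M M' φ A C x x' → Corresponds M M' φ A C y y' →
      dist x y ≤ r → dist x' y' ≤ r' := by
  obtain ⟨T, hT⟩ := M.separation (2 * C + r)
  obtain ⟨C', hC'⟩ := h.corresponds_of_shallow C T
  obtain ⟨B, hB⟩ := h.bornologous (2 * max C C' + r)
  obtain ⟨D, hD⟩ := h.exists_dist_cusp_le (max T (2 * C + r))
  have orbit : ∀ x y x' y' γ₁ γ₂, dist x (γ₁ • M.o) ≤ max C C' → dist x' (φ γ₁ • M'.o) ≤ max C C' →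
      dist y (γ₂ • M.o) ≤ max C C' → dist y' (φ γ₂ • M'.o) ≤ max C C' → dist x y ≤ r →
        dist x' y' ≤ 2 * max C C' + B := by
    intro x y x' y' γ₁ γ₂ h1 h2 h3 h4 hxy
    have e1 := dist_triangle4 (γ₁ • M.o) x y (γ₂ • M.o)
    rw [dist_comm (γ₁ • M.o) x] at e1
    have e2 := hB γ₁ γ₂ (by linarith)
    have e3 := dist_triangle4 x' (φ γ₁ • M'.o) (φ γ₂ • M'.o) y'
    rw [dist_comm (φ γ₂ • M'.o) y'] at e3
    linarith
  have mixed : ∀ x y x' y' γ₁ P, P ∈ ℙ → ∀ γ₂ P' q, A P γ₂ P' q → ∀ t : ℝ≥0,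
      dist x (γ₁ • M.o) ≤ C → dist x' (φ γ₁ • M'.o) ≤ C → dist y (γ₂ • M.c P t) ≤ C →
        dist y' (q • M'.c P' (depthMap M M' P P' t)) ≤ C → dist x y ≤ r →
          dist x' y' ≤ 2 * max C C' + B := by
    intro x y x' y' γ₁ P hP γ₂ P' q hA t h1 h2 h3 h4 hxy
    have e1 := dist_triangle4 (γ₁ • M.o) x y (γ₂ • M.c P t)
    rw [dist_comm (γ₁ • M.o) x] at e1
    have ht : (t : ℝ) ≤ T := by
      -- An orbit point counts as the point of depth 0 on a ray of the same type P.
      rcases hT P hP P hP γ₁ γ₂ 0 t (by rw [M.c_zero P hP]; linarith) with h5 | h5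
      · exact h5.2
      · have h6 := h5.2.2
        rwa [NNReal.coe_zero, zero_sub, abs_neg, NNReal.abs_eq] at h6
    obtain ⟨h5, h6⟩ := hC' P hP γ₂ P' q hA t y y' ht h3 h4
    exact orbit x y x' y' γ₁ γ₂ (h1.trans (le_max_left _ _)) (h2.trans (le_max_left _ _))
      (h5.trans (le_max_right _ _)) (h6.trans (le_max_right _ _)) hxy
  refine ⟨max (2 * max C C' + B) (2 * C + D), fun x y x' y' hx hy hxy => ?_⟩
  rcases hx with ⟨γ₁, h1, h2⟩ | ⟨P, hP, γ₁, P₁, q₁, hA₁, t, h1, h2⟩ <;>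
    rcases hy with ⟨γ₂, h3, h4⟩ | ⟨Q, hQ, γ₂, P₂, q₂, hA₂, s, h3, h4⟩
  · exact le_max_of_le_left (orbit x y x' y' γ₁ γ₂ (h1.trans (le_max_left _ _))
      (h2.trans (le_max_left _ _)) (h3.trans (le_max_left _ _)) (h4.trans (le_max_left _ _)) hxy)
  · exact le_max_of_le_left (mixed x y x' y' γ₁ Q hQ γ₂ P₂ q₂ hA₂ s h1 h2 h3 h4 hxy)
  · rw [dist_comm] at hxy ⊢
    exact le_max_of_le_left (mixed y x y' x' γ₂ P hP γ₁ P₁ q₁ hA₁ t h3 h4 h1 h2 hxy)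
  · have e1 := dist_triangle4 (γ₁ • M.c P t) x y (γ₂ • M.c Q s)
    rw [dist_comm (γ₁ • M.c P t) x] at e1
    have e2 : dist (γ₁ • M.c P t) (γ₂ • M.c Q s) ≤ 2 * C + r := by linarith
    rcases hT P hP Q hQ γ₁ γ₂ t s e2 with ⟨ht, hs⟩ | ⟨rfl, hp, hts⟩
    · obtain ⟨h5, h6⟩ := hC' P hP γ₁ P₁ q₁ hA₁ t x x' ht h1 h2
      obtain ⟨h7, h8⟩ := hC' Q hQ γ₂ P₂ q₂ hA₂ s y y' hs h3 h4
      exact le_max_of_le_left (orbit x y x' y' γ₁ γ₂ (h5.trans (le_max_right _ _))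
        (h6.trans (le_max_right _ _)) (h7.trans (le_max_right _ _)) (h8.trans (le_max_right _ _))
        hxy)
    · have e3 := hD P hP γ₁ γ₂ P₁ P₂ q₁ q₂ hA₁ hA₂ hp t s (hts.trans (le_max_left _ _))
        (e2.trans (le_max_right _ _))
      have e4 := dist_triangle4 x' (q₁ • M'.c P₁ (depthMap M M' P P₁ t))
        (q₂ • M'.c P₂ (depthMap M M' P P₂ s)) y'
      rw [dist_comm (q₂ • M'.c P₂ _) y'] at e4
      exact le_max_of_le_right (by linarith)

end CosetMap

/-! ### The extension -/

section Extension

variable {G G' X X' : Type*} [Group G] [Group G'] [MetricSpace X] [MetricSpace X']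

theorem IsGeodesicSpace.isCoarseLipschitz (hX : IsGeodesicSpace X) {F : X → X'} {C : ℝ}
    (h : ∀ x y, dist x y ≤ 1 → dist (F x) (F y) ≤ C) : IsCoarseLipschitz dist dist F := by
  have key : ∀ (n : ℕ) x y, dist x y ≤ n + 1 → dist (F x) (F y) ≤ C * (n + 1) := by
    intro n
    induction n with
    | zero => intro x y hxy; simpa using h x y (by simpa using hxy)
    | succ n ih =>
      intro x y hxy
      push_cast at hxy ⊢
      rcases le_total (dist x y) 1 with h1 | h1
      · have hC := dist_nonneg.trans (h x y h1)
        have : 0 ≤ C * (n + 1) := by positivity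
        linarith [h x y h1]
      · obtain ⟨u, hu, hu'⟩ := hX.exists_between x y zero_le_one h1
        have e1 := dist_triangle (F x) (F u) (F y)
        linarith [h x u hu.le, ih u y (by linarith)]
  refine ⟨max 1 C, |C|, le_max_left _ _, abs_nonneg C, fun x y => ?_⟩
  have hC := dist_nonneg.trans (h x x (by simp))
  have e1 := key ⌊dist x y⌋₊ x y (Nat.lt_floor_add_one _).le
  have e2 := Nat.floor_le (dist_nonneg (x := x) (y := y))
  have e3 : C * ⌊dist x y⌋₊ ≤ max 1 C * dist x y := by gcongr; exact le_max_right _ _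
  linarith [le_abs_self C]

variable [MulAction G X] [MulAction G' X'] [IsIsometricSMul G X] [IsIsometricSMul G' X']
  {ℙ : Set (Subgroup G)} {ℙ' : Set (Subgroup G')} {M : CuspModel G X ℙ}
  {M' : CuspModel G' X' ℙ'} {φ : G → G'} {R : ℝ}
  {A : Subgroup G → G → Subgroup G' → G' → Prop}

theorem IsCosetMap.isCoarseLipschitz (h : IsCosetMap M M' φ R A) (hX : IsGeodesicSpace X)
    {F : X → X'} {C : ℝ} (hF : ∀ x, Corresponds M M' φ A C x (F x)) :
    IsCoarseLipschitz dist dist F := by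
  obtain ⟨r, hr⟩ := h.exists_dist_le C 1
  exact hX.isCoarseLipschitz fun x y => hr x y _ _ (hF x) (hF y)

theorem IsCosetMap.isCuspExtension (h : IsCosetMap M M' φ R A) {F : X → X'} {C : ℝ} (hC : 0 ≤ C)
    (hF : ∀ x, Corresponds M M' φ A C x (F x)) : IsCuspExtension φ F := by
  intro x x'
  obtain ⟨r, hr⟩ := h.exists_dist_le C (dist x M.o)
  refine ⟨r + dist M'.o x', fun γ => ?_⟩
  have e1 := hr (γ • x) (γ • M.o) _ _ (hF _) (corresponds_orbit hC γ) (dist_smul _ _ _).le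
  have e2 := dist_triangle (F (γ • x)) (φ γ • M'.o) (φ γ • x')
  rw [dist_smul] at e2
  linarith

/-- Both F' (F x) and x correspond to F x under ψ. -/
theorem IsCosetMap.exists_dist_comp_le {δ : ℝ} (hX : IsHyperbolic X δ) {ψ : G' → G} {R' : ℝ}
    {A' : Subgroup G' → G' → Subgroup G → G → Prop} (h : IsCosetMap M M' φ R A)
    (h' : IsCosetMap M' M ψ R' A') {E : ℝ} (hE : ∀ γ, dist (ψ (φ γ) • M.o) (γ • M.o) ≤ E)
    {F : X → X'} {F' : X' → X} {C C' : ℝ} (hF : ∀ x, Corresponds M M' φ A C x (F x))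
    (hF' : ∀ x, Corresponds M' M ψ A' C' x (F' x)) : ∃ ε : ℝ, ∀ x, dist (F' (F x)) x ≤ ε := by
  obtain ⟨D, hD⟩ := h.corresponds_symm hX h' hE C
  obtain ⟨r, hr⟩ := h'.exists_dist_le (max C' D) 0
  exact ⟨r, fun x => hr (F x) (F x) _ _ ((hF' _).mono (le_max_left _ _))
    ((hD _ _ (hF x)).mono (le_max_right _ _)) (by simp)⟩

theorem IsCosetMap.isQuasiIsometry {δ δ' : ℝ} (hX : IsHyperbolic X δ) (hX' : IsHyperbolic X' δ')
    {ψ : G' → G} {R' : ℝ} {A' : Subgroup G' → G' → Subgroup G → G → Prop}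
    (h : IsCosetMap M M' φ R A) (h' : IsCosetMap M' M ψ R' A') {E : ℝ}
    (hE : ∀ γ, dist (ψ (φ γ) • M.o) (γ • M.o) ≤ E)
    (hE' : ∀ γ, dist (φ (ψ γ) • M'.o) (γ • M'.o) ≤ E) {F : X → X'} {C : ℝ}
    (hF : ∀ x, Corresponds M M' φ A C x (F x)) : IsQuasiIsometry dist dist F := by
  obtain ⟨C', -, hC'⟩ := h'.exists_corresponds
  choose F' hF' using hC'
  obtain ⟨ε, hε⟩ := h.exists_dist_comp_le hX h' hE hF hF'
  obtain ⟨ε', hε'⟩ := h'.exists_dist_comp_le hX' h hE' hF' hF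
  exact ⟨h.isCoarseLipschitz hX.1 hF, F', h'.isCoarseLipschitz hX'.1 hF', max ε ε',
    fun x => (hε x).trans (le_max_left _ _), fun x => (hε' x).trans (le_max_right _ _)⟩

/-- Orbit distances do not bound word distances linearly, because cusps distort. Finiteness of the
orbit in balls still gives some bound, which is all that is needed. -/
theorem IsCoarseLipschitz.bornologous {S : Set G} {S' : Set G'} (hS' : IsFiniteGeneratingSet S')
    (h : IsCoarseLipschitz (wordDist S) (wordDist S') φ) (M : CuspModel G X ℙ)
    (M' : CuspModel G' X' ℙ') (B : ℝ) :
    ∃ B' : ℝ, ∀ γ₁ γ₂ : G, dist (γ₁ • M.o) (γ₂ • M.o) ≤ B →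
      dist (φ γ₁ • M'.o) (φ γ₂ • M'.o) ≤ B' := by
  obtain ⟨L, ε, hL, hε, h⟩ := h
  obtain ⟨N, hN⟩ := CuspedSpaces.exists_wordDist_le (S := S) M.finite_dist_le B
  obtain ⟨K, hK, hK'⟩ := exists_dist_smul_le_wordDist hS' M'.o
  refine ⟨K * (L * N + ε), fun γ₁ γ₂ hγ => (hK' _ _).trans ?_⟩
  have := hN γ₁ γ₂ hγ
  gcongr
  exact (h γ₁ γ₂).trans (by gcongr)

theorem IsCoarseLipschitzMapOfPairs.exists_isCosetMap {S : Set G} {S' : Set G'}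
    (hS' : IsFiniteGeneratingSet S') (h : IsCoarseLipschitzMapOfPairs S ℙ S' ℙ' φ)
    (M : CuspModel G X ℙ) (M' : CuspModel G' X' ℙ') : ∃ R A, IsCosetMap M M' φ R A := by
  obtain ⟨hL, R, hR⟩ := h
  obtain ⟨K, hK, hK'⟩ := exists_dist_smul_le_wordDist hS' M'.o
  refine ⟨K * R, CuspedSpaces.exists_isCosetMap (hL.bornologous hS' M M') fun P hP γ => ?_⟩
  obtain ⟨P', hP', q, hq⟩ := hR P hP γ
  refine ⟨P', hP', q, fun p hp => ?_⟩
  obtain ⟨p', hp', hd⟩ := hq p hp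
  exact ⟨p', hp', (hK' _ _).trans (by gcongr)⟩

/-- A homomorphism that conjugates the members of `ℙ` into members of `ℙ'` has an equivariant
relation between cosets. -/
theorem exists_isCosetMap_of_conj (hfin : ℙ.Finite) (Φ : G →* G') (M : CuspModel G X ℙ)
    (M' : CuspModel G' X' ℙ')
    (h : ∀ P ∈ ℙ, ∃ P' ∈ ℙ', ∃ k : G', ∀ p ∈ P, k⁻¹ * Φ p * k ∈ P') :
    ∃ R A, IsCosetMap M M' Φ R A ∧
      ∀ P γ P' q k, A P γ P' q → A P (k * γ) P' (Φ k * q) := by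
  choose! P' hP' k hk using h
  obtain ⟨R, hR⟩ := (hfin.image fun P => dist (k P • M'.o) M'.o +
    dist ((k P)⁻¹ • M'.o) M'.o).bddAbove
  have hR' : ∀ P ∈ ℙ, dist (k P • M'.o) M'.o + dist ((k P)⁻¹ • M'.o) M'.o ≤ R :=
    fun P hP => hR (Set.mem_image_of_mem _ hP)
  -- The coset γ P goes to Φ(γ) k_P P', where k_P conjugates Φ(P) into P'. This formula involves no
  -- choice of coset representatives, hence is equivariant.
  refine ⟨R, fun P γ Q q => P ∈ ℙ ∧ Q = P' P ∧ (Φ γ * k P)⁻¹ * q ∈ Q ∧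
    dist (Φ γ • M'.o) (q • M'.o) ≤ R, ⟨fun B => ?_, ?_, fun h => h.2.2.2, ?_, ?_, ?_⟩, ?_⟩
  · obtain ⟨B', hB'⟩ := ((M.finite_dist_le B).image fun γ => dist M'.o (Φ γ • M'.o)).bddAbove
    refine ⟨B', fun γ₁ γ₂ hγ => ?_⟩
    rw [← dist_smul (Φ γ₁)⁻¹, inv_smul_smul, ← mul_smul, ← map_inv, ← map_mul]
    refine hB' (Set.mem_image_of_mem _ ?_)
    rwa [Set.mem_ofPred_eq, ← dist_smul γ₁, ← mul_smul, mul_inv_cancel_left]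
  · rintro P γ Q q ⟨hP, rfl, -⟩
    exact hP' P hP
  · rintro P γ Q q ⟨hP, rfl, hq, -⟩ p hp
    refine ⟨((Φ γ * k P)⁻¹ * q)⁻¹ * ((k P)⁻¹ * Φ p * k P),
      Subgroup.mul_mem _ (Subgroup.inv_mem _ hq) (hk P hP p hp), ?_⟩
    have e : q * (((Φ γ * k P)⁻¹ * q)⁻¹ * ((k P)⁻¹ * Φ p * k P)) = Φ (γ * p) * k P := by
      rw [map_mul]; group
    rw [e, mul_smul, dist_smul, dist_comm]
    linarith [hR' P hP, dist_nonneg (x := (k P)⁻¹ • M'.o) (y := M'.o)]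
  · intro P hP γ
    refine ⟨P' P, Φ γ * k P, hP, rfl, by simp, ?_⟩
    rw [mul_smul, dist_smul, dist_comm]
    linarith [hR' P hP, dist_nonneg (x := (k P)⁻¹ • M'.o) (y := M'.o)]
  · rintro P γ₁ γ₂ P₁ P₂ q₁ q₂ ⟨hP, rfl, h1, -⟩ ⟨-, rfl, h2, -⟩ hγ
    refine ⟨rfl, ?_⟩
    have := Subgroup.mul_mem _ (Subgroup.mul_mem _ (Subgroup.inv_mem _ h1) (hk P hP _ hγ)) h2
    convert this using 1
    rw [map_mul, map_inv]
    group
  · rintro P γ Q q g ⟨hP, rfl, h1, h2⟩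
    refine ⟨hP, rfl, ?_, ?_⟩
    · convert h1 using 1
      rw [map_mul]
      group
    · rwa [map_mul, mul_smul, mul_smul, dist_smul]

theorem Corresponds.smul {Φ : G →* G'}
    (hA : ∀ P γ P' q k, A P γ P' q → A P (k * γ) P' (Φ k * q)) {C : ℝ} {x : X} {x' : X'}
    (h : Corresponds M M' Φ A C x x') (k : G) : Corresponds M M' Φ A C (k • x) (Φ k • x') := by
  rcases h with ⟨γ, h1, h2⟩ | ⟨P, hP, γ, P', q, h, t, h1, h2⟩
  · refine Or.inl ⟨k * γ, ?_, ?_⟩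
    · rwa [mul_smul, dist_smul]
    · rwa [map_mul, mul_smul, dist_smul]
  · refine Or.inr ⟨P, hP, k * γ, P', Φ k * q, hA _ _ _ _ _ h, t, ?_, ?_⟩
    · rwa [mul_smul, dist_smul]
    · rwa [mul_smul, dist_smul]

/-- F (γ x) and Φ(γ) F x both correspond to γ x. -/
theorem IsCosetMap.isRoughlyEquivariant {Φ : G →* G'} (h : IsCosetMap M M' Φ R A)
    (hA : ∀ P γ P' q k, A P γ P' q → A P (k * γ) P' (Φ k * q)) {F : X → X'} {C : ℝ}
    (hF : ∀ x, Corresponds M M' Φ A C x (F x)) : IsRoughlyEquivariant Φ F := by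
  obtain ⟨r, hr⟩ := h.exists_dist_le C 0
  exact ⟨r, fun γ x => hr (γ • x) (γ • x) _ _ (hF _) ((hF x).smul hA γ) (by simp)⟩

theorem IsRoughlyEquivariant.boundary_smul {δ' : ℝ} (hX' : IsHyperbolic X' δ') {F : X → X'}
    (hF : IsRoughlyEquivariant φ F) {f : GromovBoundary X → GromovBoundary X'}
    (hf : InducesOnBoundary F f) (γ : G) (ξ : GromovBoundary X) : f (γ • ξ) = φ γ • f ξ := by
  obtain ⟨ν, hν⟩ := hF
  obtain ⟨c, rfl⟩ := exists_endpoint ξ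
  have hc := c.convergesToBoundary
  refine hX'.inducesOnBoundary_unique hf (convergesToBoundary_smul γ hc) ?_
  refine hX'.convergesToBoundary_of_dist (convergesToBoundary_smul (φ γ) (hf _ _ hc)) (B := ν)
    fun i => ?_
  rw [dist_comm]
  exact hν γ _

theorem IsIsomorphismOfPairs.exists_conj {Φ : G ≃* G'} (h : IsIsomorphismOfPairs ℙ ℙ' Φ) :
    (∀ P ∈ ℙ, ∃ P' ∈ ℙ', ∃ k : G', ∀ p ∈ P, k⁻¹ * Φ p * k ∈ P') ∧
      ∀ P' ∈ ℙ', ∃ P ∈ ℙ, ∃ k : G, ∀ p ∈ P', k⁻¹ * Φ.symm p * k ∈ P := by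
  constructor
  · intro P hP
    obtain ⟨P', hP', k, rfl⟩ := h.1 P hP
    refine ⟨_, hP', k⁻¹, fun p hp => ?_⟩
    rw [inv_inv]
    exact Subgroup.mem_map_of_mem _ (Subgroup.mem_map_of_mem _ hp)
  · intro P' hP'
    obtain ⟨P, hP, k, rfl⟩ := h.2 P' hP'
    refine ⟨P, hP, Φ.symm k, ?_⟩
    rintro _ ⟨_, ⟨p, hp, rfl⟩, rfl⟩
    simpa [mul_assoc] using hp

end Extension

end CuspedSpaces

open CuspedSpaces in
/-- Cusp extension theorem. -/
theorem theorem1p2 {Γ Γ' X X' : Type*} [Group Γ] [Group Γ'] [MetricSpace X] [MetricSpace X']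
    [MulAction Γ X] [IsIsometricSMul Γ X] [MulAction Γ' X'] [IsIsometricSMul Γ' X']
    (ℙ : Set (Subgroup Γ)) (ℙ' : Set (Subgroup Γ')) (S : Set Γ) (S' : Set Γ')
    (hS : IsFiniteGeneratingSet S) (hS' : IsFiniteGeneratingSet S')
    (hX : IsCuspedSpace X ℙ) (hX' : IsCuspedSpace X' ℙ') :
    (∀ φ : Γ → Γ', IsCoarseLipschitzMapOfPairs S ℙ S' ℙ' φ →
      ∃ F : X → X', IsCuspExtension φ F ∧ IsCoarseLipschitz dist dist F) ∧
    (∀ φ : Γ → Γ', IsQuasiIsometryOfPairs S ℙ S' ℙ' φ →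
      ∃ (F : X → X') (f : GromovBoundary X → GromovBoundary X'),
        IsCuspExtension φ F ∧ IsQuasiIsometry dist dist F ∧
        InducesOnBoundary F f ∧ IsBoundaryQuasisymmetry f) ∧
    (∀ Φ : Γ ≃* Γ', IsIsomorphismOfPairs ℙ ℙ' Φ →
      ∃ (F : X → X') (f : GromovBoundary X → GromovBoundary X'),
        IsCuspExtension Φ F ∧ IsQuasiIsometry dist dist F ∧ IsRoughlyEquivariant Φ F ∧
        InducesOnBoundary F f ∧ IsBoundaryQuasisymmetry f ∧
        ∀ (γ : Γ) (ξ : GromovBoundary X), f (γ • ξ) = Φ γ • f ξ) := by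
  obtain ⟨M⟩ := exists_cuspModel hX
  obtain ⟨M'⟩ := exists_cuspModel hX'
  obtain ⟨δ, ℬ, hU, -⟩ := hX
  obtain ⟨δ', ℬ', hU', -⟩ := hX'
  have hH := hU.hyperbolic
  have hH' := hU'.hyperbolic
  have := hU.proper
  have := hU'.proper
  have : Nonempty X := ⟨M.o⟩
  have : Nonempty X' := ⟨M'.o⟩
  refine ⟨fun φ hφ => ?_, fun φ ⟨hφ, ψ, hψ, ε, h1, h2⟩ => ?_, fun Φ hΦ => ?_⟩
  · obtain ⟨R, A, h⟩ := hφ.exists_isCosetMap hS' M M'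
    obtain ⟨C, hC, hF⟩ := h.exists_corresponds
    choose F hF using hF
    exact ⟨F, h.isCuspExtension hC hF, h.isCoarseLipschitz hH.1 hF⟩
  · obtain ⟨R, A, h⟩ := hφ.exists_isCosetMap hS' M M'
    obtain ⟨R', A', h'⟩ := hψ.exists_isCosetMap hS M' M
    obtain ⟨C, hC, hF⟩ := h.exists_corresponds
    choose F hF using hF
    obtain ⟨K, hK, hd⟩ := exists_dist_smul_le_wordDist hS M.o
    obtain ⟨K', hK', hd'⟩ := exists_dist_smul_le_wordDist hS' M'.o
    have hQ : IsQuasiIsometry dist dist F := h.isQuasiIsometry hH hH' h'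
      (E := max (K * ε) (K' * ε))
      (fun γ => (hd _ _).trans (le_max_of_le_left (by gcongr; exact h1 γ)))
      (fun γ => (hd' _ _).trans (le_max_of_le_right (by gcongr; exact h2 γ))) hF
    obtain ⟨f, hf, hf'⟩ := hQ.exists_boundaryQuasisymmetry hH hH'
    exact ⟨F, f, h.isCuspExtension hC hF, hQ, hf, hf'⟩
  · obtain ⟨R, A, h, hA⟩ := exists_isCosetMap_of_conj hU.finite_peripheral Φ.toMonoidHom M M'
      hΦ.exists_conj.1
    obtain ⟨R', A', h', -⟩ := exists_isCosetMap_of_conj hU'.finite_peripheral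
      Φ.symm.toMonoidHom M' M hΦ.exists_conj.2
    obtain ⟨C, hC, hF⟩ := h.exists_corresponds
    choose F hF using hF
    have hQ : IsQuasiIsometry dist dist F := h.isQuasiIsometry hH hH' h' (E := 0)
      (fun γ => by simp) (fun γ => by simp) hF
    have hE : IsRoughlyEquivariant Φ F := h.isRoughlyEquivariant hA hF
    obtain ⟨f, hf, hf'⟩ := hQ.exists_boundaryQuasisymmetry hH hH'
    exact ⟨F, f, h.isCuspExtension hC hF, hQ, hE, hf, hf', hE.boundary_smul hH' hf⟩
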